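/- Let $\alpha\in(0,2]$, $\tau>0$ and $n=\lceil\alpha\rceil\in\{1,2\}$. For $\beta>0$ let $I^\beta f(t)=\frac1{\Gamma(\beta)}\int_0^t(t-v)^{\beta-1}f(v)\,dv$ and $I^0f=f$. The Caputo derivative is ${}^{C}D^\alpha f=I^{n-\alpha}[f^{(n)}]$; the Riemann--Liouville derivative is ${}^{RL}D^\alpha f=\frac{d^n}{dt^n}I^{n-\alpha}f$, and ${}^{RL}D^{-\beta}=I^\beta$ for $\beta\ge0$. For real coefficients consider, with $x\in\mathbb R$, $t>0$, $\hat u_j(x,t)=u_j(x,t-\tau)$ and $k=1,2$, the system $$\partial_t^\alpha u_k=\partial_x\big[(a_{k2}u_2+a_{k1}u_1+a_{k0})\partial_xu_1+(b_{k2}u_2+b_{k1}u_1+b_{k0})\partial_xu_2\big]+\gamma_{k2}u_2+\gamma_{k1}u_1+\gamma_{k0}+\hat\gamma_{k1}\hat u_1+\hat\gamma_{k2}\hat u_2,\tag{1}$$ where $\partial_t^\alpha$ is the Caputo or the Riemann--Liouville derivative in $t$, with the history $u_k(x,t)=\varphi_{k,1}(t)+\varphi_{k,2}(t)x$ for $t\in[-\tau,0]$.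 **(A) Invariance.** For all coefficients, the right-hand side of (1), as a function of $x$, lies in $\mathcal L\{1,x\}\times\mathcal L\{1,x\}$ whenever $(u_1,u_2)$ and $(\hat u_1,\hat u_2)$ do. **(B) Solutions.** Assume from now on $a_{k2}=-b_{k1}$, $a_{k1}=b_{k2}=0$ $(k=1,2)$ and $\gamma_{21}=\hat\gamma_{21}=0$. Let $E^{c}_{a,b}(z)=\sum_{p\ge0}\frac{\Gamma(c+p)z^p}{p!\,\Gamma(c)\,\Gamma(ap+b)}$, $(f*g)(t)=\int_0^tf(t-s)g(s)\,ds$, and $\rho_1(t)=1$ for $t<0$, $\rho_1(t)=0$ for $t\ge0$. With $\eta=t-\tau m$ put $$S^{(s)}_k(t)=\sum_{m=0}^{\lfloor t/\tau\rfloor}\hat\gamma_{kk}^{\,m}\,\eta^{\alpha(m+1)+s-1}E^{m+1}_{\alpha,\alpha(m+1)+s}(\gamma_{kk}\eta^\alpha),$$ $$F_{k1}=S_k^{(1)},\quad F_{k2}=S_k^{(1-\alpha)},\quad F_{k3}=S_k^{(0)},\quad F_{k4}=S_k^{(2-\alpha)},\quad G_{k1}=S_k^{(0)},\quad G_{k2}=S_k^{(-1)}.$$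 Given functions $H_{k,i}$ on $(0,\infty)$, let $\delta_{k,i}=\varphi_{k,i}$ on $[-\tau,0]$ and, for $t>0$ and $i=1,2$ (with $[i=1]$ equal to $1$ if $i=1$ and to $0$ if $i=2$), $$\delta_{2,i}(t)=[i=1]\,\gamma_{20}F_{21}(t)+H_{2,i}(t)+\hat\gamma_{22}\,F_{23}(t)*\big(\varphi_{2,i}(t-\tau)\rho_1(t-\tau)\big),$$ $$\delta_{1,i}(t)=[i=1]\,\gamma_{10}F_{11}(t)+H_{1,i}(t)+F_{13}(t)*\Big[\big(\hat\gamma_{11}\varphi_{1,i}(t-\tau)+\hat\gamma_{12}\varphi_{2,i}(t-\tau)\big)\rho_1(t-\tau)+\hat\gamma_{12}\hat\delta_{2,i}(t-\tau)+\gamma_{12}\delta_{2,i}(t)\Big],$$ where $\hat\delta_{2,i}(t-\tau)=\delta_{2,i}(t-\tau)$ for $t\ge\tau$ and $0$ for $t<\tau$. Put $u_k(x,t)=\delta_{k,1}(t)+\delta_{k,2}(t)x$. *Caputo.* Let the $\varphi_{k,i}$ be absolutely continuous on $[-\tau,0]$, let $\beta_{k,i}=\varphi_{k,i}(0)$, $\kappa_{k,i}\in\mathbb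 R$, and let $H_{k,i}=\beta_{k,i}F_{k2}$ if $\alpha\le1$, $H_{k,i}=\beta_{k,i}F_{k2}+\kappa_{k,i}F_{k4}$ if $\alpha>1$. Then $(u_1,u_2)$ satisfies (1) with the Caputo derivative for all $x\in\mathbb R$ and $t>0$: each $u_k(x,\cdot)$ is $C^{n-1}$ on $[0,\infty)$ with locally absolutely continuous $(n-1)$-st derivative, the integral in the Caputo derivative converges absolutely for every $t>0$, and if $\alpha=n$ then $\partial_t^nu_k(x,t)$ exists for every $t>0$. It has the given history and lies in $\mathcal L\{1,x\}\times\mathcal L\{1,x\}$ at each time, and $u_k(x,0)=\beta_{k,1}+\beta_{k,2}x$. If $\alpha>1$, then $\delta_{k,i}'(0^+)=\kappa_{k,i}$ and $\partial_tu_k(x,0^+)=\kappa_{k,1}+\kappa_{k,2}x$. For every $\alpha$, if the right derivatives $\delta_{k,i}'(0^+)=\kappa'_{k,i}$ exist, then $\partial_tu_k(x,0^+)=\kappa'_{k,1}+\kappa'_{k,2}x$. *Riemann--Liouville.* Let the $\varphi_{k,i}$ be continuous on $[-\tau,0]$, let $\hat\beta_{k,i},\hat\kappa_{k,i}\in\mathbb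 R$, and let $H_{k,i}=\hat\beta_{k,i}G_{k1}$ if $\alpha\le1$, $H_{k,i}=\hat\beta_{k,i}G_{k1}+\hat\kappa_{k,i}G_{k2}$ if $\alpha>1$. Then $(u_1,u_2)$ satisfies (1) with the Riemann--Liouville derivative, which exists, for all $x\in\mathbb R$ and all $t>0$ that are not integer multiples of $\tau$, and also at those multiples $t>0$ of $\tau$ for which all $\delta_{k,i}$ are continuous at $t$ and at $t-\tau$. It has the given history and lies in $\mathcal L\{1,x\}\times\mathcal L\{1,x\}$ at each time. As $t\to0^+$, ${}^{RL}D^{\alpha-1}\delta_{k,i}\to\hat\beta_{k,i}$ and ${}^{RL}D^{\alpha-1}_tu_k(x,\cdot)\to\hat\beta_{k,1}+\hat\beta_{k,2}x$, and ${}^{RL}D^{\alpha-2}\delta_{k,i}$, ${}^{RL}D_t^{\alpha-2}u_k(x,\cdot)$ tend to $\hat\kappa_{k,i}$, $\hat\kappa_{k,1}+\hat\kappa_{k,2}x$ if $\alpha>1$ and to $0$ if $\alpha\le1$. In both cases, $u_k(0,t)=\delta_{k,1}(t)$ and $u_k(\lambda,t)=\delta_{k,1}(t)+\lambda\delta_{k,2}(t)$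 for every $\lambda\in\mathbb R$. -/

import Mathlib

open MeasureTheory Filter Topology Set

noncomputable section

namespace DelayDR

/-! ### Fractional calculus in the time variable -/

/-- The Riemann-Liouville integral `I^β f (t) = Γ(β)⁻¹ ∫_0^t (t - v)^(β - 1) f(v) dv` of order
`β > 0`, with the usual convention `I^0 f = f`. -/
def rlIntegral (β : ℝ) (f : ℝ → ℝ) (t : ℝ) : ℝ :=
  if β = 0 then f t
  else (Real.Gamma β)⁻¹ * ∫ v in (0 : ℝ)..t, (t - v) ^ (β - 1) * f v

/-- The integral defining `I^β f (t)` converges absolutely (nothing is required if `β = 0`). -/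
def RLIntegrableAt (β : ℝ) (f : ℝ → ℝ) (t : ℝ) : Prop :=
  β ≠ 0 → IntervalIntegrable (fun v => (t - v) ^ (β - 1) * f v) volume 0 t

/-- The Caputo derivative `I^(n - α) [f^(n)] (t)` with `n - 1 < α ≤ n`, for `t > 0`.
Derivatives are taken in `[0, ∞)`, hence are one-sided at `0` and ordinary ones at `t > 0`. -/
def caputoDeriv (α : ℝ) (f : ℝ → ℝ) (t : ℝ) : ℝ :=
  rlIntegral (⌈α⌉₊ - α) (iteratedDerivWithin ⌈α⌉₊ f (Ici 0)) t

/-- The Caputo derivative of order `α > 0` of `f` at `t > 0` is well defined: with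
`n - 1 < α ≤ n`, `f` is `C^(n-1)` on `[0, ∞)`, `f^(n-1)` is locally absolutely continuous there,
the integral that defines the fractional derivative at `t` converges absolutely, and if `α = n`
then `f^(n)(t)` exists. -/
structure CaputoDifferentiableAt (α : ℝ) (f : ℝ → ℝ) (t : ℝ) : Prop where
  contDiffOn : ContDiffOn ℝ ((⌈α⌉₊ - 1 : ℕ)) f (Ici 0)
  absCont : ∀ T : ℝ, 0 < T →
    AbsolutelyContinuousOnInterval (iteratedDerivWithin (⌈α⌉₊ - 1) f (Ici 0)) 0 T
  integrable : RLIntegrableAt (⌈α⌉₊ - α) (iteratedDerivWithin ⌈α⌉₊ f (Ici 0)) t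
  differentiableAt : α = ⌈α⌉₊ →
    DifferentiableAt ℝ (iteratedDerivWithin (⌈α⌉₊ - 1) f (Ici 0)) t

/-- The Riemann-Liouville derivative `(d/dt)^n [I^(n - α) f] (t)` with `n - 1 < α ≤ n`, for
`t > 0`. For `α ≤ 0` one has `n = 0`, and this is the fractional integral `I^(-α) f (t)`. -/
def rlDeriv (α : ℝ) (f : ℝ → ℝ) (t : ℝ) : ℝ :=
  iteratedDeriv ⌈α⌉₊ (rlIntegral (⌈α⌉₊ - α) f) t

/-- The Riemann-Liouville derivative of order `α` of `f` at `t > 0` is well defined: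
`I^(n - α) f` is given by absolutely convergent integrals near `t`, and it is `n` times
differentiable at `t`. -/
structure RLDifferentiableAt (α : ℝ) (f : ℝ → ℝ) (t : ℝ) : Prop where
  integrable : ∀ᶠ s in 𝓝 t, RLIntegrableAt (⌈α⌉₊ - α) f s
  eventually_differentiableAt : ∀ j : ℕ, j + 1 < ⌈α⌉₊ →
    ∀ᶠ s in 𝓝 t, DifferentiableAt ℝ (iteratedDeriv j (rlIntegral (⌈α⌉₊ - α) f)) s
  differentiableAt : ∀ j : ℕ, j < ⌈α⌉₊ →
    DifferentiableAt ℝ (iteratedDeriv j (rlIntegral (⌈α⌉₊ - α) f)) t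

/-! ### The system -/

/-- The coefficients. The component index `k ∈ {1, 2}` is `0, 1 : Fin 2`;
`a k j`, `b k j`, `γ k j` for `j = 0, 1, 2` are `a_{kj}`, `b_{kj}`, `γ_{kj}`;
`γhat k 0` and `γhat k 1` are the coefficients of the delayed `u_1` and `u_2`. -/
structure Coeffs where
  a : Fin 2 → Fin 3 → ℝ
  b : Fin 2 → Fin 3 → ℝ
  γ : Fin 2 → Fin 3 → ℝ
  γhat : Fin 2 → Fin 2 → ℝ

/-- The `k`-th component of the diffusion-reaction operator, applied to functions of `x`:
`U 0, U 1` are `u_1, u_2` and `V 0, V 1` are the delayed `u_1, u_2`. -/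
def drOperator (P : Coeffs) (U V : Fin 2 → ℝ → ℝ) (k : Fin 2) (x : ℝ) : ℝ :=
  deriv (fun y => (P.a k 2 * U 1 y + P.a k 1 * U 0 y + P.a k 0) * deriv (U 0) y
      + (P.b k 2 * U 1 y + P.b k 1 * U 0 y + P.b k 0) * deriv (U 1) y) x
    + P.γ k 2 * U 1 x + P.γ k 1 * U 0 x + P.γ k 0
    + P.γhat k 0 * V 0 x + P.γhat k 1 * V 1 x

/-- The space `L{1, x} × L{1, x}`. -/
def polySpace : Submodule ℝ (Fin 2 → ℝ → ℝ) :=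
  Submodule.pi Set.univ
    (fun _ => Submodule.span ℝ {(fun _ : ℝ => (1 : ℝ)), (fun x : ℝ => x)})

/-- The right-hand side of the system at `(x, t)`, for `u k x t = u_k(x, t)`. -/
def delayRHS (P : Coeffs) (τ : ℝ) (u : Fin 2 → ℝ → ℝ → ℝ) (k : Fin 2) (x t : ℝ) : ℝ :=
  drOperator P (fun j y => u j y t) (fun j y => u j y (t - τ)) k x

/-- `u` is `C^2` in `x` and satisfies both equations, with Caputo derivatives in time, at time
`t` and all `x`. -/
def CaputoSolvesAt (P : Coeffs) (α τ : ℝ) (u : Fin 2 → ℝ → ℝ → ℝ) (t : ℝ) : Prop :=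
  ∀ k : Fin 2, ContDiff ℝ 2 (fun x => u k x t) ∧
    ∀ x : ℝ, CaputoDifferentiableAt α (u k x) t ∧
      caputoDeriv α (u k x) t = delayRHS P τ u k x t

/-- `u` is `C^2` in `x` and satisfies both equations, with Riemann-Liouville derivatives in time,
at time `t` and all `x`. -/
def RLSolvesAt (P : Coeffs) (α τ : ℝ) (u : Fin 2 → ℝ → ℝ → ℝ) (t : ℝ) : Prop :=
  ∀ k : Fin 2, ContDiff ℝ 2 (fun x => u k x t) ∧
    ∀ x : ℝ, RLDifferentiableAt α (u k x) t ∧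
      rlDeriv α (u k x) t = delayRHS P τ u k x t

/-! ### The explicit functions -/

/-- The three-parameter Mittag-Leffler function `E^c_{a,b}(z)`. -/
def mittagLeffler (c a b z : ℝ) : ℝ :=
  ∑' p : ℕ, Real.Gamma (c + p) * z ^ p / (p.factorial * Real.Gamma c * Real.Gamma (a * p + b))

/-- `∑_{m = 0}^{⌊t/τ⌋} (γhat_{kk})^m η^(b_m - 1) E^{m+1}_{α, b_m}(γ_{kk} η^α)` with
`η = t - τ m` and `b_m = α (m + 1) + s`. -/
def mlSum (P : Coeffs) (α τ s : ℝ) (k : Fin 2) (t : ℝ) : ℝ :=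
  ∑ m ∈ Finset.range (⌊t / τ⌋₊ + 1),
    P.γhat k k ^ m * (t - τ * m) ^ (α * (m + 1) + s - 1) *
      mittagLeffler (m + 1) α (α * (m + 1) + s) (P.γ k k.succ * (t - τ * m) ^ α)

/-- `F_{k1}`: terms `η^(α(m+1)) E^{m+1}_{α, α(m+1)+1}`. -/
def mlF1 (P : Coeffs) (α τ : ℝ) : Fin 2 → ℝ → ℝ := mlSum P α τ 1

/-- `F_{k2}`: terms `η^(αm) E^{m+1}_{α, αm+1}`. -/
def mlF2 (P : Coeffs) (α τ : ℝ) : Fin 2 → ℝ → ℝ := mlSum P α τ (1 - α)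

/-- `F_{k3}`: terms `η^(α(m+1)-1) E^{m+1}_{α, α(m+1)}`. -/
def mlF3 (P : Coeffs) (α τ : ℝ) : Fin 2 → ℝ → ℝ := mlSum P α τ 0

/-- `F_{k4}`: terms `η^(αm+1) E^{m+1}_{α, αm+2}`. -/
def mlF4 (P : Coeffs) (α τ : ℝ) : Fin 2 → ℝ → ℝ := mlSum P α τ (2 - α)

/-- `G_{k1}`: terms `η^(α(m+1)-1) E^{m+1}_{α, α(m+1)}`. -/
def mlG1 (P : Coeffs) (α τ : ℝ) : Fin 2 → ℝ → ℝ := mlSum P α τ 0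

/-- `G_{k2}`: terms `η^(α(m+1)-2) E^{m+1}_{α, α(m+1)-1}`. -/
def mlG2 (P : Coeffs) (α τ : ℝ) : Fin 2 → ℝ → ℝ := mlSum P α τ (-1)

/-- The convolution product of functions on `[0, ∞)`. -/
def conv (f g : ℝ → ℝ) (t : ℝ) : ℝ := ∫ s in (0 : ℝ)..t, f (t - s) * g s

/-- `ρ_1`, the indicator function of the negative half-line. -/
def rho (t : ℝ) : ℝ := if 0 ≤ t then 0 else 1

/-- The functions `δ_{2,i}`, from the history `φ` and the contribution `H` of the initial data;
`i = 0, 1` are the coefficients of `1` and `x`. -/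
def deltaTwo (P : Coeffs) (α τ : ℝ) (φ H : Fin 2 → Fin 2 → ℝ → ℝ) (i : Fin 2) (t : ℝ) : ℝ :=
  if t ≤ 0 then φ 1 i t
  else (if i = 0 then P.γ 1 0 * mlF1 P α τ 1 t else 0) + H 1 i t
    + P.γhat 1 1 * conv (mlF3 P α τ 1) (fun s => φ 1 i (s - τ) * rho (s - τ)) t

/-- The functions `δ_{1,i}`. In the convolution, the delayed `δ_{2,i}(s - τ)` is cut off to `0`
for `s < τ`, where the history enters instead. -/
def deltaOne (P : Coeffs) (α τ : ℝ) (φ H : Fin 2 → Fin 2 → ℝ → ℝ) (i : Fin 2) (t : ℝ) : ℝ :=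
  if t ≤ 0 then φ 0 i t
  else (if i = 0 then P.γ 0 0 * mlF1 P α τ 0 t else 0) + H 0 i t
    + conv (mlF3 P α τ 0) (fun s =>
        (P.γhat 0 0 * φ 0 i (s - τ) + P.γhat 0 1 * φ 1 i (s - τ)) * rho (s - τ)
        + P.γhat 0 1 * (if τ ≤ s then deltaTwo P α τ φ H i (s - τ) else 0)
        + P.γ 0 2 * deltaTwo P α τ φ H i s) t

/-- `δ_{k,i}` for the Caputo derivative, with `β_{k,i} = φ_{k,i}(0)`. -/
def caputoDelta (P : Coeffs) (α τ : ℝ) (φ : Fin 2 → Fin 2 → ℝ → ℝ) (κ : Fin 2 → Fin 2 → ℝ) :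
    Fin 2 → Fin 2 → ℝ → ℝ :=
  let H : Fin 2 → Fin 2 → ℝ → ℝ := fun k i t =>
    φ k i 0 * mlF2 P α τ k t + (if 1 < α then κ k i * mlF4 P α τ k t else 0)
  ![deltaOne P α τ φ H, deltaTwo P α τ φ H]

/-- `δ_{k,i}` for the Riemann-Liouville derivative. -/
def rlDelta (P : Coeffs) (α τ : ℝ) (φ : Fin 2 → Fin 2 → ℝ → ℝ) (β κ : Fin 2 → Fin 2 → ℝ) :
    Fin 2 → Fin 2 → ℝ → ℝ :=
  let H : Fin 2 → Fin 2 → ℝ → ℝ := fun k i t =>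
    β k i * mlG1 P α τ k t + (if 1 < α then κ k i * mlG2 P α τ k t else 0)
  ![deltaOne P α τ φ H, deltaTwo P α τ φ H]

/-- The separable form `u_k(x, t) = δ_{k,1}(t) + δ_{k,2}(t) x`. -/
def sepForm (δ : Fin 2 → Fin 2 → ℝ → ℝ) (k : Fin 2) (x t : ℝ) : ℝ := δ k 0 t + δ k 1 t * x

end DelayDR

end

/-!
The reaction part of the system is triangular (`u_2` does not feel `u_1`), and the constraints on
the diffusion coefficients cancel every quadratic contribution of affine functions of `x`. So for
`u_k = δ_{k,1} + δ_{k,2} x` the system splits into scalar linear delay equations for the `δ_{k,i}`,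
first for `δ_{2,i}` and then for `δ_{1,i}` with `δ_{2,i}` as a source (`Problem.delayRHS_sepForm`).

Write `h_b(t) = t^(b-1) / Γ(b)` for `t > 0` and `h_b(t) = 0` otherwise (`pk`), so that
`I^b f = h_b * f` and `h_a * h_b = h_{a+b}`, and work with locally integrable functions on `ℝ`
vanishing on `(-∞, 0]` (`Causal`). Expanding the Mittag-Leffler functions, the explicit kernels are
`S^{(s)} = ∑_{m,p} (m+p choose m) γhat^m γ^p h_{α(m+p+1)+s}(· - τ m)` (`delayKernel`), convergent
since `Γ` outgrows every geometric sequence (`summable_mittagLeffler`). Termwise integration gives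
`h_a * S^{(s)} = S^{(s+a)}` (`cv_pk_delayKernel`), and Pascal's rule gives
`S^{(s)} = h_{α+s} + γ S^{(s+α)} + γhat S^{(s+α)}(· - τ)` (`delayKernel_pascal`). Together they are
the resolvent equation `S^{(s)} = h_{α+s} + I^α (γ S^{(s)} + γhat S^{(s)}(· - τ))`; convolving the
one for `K = S^{(0)}` with a source `f` shows that `δ = c S^{(1)} + b₁ S^{(s₁)} + b₂ S^{(s₂)} + K * f`
solves the integral equation `δ = b₁ h_{α+s₁} + b₂ h_{α+s₂} + I^α g`, where `g` is the right-hand side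
of the differential equation (`solFun_ae`, `solFun_of_one_le`).

Riemann-Liouville case (`s₁ = 0`, `s₂ = -1`). Applying `I^(n-α)` to the integral equation gives
`b₁ h_n + b₂ h_{n-1} + I^n g` at every `t > 0`; this is `n` times differentiable with `n`-th
derivative `g` wherever `g` is continuous, and its behaviour at `0` gives the initial conditions
(`rl_of_integral_eq`). The `δ_{k,i}` are continuous off the multiples of `τ` because convolution
preserves this property (`continuousOn_cv_offGrid`).

Caputo case (`s₁ = 1 - α`, `s₂ = 2 - α`). The integral equation reads `δ = b₁ + b₂ t + I^α g`, and
it yields the Caputo equation if `g` is locally absolutely continuous (`caputo_of_integral_eq`).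
Convolution with `K` maps a primitive with two jumps, such as the delayed history, to a primitive
(`JumpPrimitive.cv_eq`); hence `δ` is absolutely continuous, and the jump of the delayed history at
`τ` cancels against that of the delayed solution because `b₁` is the value of the history at `0`
(`solFun_eq_of_jumpPrimitive`).
-/

namespace DelayDR

/-! ### Convolution of causal functions -/

/-- Locally integrable functions on `ℝ` that vanish on `(-∞, 0]`. -/
structure Causal (f : ℝ → ℝ) : Prop where
  zero : ∀ t ≤ 0, f t = 0
  locInt : LocallyIntegrable f volume

/-- Boundedness on every half-line `(-∞, T]`. -/
def LocBdd (f : ℝ → ℝ) : Prop := ∀ T : ℝ, ∃ C : ℝ, ∀ t ≤ T, |f t| ≤ C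

/-- The convolution product on `ℝ`. -/
noncomputable def cv (f g : ℝ → ℝ) (t : ℝ) : ℝ := ∫ s, f s * g (t - s)

/-- The integral defining `cv f g t` converges absolutely. -/
def CvEx (f g : ℝ → ℝ) (t : ℝ) : Prop := Integrable (fun s => f s * g (t - s))

/-- The function `f` delayed by `c`. -/
def shift (c : ℝ) (f : ℝ → ℝ) (t : ℝ) : ℝ := f (t - c)

lemma cv_comm (f g : ℝ → ℝ) : cv f g = cv g f := by
  ext t
  unfold cv
  rw [← integral_sub_left_eq_self _ volume t]
  simp [mul_comm]

lemma CvEx.symm {f g : ℝ → ℝ} {t : ℝ} (h : CvEx f g t) : CvEx g f t := by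
  have := Integrable.comp_sub_left h t
  simpa [CvEx, mul_comm] using this

namespace Causal

variable {f g k : ℝ → ℝ}

lemma integrableOn_Iic (hf : Causal f) (T : ℝ) : IntegrableOn f (Iic T) := by
  have h1 : IntegrableOn f (Icc 0 T) := hf.locInt.integrableOn_isCompact isCompact_Icc
  have h2 : IntegrableOn f (Iic 0) :=
    (integrableOn_zero : IntegrableOn (fun _ : ℝ => (0 : ℝ)) (Iic 0) volume).congr_fun
      (fun t ht => (hf.zero t ht).symm) measurableSet_Iic
  refine (h2.union h1).mono_set fun t ht => ?_
  rcases le_total t 0 with h | h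
  · exact Or.inl h
  · exact Or.inr ⟨h, ht⟩

lemma integrable_trunc (hf : Causal f) (T : ℝ) : Integrable ((Iic T).indicator f) :=
  (integrable_indicator_iff measurableSet_Iic).2 (hf.integrableOn_Iic T)

lemma intervalIntegrable (hf : Causal f) (a b : ℝ) : IntervalIntegrable f volume a b :=
  (hf.locInt.integrableOn_isCompact isCompact_uIcc).intervalIntegrable

lemma aesm (hf : Causal f) : AEStronglyMeasurable f volume := hf.locInt.aestronglyMeasurable

lemma add (hf : Causal f) (hg : Causal g) : Causal (fun t => f t + g t) :=
  ⟨fun t ht => by simp [hf.zero t ht, hg.zero t ht], hf.locInt.add hg.locInt⟩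

lemma const_mul (hf : Causal f) (c : ℝ) : Causal (fun t => c * f t) :=
  ⟨fun t ht => by simp [hf.zero t ht], hf.locInt.smul c⟩

lemma abs (hf : Causal f) : Causal (fun t => |f t|) :=
  ⟨fun t ht => by simp [hf.zero t ht], fun x => (hf.locInt x).norm⟩

lemma of_integrableOn (h0 : ∀ t ≤ 0, f t = 0) (h : ∀ T, IntegrableOn f (Iic T)) : Causal f := by
  refine ⟨h0, fun x => ⟨Iic (x + 1), Iic_mem_nhds (by linarith), h _⟩⟩

lemma shift (hf : Causal f) {c : ℝ} (hc : 0 ≤ c) : Causal (shift c f) := by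
  refine of_integrableOn (fun t ht => hf.zero _ (by linarith)) fun T => ?_
  rw [← integrable_indicator_iff measurableSet_Iic]
  refine ((hf.integrable_trunc (T - c)).comp_sub_right c).congr (Eventually.of_forall fun t => ?_)
  simp [indicator, DelayDR.shift]

end Causal

section
variable {f f' g g' k : ℝ → ℝ}

/-- The integrand of `cv f g t` only depends on the values of `f` and `g` on `(0, t)`. -/
lemma cv_integrand_congr (hf : ∀ t ≤ 0, f t = 0) (hg : ∀ t ≤ 0, g t = 0)
    (hf' : ∀ t ≤ 0, f' t = 0) (hg' : ∀ t ≤ 0, g' t = 0) {t : ℝ}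
    (h1 : ∀ᵐ s, s < t → f s = f' s) (h2 : ∀ᵐ s, s < t → g s = g' s) :
    (fun s => f s * g (t - s)) =ᵐ[volume] fun s => f' s * g' (t - s) := by
  have h3 : ∀ᵐ s, t - s < t → g (t - s) = g' (t - s) :=
    (Measure.measurePreserving_sub_left volume t).quasiMeasurePreserving.ae h2
  filter_upwards [h1, h3] with s a b
  rcases lt_or_ge s t with hs | hs
  · rcases le_or_gt s 0 with h | h
    · simp [hf s h, hf' s h]
    · rw [a hs, b (by linarith)]
  · simp [hg (t - s) (by linarith), hg' (t - s) (by linarith)]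

lemma cv_congr (hf : ∀ t ≤ 0, f t = 0) (hg : ∀ t ≤ 0, g t = 0)
    (hf' : ∀ t ≤ 0, f' t = 0) (hg' : ∀ t ≤ 0, g' t = 0) {t : ℝ}
    (h1 : ∀ᵐ s, s < t → f s = f' s) (h2 : ∀ᵐ s, s < t → g s = g' s) :
    cv f g t = cv f' g' t :=
  integral_congr_ae (cv_integrand_congr hf hg hf' hg' h1 h2)

lemma CvEx.congr (hf : ∀ t ≤ 0, f t = 0) (hg : ∀ t ≤ 0, g t = 0)
    (hf' : ∀ t ≤ 0, f' t = 0) (hg' : ∀ t ≤ 0, g' t = 0) {t : ℝ}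
    (h1 : ∀ᵐ s, s < t → f s = f' s) (h2 : ∀ᵐ s, s < t → g s = g' s) (h : CvEx f g t) :
    CvEx f' g' t :=
  Integrable.congr h (cv_integrand_congr hf hg hf' hg' h1 h2)

/-- For functions vanishing on `(-∞, 0]` the convolution is an integral over `[0, t]`. -/
lemma cv_eq_intervalIntegral (hf : ∀ t ≤ 0, f t = 0) (hg : ∀ t ≤ 0, g t = 0) {t : ℝ}
    (ht : 0 ≤ t) : cv f g t = ∫ s in (0 : ℝ)..t, f s * g (t - s) := by
  rw [intervalIntegral.integral_of_le ht, cv, ← integral_indicator measurableSet_Ioc]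
  congr 1; ext s
  by_cases hs : s ∈ Ioc 0 t
  · simp [hs]
  · rw [indicator_of_notMem hs]
    rcases le_or_gt s 0 with h | h
    · simp [hf s h]
    · have : ¬ s ≤ t := fun h' => hs ⟨h, h'⟩
      simp [hg (t - s) (by linarith)]

lemma cvEx_iff_intervalIntegrable (hf : ∀ t ≤ 0, f t = 0) (hg : ∀ t ≤ 0, g t = 0) {t : ℝ}
    (ht : 0 ≤ t) :
    CvEx f g t ↔ IntervalIntegrable (fun s => f s * g (t - s)) volume 0 t := by
  rw [intervalIntegrable_iff, uIoc_of_le ht, CvEx, ← integrable_indicator_iff measurableSet_Ioc]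
  have : (fun s => f s * g (t - s)) = (Ioc 0 t).indicator (fun s => f s * g (t - s)) := by
    ext s
    by_cases hs : s ∈ Ioc 0 t
    · simp [hs]
    · rw [indicator_of_notMem hs]
      rcases le_or_gt s 0 with h | h
      · simp [hf s h]
      · have : ¬ s ≤ t := fun h' => hs ⟨h, h'⟩
        simp [hg (t - s) (by linarith)]
  rw [← this]

lemma cv_of_nonpos (hf : ∀ t ≤ 0, f t = 0) (hg : ∀ t ≤ 0, g t = 0) {t : ℝ} (ht : t ≤ 0) :
    cv f g t = 0 := by
  rw [cv, ← integral_zero ℝ ℝ (μ := volume)]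
  congr 1; ext s
  rcases le_or_gt s 0 with h | h
  · simp [hf s h]
  · simp [hg (t - s) (by linarith)]

lemma trunc_zero (hf : ∀ t ≤ 0, f t = 0) (T : ℝ) : ∀ t ≤ 0, (Iic T).indicator f t = 0 :=
  fun t ht => by simp [indicator, hf t ht]

lemma trunc_ae (f : ℝ → ℝ) {t T : ℝ} (h : t ≤ T) : ∀ᵐ s, s < t → f s = (Iic T).indicator f s :=
  Eventually.of_forall fun s hs => by
    rw [indicator_of_mem]; exact (hs.le.trans h)

lemma cv_trunc (hf : ∀ t ≤ 0, f t = 0) (hg : ∀ t ≤ 0, g t = 0) {t T : ℝ} (h : t ≤ T) :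
    cv f g t = cv ((Iic T).indicator f) ((Iic T).indicator g) t :=
  cv_congr hf hg (trunc_zero hf T) (trunc_zero hg T) (trunc_ae f h) (trunc_ae g h)

lemma cvEx_trunc_iff (hf : ∀ t ≤ 0, f t = 0) (hg : ∀ t ≤ 0, g t = 0) {t T : ℝ} (h : t ≤ T) :
    CvEx f g t ↔ CvEx ((Iic T).indicator f) ((Iic T).indicator g) t :=
  ⟨CvEx.congr hf hg (trunc_zero hf T) (trunc_zero hg T) (trunc_ae f h) (trunc_ae g h),
   CvEx.congr (trunc_zero hf T) (trunc_zero hg T) hf hg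
    ((trunc_ae f h).mono fun _ h hs => (h hs).symm) ((trunc_ae g h).mono fun _ h hs => (h hs).symm)⟩

lemma integrable_cv (hf : Integrable f) (hg : Integrable g) : Integrable (cv f g) :=
  hf.integrable_convolution (ContinuousLinearMap.mul ℝ ℝ) hg

lemma ae_cvEx_of_integrable (hf : Integrable f) (hg : Integrable g) : ∀ᵐ t, CvEx f g t :=
  hf.ae_convolution_exists (ContinuousLinearMap.mul ℝ ℝ) hg

/-- A property holding almost everywhere on each half-line `(-∞, T]` holds almost everywhere. -/
lemma ae_of_forall_le {p : ℝ → Prop} (h : ∀ T : ℝ, ∀ᵐ t, t ≤ T → p t) : ∀ᵐ t, p t := by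
  have := ae_all_iff.2 fun n : ℕ => h n
  filter_upwards [this] with t ht
  obtain ⟨n, hn⟩ := exists_nat_ge t
  exact ht n hn

namespace Causal

lemma ae_cvEx (hf : Causal f) (hg : Causal g) : ∀ᵐ t, CvEx f g t :=
  ae_of_forall_le fun T => by
    filter_upwards [ae_cvEx_of_integrable (hf.integrable_trunc T) (hg.integrable_trunc T)]
      with t ht htT
    exact (cvEx_trunc_iff hf.zero hg.zero htT).2 ht

lemma cv (hf : Causal f) (hg : Causal g) : Causal (cv f g) :=
  of_integrableOn (fun _ ht => cv_of_nonpos hf.zero hg.zero ht) fun T =>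
    (integrable_cv (hf.integrable_trunc T) (hg.integrable_trunc T)).integrableOn.congr_fun
      (fun _ ht => (cv_trunc hf.zero hg.zero ht).symm) measurableSet_Iic

end Causal

lemma cv_congr_ae (hf : ∀ t ≤ 0, f t = 0) (hg : ∀ t ≤ 0, g t = 0)
    (hg' : ∀ t ≤ 0, g' t = 0) (h : g =ᵐ[volume] g') : cv f g = cv f g' := by
  ext t
  exact cv_congr hf hg hf hg' (Eventually.of_forall fun _ _ => rfl) (h.mono fun _ h _ => h)

lemma cv_add {t : ℝ} (h1 : CvEx f g t) (h2 : CvEx f k t) :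
    cv f (fun s => g s + k s) t = cv f g t + cv f k t := by
  simp only [cv, mul_add]; exact integral_add h1 h2

lemma CvEx.add {t : ℝ} (h1 : CvEx f g t) (h2 : CvEx f k t) : CvEx f (fun s => g s + k s) t := by
  simp only [CvEx, mul_add]; exact Integrable.add h1 h2

lemma cv_const_mul (f g : ℝ → ℝ) (c t : ℝ) : cv f (fun s => c * g s) t = c * cv f g t := by
  simp only [cv, mul_left_comm _ c]; exact integral_const_mul _ _

lemma CvEx.const_mul {t : ℝ} (h : CvEx f g t) (c : ℝ) : CvEx f (fun s => c * g s) t := by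
  simp only [CvEx, mul_left_comm _ c]; exact Integrable.const_mul h c

lemma cv_shift (f g : ℝ → ℝ) (c : ℝ) : cv f (shift c g) = shift c (cv f g) := by
  ext t
  simp only [cv, shift]
  congr 1; ext s; rw [sub_right_comm]

lemma CvEx.shift {c t : ℝ} (h : CvEx f g (t - c)) : CvEx f (shift c g) t := by
  refine Integrable.congr h (Eventually.of_forall fun s => ?_)
  simp [DelayDR.shift, sub_right_comm]

/-! ### Associativity -/

lemma cv_assoc_ae_of_integrable (hf : Integrable f) (hg : Integrable g) (hk : Integrable k) :
    cv (cv f g) k =ᵐ[volume] cv f (cv g k) := by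
  filter_upwards [ae_cvEx_of_integrable hf.norm (integrable_cv hg.norm hk.norm)] with t ht
  exact convolution_assoc (ContinuousLinearMap.mul ℝ ℝ) (ContinuousLinearMap.mul ℝ ℝ)
    (ContinuousLinearMap.mul ℝ ℝ) (ContinuousLinearMap.mul ℝ ℝ) (fun x y z => by simp [mul_assoc])
    hf.aestronglyMeasurable hg.aestronglyMeasurable hk.aestronglyMeasurable
    (ae_cvEx_of_integrable hf hg) (ae_cvEx_of_integrable hg.norm hk.norm) ht

lemma Causal.cv_assoc_ae (hf : Causal f) (hg : Causal g) (hk : Causal k) :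
    DelayDR.cv (DelayDR.cv f g) k =ᵐ[volume] DelayDR.cv f (DelayDR.cv g k) := by
  refine ae_of_forall_le fun T => ?_
  filter_upwards [cv_assoc_ae_of_integrable (hf.integrable_trunc T) (hg.integrable_trunc T)
    (hk.integrable_trunc T)] with t ht htT
  have tz : ∀ {u v : ℝ → ℝ}, (∀ t ≤ 0, u t = 0) → (∀ t ≤ 0, v t = 0) →
    ∀ t ≤ 0, DelayDR.cv ((Iic T).indicator u) ((Iic T).indicator v) t = 0 := fun hu hv t ht =>
      cv_of_nonpos (trunc_zero hu T) (trunc_zero hv T) ht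
  have e1 : DelayDR.cv (DelayDR.cv f g) k t
      = DelayDR.cv (DelayDR.cv ((Iic T).indicator f) ((Iic T).indicator g))
        ((Iic T).indicator k) t :=
    cv_congr (hf.cv hg).zero hk.zero (tz hf.zero hg.zero) (trunc_zero hk.zero T)
      (Eventually.of_forall fun s hs => cv_trunc hf.zero hg.zero (hs.le.trans htT))
      (trunc_ae k htT)
  have e2 : DelayDR.cv f (DelayDR.cv g k) t
      = DelayDR.cv ((Iic T).indicator f)
        (DelayDR.cv ((Iic T).indicator g) ((Iic T).indicator k)) t :=
    cv_congr hf.zero (hg.cv hk).zero (trunc_zero hf.zero T) (tz hg.zero hk.zero)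
      (trunc_ae f htT)
      (Eventually.of_forall fun s hs => cv_trunc hg.zero hk.zero (hs.le.trans htT))
  rw [e1, e2]; exact ht

lemma LocBdd.cvEx (hb : LocBdd g) (hf : Causal f) (hg : Causal g) (t : ℝ) : CvEx f g t := by
  obtain ⟨C, hC⟩ := hb t
  have h0 := hf.integrable_trunc t
  refine (h0.norm.mul_const C).mono'
    (hf.aesm.mul (hg.aesm.comp_quasiMeasurePreserving
      (Measure.measurePreserving_sub_left volume t).quasiMeasurePreserving))
    (Eventually.of_forall fun s => ?_)
  rw [norm_mul]
  rcases le_or_gt s 0 with h | h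
  · simp [hf.zero s h, indicator]
  rcases le_or_gt s t with h' | h'
  · rw [indicator_of_mem (by exact h')]
    exact mul_le_mul_of_nonneg_left (hC _ (by linarith)) (norm_nonneg _)
  · simp [hg.zero (t - s) (by linarith), indicator, not_le.2 h']

lemma LocBdd.cv (hb : LocBdd g) (hf : Causal f) (hg : Causal g) : LocBdd (cv f g) := by
  intro T
  obtain ⟨C, hC⟩ := hb T
  refine ⟨∫ s, ‖(Iic T).indicator f s‖ * C, fun t ht => ?_⟩
  refine (norm_integral_le_integral_norm (μ := volume) (fun s => f s * g (t - s))).trans ?_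
  refine integral_mono_of_nonneg (Eventually.of_forall fun s => norm_nonneg _)
    ((hf.integrable_trunc T).norm.mul_const C) (Eventually.of_forall fun s => ?_)
  have hC0 : 0 ≤ C := (abs_nonneg _).trans (hC T le_rfl)
  simp only [norm_mul]
  rcases le_or_gt s 0 with h | h
  · simp [hf.zero s h, indicator]
  rcases le_or_gt s t with h' | h'
  · rw [indicator_of_mem (by exact h'.trans ht)]
    exact mul_le_mul_of_nonneg_left (hC _ (by linarith)) (norm_nonneg _)
  · simp only [hg.zero (t - s) (by linarith), norm_zero, mul_zero]; positivity

/-- Absolute convergence of the double integral behind associativity, at every point, provided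
`|f| * |g|` is locally bounded. -/
lemma cv_assoc_integrable (hf : Causal f) (hg : Causal g) (hk : Causal k)
    (hfg : ∀ t, CvEx (fun s => |f s|) (fun s => |g s|) t)
    (hb : LocBdd (cv (fun s => |f s|) (fun s => |g s|))) (t : ℝ) :
    Integrable (Function.uncurry fun x y => f y * (g (x - y) * k (t - x)))
      (volume.prod volume) := by
  have hm : AEStronglyMeasurable (Function.uncurry fun x y => f y * (g (x - y) * k (t - x)))
      (volume.prod volume) := by
    have h1 := hf.aesm.convolution_integrand (ContinuousLinearMap.mul ℝ ℝ) hg.aesm (μ := volume)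
    have h2 : AEStronglyMeasurable (fun p : ℝ × ℝ => k (t - p.1)) (volume.prod volume) :=
      (hk.aesm.comp_quasiMeasurePreserving
        (Measure.measurePreserving_sub_left volume t).quasiMeasurePreserving).comp_fst
    refine (h1.mul h2).congr (Eventually.of_forall fun p => ?_)
    simp [Function.uncurry, mul_assoc]
  rw [integrable_prod_iff hm]
  constructor
  · refine Eventually.of_forall fun x => ?_
    have h1 : Integrable (fun y => |f y| * |g (x - y)| * |k (t - x)|) :=
      Integrable.mul_const (hfg x) _
    refine h1.mono ?_ (Eventually.of_forall fun y => ?_)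
    · have hx : AEStronglyMeasurable (fun y => g (x - y)) volume :=
        hg.aesm.comp_quasiMeasurePreserving
          (Measure.measurePreserving_sub_left volume x).quasiMeasurePreserving
      change AEStronglyMeasurable (fun y => f y * (g (x - y) * k (t - x))) volume
      exact hf.aesm.mul (hx.mul_const _)
    · simp [Function.uncurry, mul_assoc]
  · have e : (fun x => ∫ y, ‖Function.uncurry (fun x y => f y * (g (x - y) * k (t - x))) (x, y)‖)
        = fun x => cv (fun s => |f s|) (fun s => |g s|) x * |k (t - x)| := by
      ext x
      simp only [Function.uncurry, norm_mul, Real.norm_eq_abs, ← mul_assoc, cv]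
      exact integral_mul_const _ _
    rw [e]
    exact (hb.cvEx hk.abs (hf.abs.cv hg.abs) t).symm

/-- Associativity at every point, not just almost everywhere, if `|f| * |g|` is locally bounded. -/
lemma cv_assoc (hf : Causal f) (hg : Causal g) (hk : Causal k)
    (hfg : ∀ t, CvEx (fun s => |f s|) (fun s => |g s|) t)
    (hb : LocBdd (cv (fun s => |f s|) (fun s => |g s|))) (t : ℝ) :
    cv (cv f g) k t = cv f (cv g k) t :=
  convolution_assoc' (ContinuousLinearMap.mul ℝ ℝ) (ContinuousLinearMap.mul ℝ ℝ)
    (ContinuousLinearMap.mul ℝ ℝ) (ContinuousLinearMap.mul ℝ ℝ) (fun x y z => by simp [mul_assoc])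
    (hf.ae_cvEx hg) (hg.ae_cvEx hk) (cv_assoc_integrable hf hg hk hfg hb t)

lemma cvEx_assoc (hf : Causal f) (hg : Causal g) (hk : Causal k)
    (hfg : ∀ t, CvEx (fun s => |f s|) (fun s => |g s|) t)
    (hb : LocBdd (cv (fun s => |f s|) (fun s => |g s|))) (t : ℝ) :
    CvEx f (cv g k) t := by
  have := (cv_assoc_integrable hf hg hk hfg hb t).integral_prod_right
  refine this.congr (Eventually.of_forall fun y => ?_)
  simp only [Function.uncurry, cv]
  rw [integral_const_mul, ← integral_sub_right_eq_self (fun s => g s * k (t - y - s)) y]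
  simp

lemma LocBdd.abs (h : LocBdd f) : LocBdd (fun t => |f t|) := fun T => by simpa using h T

/-- Associativity at every point if the middle function is locally bounded. -/
lemma LocBdd.cv_assoc (hb : LocBdd g) (hf : Causal f) (hg : Causal g) (hk : Causal k) (t : ℝ) :
    DelayDR.cv (DelayDR.cv f g) k t = DelayDR.cv f (DelayDR.cv g k) t :=
  DelayDR.cv_assoc hf hg hk (fun t => hb.abs.cvEx hf.abs hg.abs t) (hb.abs.cv hf.abs hg.abs) t

/-! ### Continuity of convolutions -/

/-- Truncating both functions reduces this to an integrable and a bounded continuous one. -/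
lemma continuous_cv (hf : Causal f) (hg : Causal g) (hc : Continuous g) : Continuous (cv f g) := by
  have key : ∀ T : ℝ, ∃ F : ℝ → ℝ, Continuous F ∧ ∀ t ≤ T, cv f g t = F t := by
    intro T
    let b : ℝ → ℝ := fun t => g (min t T)
    have hbc : Continuous b := by fun_prop
    have hbb : BddAbove (range fun x => ‖b x‖) := by
      obtain ⟨C, hC⟩ := (isCompact_Icc (a := min 0 T) (b := T)).exists_bound_of_continuousOn
        hc.continuousOn
      refine ⟨C, ?_⟩
      rintro _ ⟨x, rfl⟩
      rcases le_or_gt (min 0 T) (min x T) with h | h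
      · exact hC _ ⟨h, min_le_right _ _⟩
      · have hx : min x T ≤ 0 := h.le.trans (min_le_left _ _)
        have : 0 ≤ C := (norm_nonneg _).trans (hC T ⟨min_le_right _ _, le_rfl⟩)
        simpa [b, hg.zero _ hx] using this
    refine ⟨_, hbb.continuous_convolution_right_of_integrable (ContinuousLinearMap.mul ℝ ℝ)
      (hf.integrable_trunc T) hbc, fun t ht => ?_⟩
    change cv f g t = ∫ s, (Iic T).indicator f s * b (t - s)
    unfold cv
    congr 1; ext s
    rcases le_or_gt s 0 with h | h
    · simp [hf.zero s h, indicator]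
    rcases le_or_gt s t with h' | h'
    · rw [indicator_of_mem (by exact h'.trans ht)]
      simp only [b, min_eq_left (show t - s ≤ T by linarith)]
    · have : b (t - s) = 0 := hg.zero _ ((min_le_left _ _).trans (by linarith))
      simp [hg.zero (t - s) (by linarith), this]
  rw [continuous_iff_continuousAt]
  intro t
  obtain ⟨F, hF, h⟩ := key (t + 1)
  refine hF.continuousAt.congr ?_
  filter_upwards [Iic_mem_nhds (show t < t + 1 by linarith)] with s hs
  exact (h s hs).symm

/-- Points that are not integer multiples of `τ`, described by a continuous function that is
subadditive in absolute value; see `mem_offGrid_iff`. -/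
def offGrid (τ : ℝ) : Set ℝ := {t | Real.sin (Real.pi * t / τ) ≠ 0}

lemma abs_sin_add_le (x y : ℝ) : |Real.sin (x + y)| ≤ |Real.sin x| + |Real.sin y| := by
  rw [Real.sin_add]
  refine (abs_add_le _ _).trans ?_
  rw [abs_mul, abs_mul]
  have h1 := Real.abs_cos_le_one x
  have h2 := Real.abs_cos_le_one y
  have h3 := abs_nonneg (Real.sin x)
  have h4 := abs_nonneg (Real.sin y)
  nlinarith

/-- If two functions are continuous away from the multiples of `τ`, so is their convolution.
With a cutoff `χ` vanishing near the grid, `f * g = f * (χ g) + (χ f) * ((1 - χ) g)` near a given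
point off the grid: if `s` is close to the grid then `t - s` is not. -/
lemma continuousOn_cv_offGrid {τ : ℝ} (hf : Causal f) (hg : Causal g)
    (hfc : ContinuousOn f (offGrid τ)) (hgc : ContinuousOn g (offGrid τ)) :
    ContinuousOn (cv f g) (offGrid τ) := by
  let d : ℝ → ℝ := fun t => |Real.sin (Real.pi * t / τ)|
  have hd : Continuous d := by fun_prop
  have hopen : IsOpen (offGrid τ) := isOpen_ne_fun (by fun_prop) continuous_const
  have hdadd : ∀ x y, d (x + y) ≤ d x + d y := fun x y => by
    simp only [d]; rw [mul_add, add_div]; exact abs_sin_add_le _ _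
  intro t₀ ht₀
  have hr : 0 < d t₀ := abs_pos.2 ht₀
  set r := d t₀ / 5 with hrdef
  have hr0 : 0 < r := by positivity
  let χ : ℝ → ℝ := fun t => max 0 (min 1 ((d t - r) / r))
  have hχ : Continuous χ := by fun_prop
  have hχ0 : ∀ t, d t ≤ r → χ t = 0 := fun t ht => by
    simp only [χ]
    exact max_eq_left ((min_le_right _ _).trans (div_nonpos_of_nonpos_of_nonneg (by linarith) hr0.le))
  have hχ1 : ∀ t, 2 * r ≤ d t → χ t = 1 := fun t ht => by
    simp only [χ]
    rw [min_eq_left ((one_le_div hr0).2 (by linarith))]; simp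
  have cut : ∀ {u : ℝ → ℝ}, ContinuousOn u (offGrid τ) → Continuous fun t => u t * χ t := by
    intro u hu
    rw [continuous_iff_continuousAt]
    intro t
    by_cases ht : d t = 0
    · have : ∀ᶠ s in 𝓝 t, u s * χ s = 0 := by
        filter_upwards [hd.continuousAt.eventually_lt continuousAt_const (by rw [ht]; exact hr0)]
          with s hs
        rw [hχ0 s hs.le, mul_zero]
      exact (continuousAt_const (y := (0 : ℝ))).congr (this.mono fun _ h => h.symm)
    · have : t ∈ offGrid τ := fun h => ht (by simp [d, h])
      exact (hu.continuousAt (hopen.mem_nhds this)).mul hχ.continuousAt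
  have mulC : ∀ {u w : ℝ → ℝ}, Causal u → Continuous w → Causal fun t => u t * w t :=
    fun hu hw => ⟨fun t ht => by simp [hu.zero t ht], hu.locInt.mul_continuous hw⟩
  have bdd : ∀ {u : ℝ → ℝ}, Causal u → Continuous u → LocBdd u := by
    intro u hu hc T
    obtain ⟨C, hC⟩ := (isCompact_Icc (a := 0) (b := T)).exists_bound_of_continuousOn hc.continuousOn
    refine ⟨max C 0, fun t ht => ?_⟩
    rcases le_or_gt t 0 with h | h
    · simp [hu.zero t h]
    · exact (hC t ⟨h.le, ht⟩).trans (le_max_left _ _)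
  have c1 := continuous_cv hf (mulC hg hχ) (cut hgc)
  have hg2 : Causal fun t => g t * (1 - χ t) := mulC hg (by fun_prop)
  have c2 := continuous_cv hg2 (mulC hf hχ) (cut hfc)
  refine ContinuousAt.continuousWithinAt ?_
  refine (c1.add c2).continuousAt.congr ?_
  have ev : ∀ᶠ t in 𝓝 t₀, d (t₀ - t) < r := by
    refine ContinuousAt.eventually_lt (by fun_prop) continuousAt_const ?_
    simp [d, hr0]
  filter_upwards [ev] with t ht
  have hdt : 4 * r ≤ d t := by
    have := hdadd (t₀ - t) t
    rw [sub_add_cancel] at this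
    linarith
  have hex1 : CvEx f (fun s => g s * χ s) t := (bdd (mulC hg hχ) (cut hgc)).cvEx hf (mulC hg hχ) t
  have hex2 : CvEx (fun s => g s * (1 - χ s)) (fun s => f s * χ s) t :=
    (bdd (mulC hf hχ) (cut hfc)).cvEx hg2 (mulC hf hχ) t
  rw [cv_comm (fun s => g s * (1 - χ s))]
  have hex2 := hex2.symm
  simp only [cv, Pi.add_apply]
  rw [← integral_add hex1 hex2]
  congr 1; ext s
  beta_reduce
  rcases le_or_gt (2 * r) (d (t - s)) with h | h
  · rw [hχ1 _ h]; ring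
  · have h2 := hdadd (t - s) s
    rw [sub_add_cancel] at h2
    rw [hχ1 s (by linarith)]; ring

end

/-! ### Power kernels and fractional integrals -/

/-- The kernel `t ^ (b - 1) / Γ(b)` of the fractional integral of order `b`, extended by `0` to
`t ≤ 0`. -/
noncomputable def pk (b t : ℝ) : ℝ := if 0 < t then t ^ (b - 1) / Real.Gamma b else 0

lemma pk_of_pos {b t : ℝ} (ht : 0 < t) : pk b t = t ^ (b - 1) / Real.Gamma b := if_pos ht

lemma pk_zero (b : ℝ) : ∀ t ≤ 0, pk b t = 0 := fun _ ht => if_neg (not_lt.2 ht)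

lemma pk_nonneg {b : ℝ} (hb : 0 < b) (t : ℝ) : 0 ≤ pk b t := by
  unfold pk
  split_ifs with h
  · have := Real.Gamma_pos_of_pos hb
    positivity
  · rfl

lemma pk_one {t : ℝ} (ht : 0 < t) : pk 1 t = 1 := by simp [pk, ht]

lemma pk_two {t : ℝ} (ht : 0 < t) : pk 2 t = t := by
  rw [pk_of_pos ht]; norm_num

lemma pk_causal {b : ℝ} (hb : 0 < b) : Causal (pk b) := by
  refine Causal.of_integrableOn (pk_zero b) fun T => ?_
  have h1 : IntervalIntegrable (fun t : ℝ => t ^ (b - 1) / Real.Gamma b) volume 0 (max T 0) :=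
    (intervalIntegral.intervalIntegrable_rpow' (by linarith)).div_const _
  rw [intervalIntegrable_iff, uIoc_of_le (le_max_right _ _)] at h1
  have h2 : IntegrableOn (pk b) (Ioc 0 (max T 0)) :=
    h1.congr_fun (fun t ht => (pk_of_pos ht.1).symm) measurableSet_Ioc
  have h3 : IntegrableOn (pk b) (Iic 0) :=
    (integrableOn_zero : IntegrableOn (fun _ : ℝ => (0 : ℝ)) (Iic 0) volume).congr_fun
      (fun t ht => (pk_zero b t ht).symm) measurableSet_Iic
  refine (h3.union h2).mono_set fun t ht => ?_
  rcases le_or_gt t 0 with h | h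
  · exact Or.inl h
  · exact Or.inr ⟨h, le_max_of_le_left ht⟩

lemma pk_locBdd {b : ℝ} (hb : 1 ≤ b) : LocBdd (pk b) := by
  intro T
  have hG : 0 < Real.Gamma b := Real.Gamma_pos_of_pos (by linarith)
  refine ⟨(max T 0) ^ (b - 1) / Real.Gamma b, fun t ht => ?_⟩
  rw [abs_of_nonneg (pk_nonneg (by linarith) t)]
  rcases le_or_gt t 0 with h | h
  · rw [pk_zero b t h]; positivity
  · rw [pk_of_pos h]
    gcongr
    exact ht.trans (le_max_left _ _)

lemma continuousOn_pk (b : ℝ) : ContinuousOn (pk b) {0}ᶜ := by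
  intro t ht
  refine ContinuousAt.continuousWithinAt ?_
  rcases lt_or_gt_of_ne (show t ≠ 0 from ht) with h | h
  · refine (continuousAt_const (y := (0 : ℝ))).congr ?_
    filter_upwards [Iio_mem_nhds h] with s hs
    exact (pk_zero b s (le_of_lt hs)).symm
  · have : ContinuousAt (fun t : ℝ => t ^ (b - 1) / Real.Gamma b) t :=
      (Real.continuousAt_rpow_const _ _ (Or.inl h.ne')).div_const _
    refine this.congr ?_
    filter_upwards [Ioi_mem_nhds h] with s hs
    exact (pk_of_pos hs).symm

/-- The Beta integral over `[0, t]`, with its absolute convergence. -/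
lemma beta_scaled {a b t : ℝ} (ha : 0 < a) (hb : 0 < b) (ht : 0 < t) :
    IntervalIntegrable (fun s => s ^ (a - 1) * (t - s) ^ (b - 1)) volume 0 t ∧
    ∫ s in (0 : ℝ)..t, s ^ (a - 1) * (t - s) ^ (b - 1)
      = t ^ (a + b - 1) * (Real.Gamma a * Real.Gamma b / Real.Gamma (a + b)) := by
  have hc : ∀ s ∈ Ioc (0 : ℝ) t, ((s ^ (a - 1) * (t - s) ^ (b - 1) : ℝ) : ℂ)
      = (s : ℂ) ^ ((a : ℂ) - 1) * ((t : ℂ) - s) ^ ((b : ℂ) - 1) := by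
    intro s hs
    push_cast [Complex.ofReal_cpow hs.1.le, Complex.ofReal_cpow (sub_nonneg.2 hs.2)]
    rfl
  have hab : Real.Gamma (a + b) ≠ 0 := (Real.Gamma_pos_of_pos (by linarith)).ne'
  have hbeta : Complex.betaIntegral a b
      = ((Real.Gamma a * Real.Gamma b / Real.Gamma (a + b) : ℝ) : ℂ) := by
    have h1 : 0 < (a : ℂ).re := by simpa
    have h2 : 0 < (b : ℂ).re := by simpa
    have := Complex.Gamma_mul_Gamma_eq_betaIntegral h1 h2
    rw [← Complex.ofReal_add, Complex.Gamma_ofReal, Complex.Gamma_ofReal, Complex.Gamma_ofReal]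
      at this
    push_cast
    rw [this, mul_div_cancel_left₀]
    exact_mod_cast hab
  have key : ∫ s in (0 : ℝ)..t, s ^ (a - 1) * (t - s) ^ (b - 1)
      = t ^ (a + b - 1) * (Real.Gamma a * Real.Gamma b / Real.Gamma (a + b)) := by
    have h5 := Complex.betaIntegral_scaled a b ht
    rw [hbeta] at h5
    have : ((∫ s in (0 : ℝ)..t, s ^ (a - 1) * (t - s) ^ (b - 1) : ℝ) : ℂ)
        = ((t ^ (a + b - 1) * (Real.Gamma a * Real.Gamma b / Real.Gamma (a + b)) : ℝ) : ℂ) := by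
      rw [← intervalIntegral.integral_ofReal]
      rw [intervalIntegral.integral_of_le ht.le, setIntegral_congr_fun measurableSet_Ioc hc,
        ← intervalIntegral.integral_of_le ht.le, h5]
      push_cast [Complex.ofReal_cpow ht.le]
      rfl
    exact_mod_cast this
  refine ⟨intervalIntegral.intervalIntegrable_of_integral_ne_zero ?_, key⟩
  -- the value of the integral is positive, hence the integral is not a junk value
  have hA := Real.Gamma_pos_of_pos ha
  have hB := Real.Gamma_pos_of_pos hb
  have hAB := Real.Gamma_pos_of_pos (add_pos ha hb)
  rw [key]
  positivity

lemma pk_mul_pk_ae {a b t : ℝ} (ht : 0 < t) : ∀ᵐ s, s ∈ uIoc 0 t →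
    s ^ (a - 1) * (t - s) ^ (b - 1) / (Real.Gamma a * Real.Gamma b) = pk a s * pk b (t - s) := by
  have : ∀ᵐ s : ℝ, s ≠ t := by simp [ae_iff]
  filter_upwards [this] with s hst hs
  rw [uIoc_of_le ht.le] at hs
  rw [pk_of_pos hs.1, pk_of_pos (sub_pos.2 (lt_of_le_of_ne hs.2 hst)), div_mul_div_comm]

lemma cvEx_pk {a b : ℝ} (ha : 0 < a) (hb : 0 < b) (t : ℝ) : CvEx (pk a) (pk b) t := by
  rcases le_or_gt t 0 with ht | ht
  · have : (fun s => pk a s * pk b (t - s)) = fun _ => 0 := by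
      ext s
      rcases le_or_gt s 0 with h | h
      · simp [pk_zero a s h]
      · simp [pk_zero b (t - s) (by linarith)]
    rw [CvEx, this]; exact integrable_zero _ _ _
  · rw [cvEx_iff_intervalIntegrable (pk_zero a) (pk_zero b) ht.le]
    refine (((beta_scaled ha hb ht).1.div_const
      (Real.Gamma a * Real.Gamma b)).congr_ae ?_)
    exact (ae_restrict_iff' measurableSet_uIoc).2 (pk_mul_pk_ae ht)

lemma cv_pk_pk {a b : ℝ} (ha : 0 < a) (hb : 0 < b) : cv (pk a) (pk b) = pk (a + b) := by
  ext t
  rcases le_or_gt t 0 with ht | ht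
  · rw [pk_zero _ t ht, cv_of_nonpos (pk_zero a) (pk_zero b) ht]
  · rw [cv_eq_intervalIntegral (pk_zero a) (pk_zero b) ht.le, pk_of_pos ht]
    have h1 := (beta_scaled ha hb ht).2
    have hA := (Real.Gamma_pos_of_pos ha).ne'
    have hB := (Real.Gamma_pos_of_pos hb).ne'
    calc ∫ s in (0 : ℝ)..t, pk a s * pk b (t - s)
        = ∫ s in (0 : ℝ)..t, s ^ (a - 1) * (t - s) ^ (b - 1) / (Real.Gamma a * Real.Gamma b) := by
          exact intervalIntegral.integral_congr_ae
            ((pk_mul_pk_ae ht).mono fun s h hs => (h hs).symm)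
      _ = _ := by
          rw [intervalIntegral.integral_div, h1]
          field_simp

/-- `I^a I^b f = I^(a + b) f` at every point if `a + b ≥ 1`, since then `h_a * h_b = h_(a+b)` is
locally bounded. -/
lemma cv_pk_cv_pk {a b : ℝ} (ha : 0 < a) (hb : 0 < b) (hab : 1 ≤ a + b) {f : ℝ → ℝ}
    (hf : Causal f) (t : ℝ) :
    CvEx (pk a) (cv (pk b) f) t ∧ cv (pk a) (cv (pk b) f) t = cv (pk (a + b)) f t := by
  have eabs : ∀ {c : ℝ}, 0 < c → (fun s => |pk c s|) = pk c := fun hc => by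
    ext s; exact abs_of_nonneg (pk_nonneg hc s)
  have h1 : ∀ t, CvEx (fun s => |pk a s|) (fun s => |pk b s|) t := by
    rw [eabs ha, eabs hb]; exact cvEx_pk ha hb
  have h2 : LocBdd (cv (fun s => |pk a s|) (fun s => |pk b s|)) := by
    rw [eabs ha, eabs hb, cv_pk_pk ha hb]; exact pk_locBdd hab
  refine ⟨cvEx_assoc (pk_causal ha) (pk_causal hb) hf h1 h2 t, ?_⟩
  rw [← cv_assoc (pk_causal ha) (pk_causal hb) hf h1 h2 t, cv_pk_pk ha hb]

lemma cv_pk_one {f : ℝ → ℝ} (hf : Causal f) (t : ℝ) :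
    cv (pk 1) f t = ∫ s in (0 : ℝ)..t, f s := by
  rcases le_or_gt t 0 with ht | ht
  · rw [cv_of_nonpos (pk_zero 1) hf.zero ht, intervalIntegral.integral_of_ge ht,
      setIntegral_congr_fun (g := fun _ => (0 : ℝ)) measurableSet_Ioc
        (fun s hs => hf.zero s hs.2)]
    simp
  · rw [cv_comm, cv_eq_intervalIntegral hf.zero (pk_zero 1) ht.le]
    refine intervalIntegral.integral_congr_ae ?_
    have : ∀ᵐ s : ℝ, s ≠ t := by simp [ae_iff]
    filter_upwards [this] with s hst hs
    rw [uIoc_of_le ht.le] at hs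
    rw [pk_one (sub_pos.2 (lt_of_le_of_ne hs.2 hst)), mul_one]

lemma rlIntegral_integrand {β : ℝ} {f F : ℝ → ℝ} {t : ℝ} (ht : 0 < t)
    (h : ∀ᵐ s, 0 < s → s < t → f s = F s) :
    ∀ᵐ s, s ∈ uIoc 0 t →
      (t - s) ^ (β - 1) * f s = Real.Gamma β * (F s * pk β (t - s)) ∨ Real.Gamma β = 0 := by
  have h2 : ∀ᵐ s : ℝ, s ≠ t := by simp [ae_iff]
  filter_upwards [h, h2] with s h1 hst hs
  rw [uIoc_of_le ht.le] at hs
  have hlt := lt_of_le_of_ne hs.2 hst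
  by_cases hG : Real.Gamma β = 0
  · exact Or.inr hG
  · left
    rw [h1 hs.1 hlt, pk_of_pos (sub_pos.2 hlt)]
    field_simp

/-- `rlIntegral` as a convolution with a causal function that agrees with `f` on `(0, t)`. -/
lemma rlIntegral_eq_cv {β : ℝ} (hβ : 0 < β) {f F : ℝ → ℝ} (hF : Causal F) {t : ℝ} (ht : 0 < t)
    (h : ∀ᵐ s, 0 < s → s < t → f s = F s) : rlIntegral β f t = cv (pk β) F t := by
  have hG := (Real.Gamma_pos_of_pos hβ).ne'
  rw [rlIntegral, if_neg hβ.ne', cv_comm, cv_eq_intervalIntegral hF.zero (pk_zero β) ht.le,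
    ← intervalIntegral.integral_const_mul]
  refine intervalIntegral.integral_congr_ae ?_
  filter_upwards [rlIntegral_integrand (β := β) ht h] with s hs hmem
  rcases hs hmem with h | h
  · rw [h]; field_simp
  · exact absurd h hG

lemma rlIntegrableAt_of_cvEx {β : ℝ} (hβ : 0 ≤ β) {f F : ℝ → ℝ} (hF : Causal F) {t : ℝ}
    (ht : 0 < t) (h : ∀ᵐ s, 0 < s → s < t → f s = F s) (hex : 0 < β → CvEx (pk β) F t) :
    RLIntegrableAt β f t := by
  intro h0
  have hβ : 0 < β := lt_of_le_of_ne hβ (Ne.symm h0)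
  have hG := (Real.Gamma_pos_of_pos hβ).ne'
  have := (cvEx_iff_intervalIntegrable hF.zero (pk_zero β) ht.le).1 (hex hβ).symm
  refine (this.const_mul (Real.Gamma β)).congr_ae ?_
  rw [Filter.EventuallyEq, ae_restrict_iff' measurableSet_uIoc]
  filter_upwards [rlIntegral_integrand (β := β) ht h] with s hs hmem
  rcases hs hmem with h | h
  · exact h.symm
  · exact absurd h hG

/-! ### The three-parameter Mittag-Leffler function -/

/-- `Γ(b)` grows faster than any geometric sequence: restrict the integral defining `Γ(b)` to
`[X, X + 1]`. -/
lemma rpow_le_exp_mul_Gamma {X b : ℝ} (hX : 0 < X) (hb : 1 ≤ b) :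
    X ^ (b - 1) ≤ Real.exp (X + 1) * Real.Gamma b := by
  have h1 : Real.exp (-(X + 1)) * X ^ (b - 1) ≤ Real.Gamma b := by
    rw [Real.Gamma_eq_integral (by linarith)]
    have hint := Real.GammaIntegral_convergent (s := b) (by linarith)
    have hsub : Ioc X (X + 1) ⊆ Ioi 0 := fun x hx => hX.trans hx.1
    calc Real.exp (-(X + 1)) * X ^ (b - 1)
        = ∫ _ in Ioc X (X + 1), Real.exp (-(X + 1)) * X ^ (b - 1) := by simp
      _ ≤ ∫ x in Ioc X (X + 1), Real.exp (-x) * x ^ (b - 1) := by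
          refine setIntegral_mono_on continuous_const.integrableOn_Ioc (hint.mono_set hsub) measurableSet_Ioc
            fun x hx => ?_
          have := hx.1
          have := hx.2
          gcongr
      _ ≤ _ := by
          refine setIntegral_mono_set hint ?_ hsub.eventuallyLE
          refine (ae_restrict_iff' measurableSet_Ioi).2 (Eventually.of_forall fun x hx => ?_)
          have : (0 : ℝ) < x := hx
          simp only [Pi.zero_apply]
          positivity
  rw [Real.exp_neg, inv_mul_le_iff₀ (Real.exp_pos _)] at h1
  exact h1

/-- Coefficients `(m + p choose m)` of the Mittag-Leffler function with first parameter `m + 1`. -/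
def binom (m p : ℕ) : ℝ := ((p + m).choose m : ℝ)

lemma binom_nonneg (m p : ℕ) : 0 ≤ binom m p := Nat.cast_nonneg _

lemma summable_mittagLeffler {α b : ℝ} (hα : 0 < α) (m : ℕ) (R : ℝ) (hR : 0 ≤ R) :
    Summable fun p : ℕ => binom m p * R ^ p / |Real.Gamma (α * p + b)| := by
  -- with this `X`, the terms are eventually dominated by those of a series in `R / X ^ α < 1`
  set X : ℝ := (2 * (R + 1)) ^ α⁻¹ with hXdef
  have hX : 0 < X := by positivity
  have hXα : X ^ α = 2 * (R + 1) := Real.rpow_inv_rpow (by positivity) hα.ne'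
  have hr : ‖R / X ^ α‖ < 1 := by
    rw [hXα, Real.norm_of_nonneg (by positivity), div_lt_one (by positivity)]; linarith
  have hs := (summable_choose_mul_geometric_of_norm_lt_one m hr).mul_left
    (Real.exp (X + 1) * X ^ (1 - b))
  refine summable_of_isBigO_nat (g := _) hs (Asymptotics.IsBigO.of_bound 1 ?_)
  obtain ⟨N, hN⟩ := exists_nat_ge ((1 - b) / α)
  filter_upwards [eventually_ge_atTop N] with p hp
  have hp1 : 1 ≤ α * p + b := by
    have : (1 - b) / α ≤ p := hN.trans (by exact_mod_cast hp)
    rw [div_le_iff₀ hα] at this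
    linarith
  have hG : 0 < Real.Gamma (α * p + b) := Real.Gamma_pos_of_pos (by linarith)
  have hbn := binom_nonneg m p
  rw [abs_of_pos hG, one_mul, Real.norm_of_nonneg (by positivity),
    Real.norm_of_nonneg (by positivity), div_le_iff₀ hG]
  have h2 := rpow_le_exp_mul_Gamma hX hp1
  have e : X ^ (α * p + b - 1) = (X ^ α) ^ p / X ^ (1 - b) := by
    rw [show α * p + b - 1 = α * p - (1 - b) by ring, Real.rpow_sub hX, Real.rpow_mul hX.le,
      Real.rpow_natCast]
  rw [e, div_le_iff₀ (by positivity)] at h2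
  change binom m p * R ^ p ≤ Real.exp (X + 1) * X ^ (1 - b) * (binom m p * (R / X ^ α) ^ p)
    * Real.Gamma (α * p + b)
  rw [div_pow]
  have hXp : 0 < (X ^ α) ^ p := by positivity
  calc binom m p * R ^ p = binom m p * R ^ p / (X ^ α) ^ p * (X ^ α) ^ p := by field_simp
    _ ≤ binom m p * R ^ p / (X ^ α) ^ p *
        (Real.exp (X + 1) * Real.Gamma (α * p + b) * X ^ (1 - b)) := by gcongr
    _ = _ := by ring

lemma mittagLeffler_term (m p : ℕ) (α b z : ℝ) :
    Real.Gamma ((m : ℝ) + 1 + p) * z ^ p /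
      (p.factorial * Real.Gamma ((m : ℝ) + 1) * Real.Gamma (α * p + b))
      = binom m p * z ^ p / Real.Gamma (α * p + b) := by
  have h1 : Real.Gamma ((m : ℝ) + 1 + p) = ((p + m).factorial : ℝ) := by
    rw [← Real.Gamma_nat_eq_factorial]; push_cast; ring_nf
  have h2 : ((p + m).choose m : ℝ) * m.factorial * p.factorial = (p + m).factorial := by
    have := Nat.choose_mul_factorial_mul_factorial (Nat.le_add_left m p)
    rw [Nat.add_sub_cancel] at this
    exact_mod_cast this
  have hm : (m.factorial : ℝ) ≠ 0 := by positivity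
  have hp : (p.factorial : ℝ) ≠ 0 := by positivity
  rw [h1, Real.Gamma_nat_eq_factorial, binom, ← h2]
  field_simp

lemma mittagLeffler_eq_tsum (m : ℕ) (α b z : ℝ) :
    mittagLeffler (m + 1) α b z = ∑' p : ℕ, binom m p * z ^ p / Real.Gamma (α * p + b) :=
  tsum_congr fun p => mittagLeffler_term m p α b z

lemma hasSum_mittagLeffler {α : ℝ} (hα : 0 < α) (m : ℕ) (b z : ℝ) :
    HasSum (fun p : ℕ => binom m p * z ^ p / Real.Gamma (α * p + b))
      (mittagLeffler (m + 1) α b z) := by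
  rw [mittagLeffler_eq_tsum]
  refine Summable.hasSum (Summable.of_norm ?_)
  refine (summable_mittagLeffler (b := b) hα m |z| (abs_nonneg z)).congr fun p => ?_
  simp [abs_of_nonneg (binom_nonneg m p)]

lemma continuous_mittagLeffler {α : ℝ} (hα : 0 < α) (m : ℕ) (b : ℝ) :
    Continuous (mittagLeffler (m + 1) α b) := by
  rw [continuous_iff_continuousAt]
  intro z
  have h : ContinuousOn (mittagLeffler (m + 1) α b) (Metric.ball 0 (|z| + 1)) := by
    rw [show mittagLeffler (m + 1) α b
      = fun z => ∑' p : ℕ, binom m p * z ^ p / Real.Gamma (α * p + b) from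
      funext fun z => mittagLeffler_eq_tsum m α b z]
    refine continuousOn_tsum (fun p => by fun_prop)
      (summable_mittagLeffler (b := b) hα m (|z| + 1) (by positivity)) fun p w hw => ?_
    have hw' : |w| ≤ |z| + 1 := by simpa using (mem_ball_zero_iff.1 hw).le
    have := binom_nonneg m p
    rw [norm_div, norm_mul, norm_pow, Real.norm_of_nonneg this, Real.norm_eq_abs, Real.norm_eq_abs]
    gcongr
  exact h.continuousAt (Metric.isOpen_ball.mem_nhds (by simp))

/-- The kernel `t ^ (b - 1) E^{m+1}_{α, b}(γ t ^ α)`, extended by `0` to `t ≤ 0`. -/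
noncomputable def ek (α γ : ℝ) (m : ℕ) (b t : ℝ) : ℝ :=
  if 0 < t then t ^ (b - 1) * mittagLeffler (m + 1) α b (γ * t ^ α) else 0

section
variable {α γ : ℝ}

lemma ek_zero (m : ℕ) (b : ℝ) : ∀ t ≤ 0, ek α γ m b t = 0 := fun _ ht => if_neg (not_lt.2 ht)

lemma ek_hasSum (hα : 0 < α) (γ : ℝ) (m : ℕ) (b t : ℝ) :
    HasSum (fun p : ℕ => binom m p * γ ^ p * pk (α * p + b) t) (ek α γ m b t) := by
  rcases le_or_gt t 0 with ht | ht
  · simp only [ek_zero m b t ht, pk_zero _ t ht, mul_zero]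
    exact hasSum_zero
  · rw [ek, if_pos ht]
    refine ((hasSum_mittagLeffler hα m b (γ * t ^ α)).mul_left (t ^ (b - 1))).congr_fun ?_
    intro p
    rw [pk_of_pos ht, show α * p + b - 1 = (b - 1) + α * p by ring, Real.rpow_add ht,
      Real.rpow_mul ht.le, Real.rpow_natCast, mul_pow]
    ring

lemma ek_eq_pk_mul (γ : ℝ) (m : ℕ) {b : ℝ} (hb : 0 < b) (t : ℝ) :
    ek α γ m b t = pk b t * (Real.Gamma b * mittagLeffler (m + 1) α b (γ * t ^ α)) := by
  rcases le_or_gt t 0 with ht | ht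
  · simp [ek_zero m b t ht, pk_zero _ t ht]
  · rw [ek, if_pos ht, pk_of_pos ht]
    have := (Real.Gamma_pos_of_pos hb).ne'
    field_simp

lemma continuous_ek_factor (hα : 0 < α) (γ : ℝ) (m : ℕ) (b : ℝ) :
    Continuous fun t : ℝ => Real.Gamma b * mittagLeffler (m + 1) α b (γ * t ^ α) :=
  continuous_const.mul ((continuous_mittagLeffler hα m b).comp
    (continuous_const.mul (Real.continuous_rpow_const hα.le)))

lemma ek_causal (hα : 0 < α) (γ : ℝ) (m : ℕ) {b : ℝ} (hb : 0 < b) : Causal (ek α γ m b) :=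
  ⟨ek_zero m b, by
    rw [show ek α γ m b = _ from funext fun t => ek_eq_pk_mul γ m hb t]
    exact (pk_causal hb).locInt.mul_continuous (continuous_ek_factor hα γ m b)⟩

lemma continuousOn_ek (hα : 0 < α) (γ : ℝ) (m : ℕ) {b : ℝ} (hb : 0 < b) :
    ContinuousOn (ek α γ m b) {0}ᶜ := by
  rw [show ek α γ m b = _ from funext fun t => ek_eq_pk_mul γ m hb t]
  exact (continuousOn_pk b).mul (continuous_ek_factor hα γ m b).continuousOn

/-- Fractional integration raises the second parameter. -/
lemma cv_pk_ek (hα : 0 < α) (γ : ℝ) (m : ℕ) {a b : ℝ} (ha : 0 < a) (hb : 0 < b) :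
    cv (pk a) (ek α γ m b) = ek α γ m (b + a) := by
  ext t
  have hbp : ∀ p : ℕ, 0 < α * p + b := fun p => by positivity
  let F : ℕ → ℝ → ℝ := fun p s => binom m p * γ ^ p * (pk a s * pk (α * p + b) (t - s))
  have hF : ∀ p, Integrable (F p) := fun p =>
    Integrable.const_mul (cvEx_pk ha (hbp p) t) _
  have hnorm : ∀ p, ∫ s, ‖F p s‖ = binom m p * |γ| ^ p * pk (α * p + (b + a)) t := by
    intro p
    have : ∀ s, ‖F p s‖ = binom m p * |γ| ^ p * (pk a s * pk (α * p + b) (t - s)) := fun s => by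
      simp only [F, norm_mul, norm_pow, Real.norm_eq_abs, abs_of_nonneg (binom_nonneg m p),
        abs_of_nonneg (pk_nonneg ha s), abs_of_nonneg (pk_nonneg (hbp p) (t - s))]
    simp only [this]
    rw [integral_const_mul]
    change _ * cv (pk a) (pk (α * p + b)) t = _
    rw [cv_pk_pk ha (hbp p), show a + (α * p + b) = α * p + (b + a) by ring]
  have hsum : Summable fun p => ∫ s, ‖F p s‖ := by
    simp only [hnorm]
    exact (ek_hasSum hα |γ| m (b + a) t).summable
  have h1 := hasSum_integral_of_summable_integral_norm hF hsum
  have h2 : ∀ p, ∫ s, F p s = binom m p * γ ^ p * pk (α * p + (b + a)) t := fun p => by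
    simp only [F]
    rw [integral_const_mul]
    change _ * cv (pk a) (pk (α * p + b)) t = _
    rw [cv_pk_pk ha (hbp p), show a + (α * p + b) = α * p + (b + a) by ring]
  simp only [h2] at h1
  rw [(ek_hasSum hα γ m (b + a) t).unique h1, cv]
  congr 1; ext s
  rw [← ((ek_hasSum hα γ m b (t - s)).mul_left (pk a s)).tsum_eq]
  exact tsum_congr fun p => by simp only [F]; ring

lemma ek_zero_succ (hα : 0 < α) (γ b t : ℝ) :
    ek α γ 0 b t = pk b t + γ * ek α γ 0 (b + α) t := by
  have h1 := (ek_hasSum hα γ 0 (b + α) t).mul_left γ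
  have h2 : HasSum (fun p : ℕ => binom 0 (p + 1) * γ ^ (p + 1) * pk (α * (p + 1 : ℕ) + b) t)
      (γ * ek α γ 0 (b + α) t) := by
    refine h1.congr_fun fun p => ?_
    rw [show α * ((p + 1 : ℕ) : ℝ) + b = α * p + (b + α) by push_cast; ring]
    simp [binom]; ring
  have h3 := (hasSum_nat_add_iff (f := fun p : ℕ => binom 0 p * γ ^ p * pk (α * p + b) t) 1).1 h2
  rw [(ek_hasSum hα γ 0 b t).unique h3]
  simp [binom, add_comm]

/-- Pascal's rule for the kernels. -/
lemma ek_succ (hα : 0 < α) (γ : ℝ) (m : ℕ) (b t : ℝ) :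
    ek α γ (m + 1) b t = γ * ek α γ (m + 1) (b + α) t + ek α γ m b t := by
  let g : ℕ → ℝ := fun p => ((p + m).choose (m + 1) : ℝ) * γ ^ p * pk (α * p + b) t
  have h1 := (ek_hasSum hα γ (m + 1) (b + α) t).mul_left γ
  have h2 : HasSum (fun p : ℕ => g (p + 1)) (γ * ek α γ (m + 1) (b + α) t) := by
    refine h1.congr_fun fun p => ?_
    simp only [g]
    rw [show α * ((p + 1 : ℕ) : ℝ) + b = α * p + (b + α) by push_cast; ring, binom,
      show p + 1 + m = p + (m + 1) by ring]
    ring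
  have h3 := ((hasSum_nat_add_iff (f := g) 1).1 h2).add (ek_hasSum hα γ m b t)
  have h4 : HasSum (fun p : ℕ => binom (m + 1) p * γ ^ p * pk (α * p + b) t)
      (γ * ek α γ (m + 1) (b + α) t + ∑ i ∈ Finset.range 1, g i + ek α γ m b t) := by
    refine h3.congr_fun fun p => ?_
    simp only [g, binom]
    rw [show p + (m + 1) = p + m + 1 by ring, Nat.choose_succ_succ]
    push_cast; ring
  rw [(ek_hasSum hα γ (m + 1) b t).unique h4]
  simp [g]

end

/-! ### The delayed Mittag-Leffler kernels -/

lemma mem_offGrid_iff {τ : ℝ} (hτ : 0 < τ) {t : ℝ} : t ∈ offGrid τ ↔ ∀ n : ℤ, t ≠ n * τ := by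
  simp only [offGrid, mem_ofPred_eq, ne_eq, Real.sin_eq_zero_iff, not_exists]
  refine forall_congr' fun n => not_congr ?_
  rw [eq_div_iff hτ.ne', mul_right_comm, mul_comm Real.pi t, mul_left_inj' Real.pi_ne_zero, eq_comm]

lemma isOpen_offGrid (τ : ℝ) : IsOpen (offGrid τ) :=
  isOpen_ne_fun (by fun_prop) continuous_const

lemma sub_mul_mem_offGrid {τ : ℝ} (hτ : 0 < τ) {t : ℝ} (ht : t ∈ offGrid τ) (m : ℤ) :
    t - m * τ ∈ offGrid τ := by
  rw [mem_offGrid_iff hτ] at ht ⊢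
  intro n h
  exact ht (n + m) (by push_cast; linarith)

lemma ae_mem_offGrid {τ : ℝ} (hτ : 0 < τ) : ∀ᵐ t, t ∈ offGrid τ := by
  have h : (range fun n : ℤ => (n : ℝ) * τ).Countable := countable_range _
  filter_upwards [h.ae_notMem volume] with t ht
  rw [mem_offGrid_iff hτ]
  exact fun n hn => ht ⟨n, hn.symm⟩

/-- The functions `S^{(s)}`: the sums `mlSum` with the convention that a summand vanishes when its
argument `t - τ m` is not positive. -/
noncomputable def delayKernel (α γ γ' τ s t : ℝ) : ℝ :=
  ∑ m ∈ Finset.range (⌊t / τ⌋₊ + 1), γ' ^ m * ek α γ m (α * (m + 1) + s) (t - τ * m)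

section
variable {α γ γ' τ s : ℝ}

lemma delayKernel_eq_sum (hτ : 0 < τ) {t : ℝ} {N : ℕ} (hN : t ≤ τ * N) :
    delayKernel α γ γ' τ s t
      = ∑ m ∈ Finset.range N, γ' ^ m * ek α γ m (α * (m + 1) + s) (t - τ * m) := by
  set M := max (⌊t / τ⌋₊ + 1) N
  have h1 : delayKernel α γ γ' τ s t
      = ∑ m ∈ Finset.range M, γ' ^ m * ek α γ m (α * (m + 1) + s) (t - τ * m) := by
    refine Finset.sum_subset (Finset.range_mono (le_max_left _ _)) fun m _ hm => ?_
    have hm' : ⌊t / τ⌋₊ + 1 ≤ m := by simpa using hm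
    have := (Nat.floor_lt' (a := t / τ) (n := m) (by omega)).1 (by omega)
    rw [div_lt_iff₀ hτ] at this
    rw [ek_zero _ _ _ (by linarith), mul_zero]
  rw [h1]
  symm
  refine Finset.sum_subset (Finset.range_mono (le_max_right _ _)) fun m _ hm => ?_
  have hm' : (N : ℝ) ≤ m := by exact_mod_cast (by simpa using hm : N ≤ m)
  have : τ * N ≤ τ * m := by gcongr
  rw [ek_zero _ _ _ (by linarith), mul_zero]

lemma exists_le_mul_nat (hτ : 0 < τ) (t : ℝ) : ∃ N : ℕ, t ≤ τ * N := by
  obtain ⟨N, hN⟩ := exists_nat_ge (t / τ)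
  exact ⟨N, by rw [div_le_iff₀ hτ] at hN; linarith⟩

lemma delayKernel_zero (hτ : 0 < τ) : ∀ t ≤ 0, delayKernel α γ γ' τ s t = 0 := fun t ht => by
  rw [delayKernel_eq_sum hτ (N := 0) (by simpa using ht)]; simp

lemma index_pos (hα : 0 < α) (hs : 0 < α + s) (m : ℕ) : 0 < α * (m + 1) + s := by
  have : 0 ≤ α * m := by positivity
  linarith

lemma delayKernel_summand_causal (hα : 0 < α) (hτ : 0 < τ) (hs : 0 < α + s) (γ : ℝ) (m : ℕ) :
    Causal fun t => γ' ^ m * ek α γ m (α * (m + 1) + s) (t - τ * m) :=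
  ((ek_causal hα γ m (index_pos hα hs m)).shift (c := τ * m) (by positivity)).const_mul _

lemma delayKernel_causal (hα : 0 < α) (hτ : 0 < τ) (hs : 0 < α + s) :
    Causal (delayKernel α γ γ' τ s) := by
  refine Causal.of_integrableOn (delayKernel_zero hτ) fun T => ?_
  obtain ⟨N, hN⟩ := exists_le_mul_nat hτ T
  refine IntegrableOn.congr_fun (integrable_finsetSum (Finset.range N) fun m _ =>
    (delayKernel_summand_causal (γ' := γ') hα hτ hs γ m).integrableOn_Iic T) ?_ measurableSet_Iic
  intro t ht
  exact (delayKernel_eq_sum hτ (le_trans ht hN)).symm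

lemma continuousOn_delayKernel (hα : 0 < α) (hτ : 0 < τ) (hs : 0 < α + s) :
    ContinuousOn (delayKernel α γ γ' τ s) (offGrid τ) := by
  intro t ht
  refine ContinuousAt.continuousWithinAt ?_
  obtain ⟨N, hN⟩ := exists_le_mul_nat hτ (t + 1)
  have : ContinuousAt (fun t => ∑ m ∈ Finset.range N,
      γ' ^ m * ek α γ m (α * (m + 1) + s) (t - τ * m)) t := by
    refine tendsto_finsetSum _ fun m _ => ?_
    have h0 : t - τ * m ∈ ({0}ᶜ : Set ℝ) := by
      have := (mem_offGrid_iff hτ).1 ht m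
      rw [mem_compl_singleton_iff, sub_ne_zero, mul_comm]
      exact_mod_cast this
    have h1 : ContinuousAt (ek α γ m (α * (m + 1) + s)) (t - τ * m) :=
      (continuousOn_ek hα γ m (index_pos hα hs m)).continuousAt (isOpen_compl_singleton.mem_nhds h0)
    have h2 : ContinuousAt (fun t : ℝ => t - τ * m) t := by fun_prop
    exact continuousAt_const.mul (ContinuousAt.comp (f := fun t : ℝ => t - τ * m) h1 h2)
  refine this.congr ?_
  filter_upwards [Iic_mem_nhds (show t < t + 1 by linarith)] with u hu
  exact (delayKernel_eq_sum hτ (le_trans hu hN)).symm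

lemma cvEx_pk_ek (hα : 0 < α) (γ : ℝ) (m : ℕ) {a b : ℝ} (ha : 0 < a) (hb : 0 < b) (t : ℝ) :
    CvEx (pk a) (ek α γ m b) t := by
  rcases le_or_gt t 0 with ht | ht
  · refine (cvEx_pk ha hb t).congr (pk_zero a) (pk_zero b) (pk_zero a) (ek_zero m b)
      (Eventually.of_forall fun _ _ => rfl) (Eventually.of_forall fun u hu => ?_)
    rw [pk_zero _ u (by linarith), ek_zero _ _ u (by linarith)]
  · rw [cvEx_iff_intervalIntegrable (pk_zero a) (ek_zero m b) ht.le]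
    have h1 := (cvEx_iff_intervalIntegrable (pk_zero a) (pk_zero b) ht.le).1 (cvEx_pk ha hb t)
    have hw := continuous_ek_factor hα γ m b
    have h2 := h1.mul_continuousOn
      (hw.comp (continuous_const.sub continuous_id : Continuous fun u => t - u)).continuousOn
    refine h2.congr fun u _ => ?_
    simp [ek_eq_pk_mul γ m hb, mul_assoc]

lemma cv_pk_delayKernel (hα : 0 < α) (hτ : 0 < τ) (hs : 0 < α + s) {a : ℝ} (ha : 0 < a) (t : ℝ) :
    CvEx (pk a) (delayKernel α γ γ' τ s) t ∧
      cv (pk a) (delayKernel α γ γ' τ s) t = delayKernel α γ γ' τ (s + a) t := by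
  obtain ⟨N, hN⟩ := exists_le_mul_nat hτ t
  let F : ℕ → ℝ → ℝ := fun m t => γ' ^ m * ek α γ m (α * (m + 1) + s) (t - τ * m)
  have hF0 : ∀ t ≤ 0, (∑ m ∈ Finset.range N, F m t) = 0 := fun t ht =>
    Finset.sum_eq_zero fun m _ => (delayKernel_summand_causal hα hτ hs γ m).zero t ht
  have hFeq : ∀ᵐ u, u < t → delayKernel α γ γ' τ s u = ∑ m ∈ Finset.range N, F m u :=
    Eventually.of_forall fun u hu => delayKernel_eq_sum hτ (hu.le.trans hN)
  have hex : ∀ m, Integrable fun u => pk a u * F m (t - u) := fun m =>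
    ((cvEx_pk_ek hα γ m ha (index_pos hα hs m) (t - τ * m)).shift).const_mul _
  have hcv : ∀ m, ∫ u, pk a u * F m (t - u)
      = γ' ^ m * ek α γ m (α * (m + 1) + (s + a)) (t - τ * m) := fun m => by
    change cv (pk a) (fun u => γ' ^ m * shift (τ * m) (ek α γ m (α * (m + 1) + s)) u) t = _
    rw [cv_const_mul, cv_shift, cv_pk_ek hα γ m ha (index_pos hα hs m), shift, add_assoc]
  constructor
  · refine CvEx.congr (pk_zero a) hF0 (pk_zero a) (delayKernel_zero hτ)
      (Eventually.of_forall fun _ _ => rfl) (hFeq.mono fun u h hu => (h hu).symm) ?_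
    simp only [CvEx, Finset.mul_sum]
    exact integrable_finsetSum _ fun m _ => hex m
  · rw [cv_congr (pk_zero a) (delayKernel_zero hτ) (pk_zero a) hF0
      (Eventually.of_forall fun _ _ => rfl) hFeq, delayKernel_eq_sum hτ hN]
    simp only [cv, Finset.mul_sum]
    rw [integral_finsetSum _ fun m _ => hex m]
    exact Finset.sum_congr rfl fun m _ => hcv m

/-- Pascal's rule summed over the delays. -/
lemma delayKernel_pascal (hα : 0 < α) (hτ : 0 < τ) (γ γ' s t : ℝ) :
    delayKernel α γ γ' τ s t = pk (α + s) t + γ * delayKernel α γ γ' τ (s + α) t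
      + γ' * delayKernel α γ γ' τ (s + α) (t - τ) := by
  obtain ⟨N, hN⟩ := exists_le_mul_nat hτ t
  have hN1 : t ≤ τ * (N + 1 : ℕ) := by push_cast; nlinarith
  rw [delayKernel_eq_sum hτ hN1, delayKernel_eq_sum (s := s + α) hτ hN1,
    delayKernel_eq_sum (t := t - τ) (N := N) hτ (by linarith), Finset.sum_range_succ',
    Finset.sum_range_succ' (fun m : ℕ => γ' ^ m * ek α γ m (α * (m + 1) + (s + α)) (t - τ * m))]
  have h0 := ek_zero_succ hα γ (α + s) t
  have hm : ∀ m : ℕ, γ' ^ (m + 1) * ek α γ (m + 1) (α * ((m + 1 : ℕ) + 1) + s) (t - τ * (m + 1 : ℕ))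
      = γ * (γ' ^ (m + 1) * ek α γ (m + 1) (α * ((m + 1 : ℕ) + 1) + (s + α)) (t - τ * (m + 1 : ℕ)))
        + γ' * (γ' ^ m * ek α γ m (α * (m + 1) + (s + α)) (t - τ - τ * m)) := fun m => by
    rw [ek_succ hα, show t - τ - τ * m = t - τ * (m + 1 : ℕ) by push_cast; ring,
      show α * ((m + 1 : ℕ) + 1) + s + α = α * ((m + 1 : ℕ) + 1) + (s + α) by ring,
      show α * (((m + 1 : ℕ) : ℝ) + 1) + s = α * (m + 1) + (s + α) by push_cast; ring]
    ring
  simp only [hm, Finset.sum_add_distrib, ← Finset.mul_sum]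
  simp only [CharP.cast_eq_zero, zero_add, mul_one, mul_zero, sub_zero, pow_zero, one_mul, h0]
  rw [show α + (s + α) = α + s + α by ring]
  ring

/-- The resolvent equation `S^{(s)} = h_{α+s} + h_α * (γ S^{(s)} + γ' S^{(s)}(· - τ))`, where
`h_b` is the power kernel `pk b`. -/
lemma delayKernel_resolvent (hα : 0 < α) (hτ : 0 < τ) (hs : 0 < α + s) (γ γ' t : ℝ) :
    CvEx (pk α) (fun u => γ * delayKernel α γ γ' τ s u + γ' * shift τ (delayKernel α γ γ' τ s) u) t
    ∧ delayKernel α γ γ' τ s t = pk (α + s) t +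
      cv (pk α)
        (fun u => γ * delayKernel α γ γ' τ s u + γ' * shift τ (delayKernel α γ γ' τ s) u) t := by
  have h1 := cv_pk_delayKernel (γ := γ) (γ' := γ') hα hτ hs hα
  have e1 := (h1 t).1.const_mul γ
  have e2 := ((h1 (t - τ)).1.shift).const_mul γ'
  refine ⟨e1.add e2, ?_⟩
  rw [cv_add e1 e2, cv_const_mul, cv_const_mul, cv_shift, shift, (h1 t).2, (h1 (t - τ)).2,
    delayKernel_pascal hα hτ γ γ' s t]
  ring

/-- `S^{(s)} = h_{α+s} + h_{α+s} * (γ K + γ' K(· - τ))` with `K = S^{(0)}`. -/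
lemma delayKernel_resolvent' (hα : 0 < α) (hτ : 0 < τ) (hs : 0 < α + s) (γ γ' t : ℝ) :
    delayKernel α γ γ' τ s t = pk (α + s) t +
      cv (pk (α + s))
        (fun u => γ * delayKernel α γ γ' τ 0 u + γ' * shift τ (delayKernel α γ γ' τ 0) u) t := by
  have h1 := cv_pk_delayKernel (γ := γ) (γ' := γ') (s := 0) hα hτ (by simpa using hα) hs
  rw [cv_add ((h1 t).1.const_mul γ) (((h1 (t - τ)).1.shift).const_mul γ'), cv_const_mul,
    cv_const_mul, cv_shift, shift, (h1 t).2, (h1 (t - τ)).2, delayKernel_pascal hα hτ γ γ' s t]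
  rw [zero_add, add_comm α s]
  ring

/-- The resolvent kernel `γ K + γ' K(· - τ)` with `K = S^{(0)}`. -/
noncomputable def resKernel (α γ γ' τ t : ℝ) : ℝ :=
  γ * delayKernel α γ γ' τ 0 t + γ' * shift τ (delayKernel α γ γ' τ 0) t

lemma resKernel_causal (hα : 0 < α) (hτ : 0 < τ) : Causal (resKernel α γ γ' τ) :=
  have h := delayKernel_causal (γ := γ) (γ' := γ') (s := 0) hα hτ (by simpa using hα)
  (h.const_mul γ).add ((h.shift hτ.le).const_mul γ')

/-- Pointwise form of `K * f = h_α * (f + γ (K * f) + γ' (K * f)(· - τ))`. -/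
lemma cv_delayKernel_aux (hα : 0 < α) (hτ : 0 < τ) {f : ℝ → ℝ} (hf : Causal f) {t : ℝ}
    (h1 : CvEx f (pk α) t) (h2 : CvEx f (cv (pk α) (resKernel α γ γ' τ)) t)
    (h3 : CvEx (pk α) (cv (resKernel α γ γ' τ) f) t)
    (h4 : cv (cv (pk α) (resKernel α γ γ' τ)) f t = cv (pk α) (cv (resKernel α γ γ' τ) f) t) :
    CvEx (pk α) (fun u => f u + (γ * cv (delayKernel α γ γ' τ 0) f u
      + γ' * shift τ (cv (delayKernel α γ γ' τ 0) f) u)) t ∧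
    cv (delayKernel α γ γ' τ 0) f t = cv (pk α) (fun u => f u +
      (γ * cv (delayKernel α γ γ' τ 0) f u + γ' * shift τ (cv (delayKernel α γ γ' τ 0) f) u)) t := by
  have hα0 : 0 < α + 0 := by simpa using hα
  have hK := delayKernel_causal (γ := γ) (γ' := γ') (s := 0) hα hτ hα0
  have hR := resKernel_causal (γ := γ) (γ' := γ') hα hτ
  have hz := hK.cv hf
  have hz' : Causal fun u => γ * cv (delayKernel α γ γ' τ 0) f u
      + γ' * shift τ (cv (delayKernel α γ γ' τ 0) f) u :=
    (hz.const_mul γ).add ((hz.shift hτ.le).const_mul γ')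
  have hae : ∀ᵐ u, cv (resKernel α γ γ' τ) f u = γ * cv (delayKernel α γ γ' τ 0) f u
      + γ' * shift τ (cv (delayKernel α γ γ' τ 0) f) u := by
    filter_upwards [hf.ae_cvEx hK, hf.ae_cvEx (hK.shift hτ.le)] with u a b
    rw [cv_comm, cv_comm _ f, ← cv_shift, ← cv_const_mul, ← cv_const_mul,
      ← cv_add (a.const_mul γ) (b.const_mul γ')]
    rfl
  have hsum : ∀ᵐ u, u < t → f u + cv (resKernel α γ γ' τ) f u = f u +
      (γ * cv (delayKernel α γ γ' τ 0) f u + γ' * shift τ (cv (delayKernel α γ γ' τ 0) f) u) :=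
    hae.mono fun u h _ => by rw [h]
  constructor
  · exact (h1.symm.add h3).congr (pk_zero α) (hf.add (hR.cv hf)).zero (pk_zero α)
      (hf.add hz').zero (Eventually.of_forall fun _ _ => rfl) hsum
  · rw [← cv_congr (pk_zero α) (hf.add (hR.cv hf)).zero (pk_zero α)
      (hf.add hz').zero (Eventually.of_forall fun _ _ => rfl) hsum, cv_add h1.symm h3, ← h4,
      cv_comm (pk α) f, cv_comm (cv (pk α) _) f, ← cv_add h1 h2, cv_comm _ f]
    refine congrArg (fun w => cv f w t) ?_
    ext u
    have := delayKernel_resolvent' (τ := τ) hα hτ hα0 γ γ' u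
    rw [add_zero] at this
    exact this

lemma cv_delayKernel_ae (hα : 0 < α) (hτ : 0 < τ) {f : ℝ → ℝ} (hf : Causal f) : ∀ᵐ t,
    CvEx (pk α) (fun u => f u + (γ * cv (delayKernel α γ γ' τ 0) f u
      + γ' * shift τ (cv (delayKernel α γ γ' τ 0) f) u)) t ∧
    cv (delayKernel α γ γ' τ 0) f t = cv (pk α) (fun u => f u +
      (γ * cv (delayKernel α γ γ' τ 0) f u + γ' * shift τ (cv (delayKernel α γ γ' τ 0) f) u)) t := by
  have hR := resKernel_causal (γ := γ) (γ' := γ') hα hτ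
  have hp := pk_causal hα
  filter_upwards [hf.ae_cvEx hp, hf.ae_cvEx (hp.cv hR), hp.ae_cvEx (hR.cv hf),
    hp.cv_assoc_ae hR hf] with t h1 h2 h3 h4
  exact cv_delayKernel_aux hα hτ hf h1 h2 h3 h4

lemma cv_delayKernel_of_one_le (hα : 1 ≤ α) (hτ : 0 < τ) {f : ℝ → ℝ} (hf : Causal f) (t : ℝ) :
    CvEx (pk α) (fun u => f u + (γ * cv (delayKernel α γ γ' τ 0) f u
      + γ' * shift τ (cv (delayKernel α γ γ' τ 0) f) u)) t ∧
    cv (delayKernel α γ γ' τ 0) f t = cv (pk α) (fun u => f u +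
      (γ * cv (delayKernel α γ γ' τ 0) f u + γ' * shift τ (cv (delayKernel α γ γ' τ 0) f) u)) t := by
  have hα0 : 0 < α := by linarith
  have hR := resKernel_causal (γ := γ) (γ' := γ') hα0 hτ
  have hp := pk_causal hα0
  have hb := pk_locBdd hα
  have hb' : LocBdd (cv (pk α) (resKernel α γ γ' τ)) := by
    rw [cv_comm]; exact hb.cv hR hp
  refine cv_delayKernel_aux hα0 hτ hf (hb.cvEx hf hp t) (hb'.cvEx hf (hp.cv hR) t)
    (hb.cvEx (hR.cv hf) hp t).symm ?_
  refine cv_assoc hp hR hf (fun t => (hb.abs.cvEx hR.abs hp.abs t).symm) ?_ t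
  rw [cv_comm]; exact hb.abs.cv hR.abs hp.abs

/-- The explicit solution of the scalar delay equation with initial data `b₁, b₂`, constant
source `c` and source `f`. -/
noncomputable def solFun (α γ γ' τ c b₁ s₁ b₂ s₂ : ℝ) (f : ℝ → ℝ) (t : ℝ) : ℝ :=
  c * delayKernel α γ γ' τ 1 t + b₁ * delayKernel α γ γ' τ s₁ t
    + b₂ * delayKernel α γ γ' τ s₂ t + cv (delayKernel α γ γ' τ 0) f t

variable {c b₁ s₁ b₂ s₂ : ℝ} {f : ℝ → ℝ}

lemma solFun_causal (hα : 0 < α) (hτ : 0 < τ) (hs₁ : 0 < α + s₁) (hs₂ : 0 < α + s₂)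
    (hf : Causal f) : Causal (solFun α γ γ' τ c b₁ s₁ b₂ s₂ f) :=
  ((((delayKernel_causal hα hτ (by linarith)).const_mul c).add
    ((delayKernel_causal hα hτ hs₁).const_mul b₁)).add
    ((delayKernel_causal hα hτ hs₂).const_mul b₂)).add
    ((delayKernel_causal hα hτ (by simpa using hα)).cv hf)

/-- The right-hand side of the scalar delay equation. -/
noncomputable def srcFun (γ γ' τ c : ℝ) (f y : ℝ → ℝ) (t : ℝ) : ℝ :=
  c * pk 1 t + f t + (γ * y t + γ' * shift τ y t)

lemma srcFun_causal (hτ : 0 < τ) {y : ℝ → ℝ} (hf : Causal f) (hy : Causal y) :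
    Causal (srcFun γ γ' τ c f y) :=
  (((pk_causal one_pos).const_mul c).add hf).add
    ((hy.const_mul γ).add ((hy.shift hτ.le).const_mul γ'))

lemma solFun_aux (hα : 0 < α) (hτ : 0 < τ) (hs₁ : 0 < α + s₁) (hs₂ : 0 < α + s₂) {t : ℝ}
    (h : CvEx (pk α) (fun u => f u + (γ * cv (delayKernel α γ γ' τ 0) f u
      + γ' * shift τ (cv (delayKernel α γ γ' τ 0) f) u)) t ∧
    cv (delayKernel α γ γ' τ 0) f t = cv (pk α) (fun u => f u +
      (γ * cv (delayKernel α γ γ' τ 0) f u + γ' * shift τ (cv (delayKernel α γ γ' τ 0) f) u)) t) :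
    CvEx (pk α) (srcFun γ γ' τ c f (solFun α γ γ' τ c b₁ s₁ b₂ s₂ f)) t ∧
    solFun α γ γ' τ c b₁ s₁ b₂ s₂ f t = b₁ * pk (α + s₁) t + b₂ * pk (α + s₂) t
      + cv (pk α) (srcFun γ γ' τ c f (solFun α γ γ' τ c b₁ s₁ b₂ s₂ f)) t := by
  obtain ⟨x0, e0⟩ := h
  obtain ⟨x1, e1⟩ := delayKernel_resolvent (s := 1) hα hτ (by linarith) γ γ' t
  obtain ⟨x2, e2⟩ := delayKernel_resolvent hα hτ hs₁ γ γ' t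
  obtain ⟨x3, e3⟩ := delayKernel_resolvent hα hτ hs₂ γ γ' t
  have x4 := (cvEx_pk hα one_pos t).const_mul c
  have hsrc : srcFun γ γ' τ c f (solFun α γ γ' τ c b₁ s₁ b₂ s₂ f) = fun u => c * pk 1 u +
      (c * (γ * delayKernel α γ γ' τ 1 u + γ' * shift τ (delayKernel α γ γ' τ 1) u) +
      (b₁ * (γ * delayKernel α γ γ' τ s₁ u + γ' * shift τ (delayKernel α γ γ' τ s₁) u) +
      (b₂ * (γ * delayKernel α γ γ' τ s₂ u + γ' * shift τ (delayKernel α γ γ' τ s₂) u) +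
      (f u + (γ * cv (delayKernel α γ γ' τ 0) f u
      + γ' * shift τ (cv (delayKernel α γ γ' τ 0) f) u))))) := by
    ext u
    simp only [srcFun, solFun, shift]
    ring
  have y3 := (x3.const_mul b₂).add x0
  have y2 := (x2.const_mul b₁).add y3
  have y1 := (x1.const_mul c).add y2
  rw [hsrc]
  refine ⟨x4.add y1, ?_⟩
  rw [cv_add x4 y1, cv_add (x1.const_mul c) y2, cv_add (x2.const_mul b₁) y3,
    cv_add (x3.const_mul b₂) x0, cv_const_mul, cv_const_mul, cv_const_mul, cv_const_mul,
    cv_pk_pk hα one_pos, ← e0, solFun, e1, e2, e3]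
  ring

lemma solFun_ae (hα : 0 < α) (hτ : 0 < τ) (hs₁ : 0 < α + s₁) (hs₂ : 0 < α + s₂)
    (hf : Causal f) : ∀ᵐ t,
    solFun α γ γ' τ c b₁ s₁ b₂ s₂ f t = b₁ * pk (α + s₁) t + b₂ * pk (α + s₂) t
      + cv (pk α) (srcFun γ γ' τ c f (solFun α γ γ' τ c b₁ s₁ b₂ s₂ f)) t :=
  (cv_delayKernel_ae hα hτ hf).mono fun _ h => (solFun_aux hα hτ hs₁ hs₂ h).2

lemma solFun_of_one_le (hα : 1 ≤ α) (hτ : 0 < τ) (hs₁ : 0 < α + s₁) (hs₂ : 0 < α + s₂)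
    (hf : Causal f) (t : ℝ) :
    solFun α γ γ' τ c b₁ s₁ b₂ s₂ f t = b₁ * pk (α + s₁) t + b₂ * pk (α + s₂) t
      + cv (pk α) (srcFun γ γ' τ c f (solFun α γ γ' τ c b₁ s₁ b₂ s₂ f)) t :=
  (solFun_aux (by linarith) hτ hs₁ hs₂ (cv_delayKernel_of_one_le hα hτ hf t)).2

lemma continuousOn_solFun (hα : 0 < α) (hτ : 0 < τ) (hs₁ : 0 < α + s₁) (hs₂ : 0 < α + s₂)
    (hf : Causal f) (hfc : ContinuousOn f (offGrid τ)) :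
    ContinuousOn (solFun α γ γ' τ c b₁ s₁ b₂ s₂ f) (offGrid τ) := by
  have hα0 : 0 < α + 0 := by simpa using hα
  have h1 : 0 < α + 1 := by linarith
  exact (((continuousOn_const.mul (continuousOn_delayKernel hα hτ h1)).add
    (continuousOn_const.mul (continuousOn_delayKernel hα hτ hs₁))).add
    (continuousOn_const.mul (continuousOn_delayKernel hα hτ hs₂))).add
    (continuousOn_cv_offGrid (delayKernel_causal hα hτ hα0) hf
      (continuousOn_delayKernel hα hτ hα0) hfc)

end

/-- `mlSum` is `S^{(s)}`, except where a delayed summand equals `0 ^ 0`. -/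
lemma mlSum_eq_delayKernel (P : Coeffs) {α τ s : ℝ} (hτ : 0 < τ) (k : Fin 2) {t : ℝ} (ht : 0 < t)
    (h : (∀ m : ℕ, m ≠ 0 → α * (m + 1) + s ≠ 1) ∨ t ∈ offGrid τ) :
    mlSum P α τ s k t = delayKernel α (P.γ k k.succ) (P.γhat k k) τ s t := by
  refine Finset.sum_congr rfl fun m hm => ?_
  have hm' : m ≤ ⌊t / τ⌋₊ := by simpa [Nat.lt_succ_iff] using hm
  have h1 : (m : ℝ) ≤ t / τ := (Nat.le_floor_iff (by positivity)).1 hm'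
  rw [le_div_iff₀ hτ] at h1
  rcases (show 0 ≤ t - τ * m by linarith).eq_or_lt with h0 | h0
  · rcases h with h | h
    · have hm0 : m ≠ 0 := by
        rintro rfl
        simp at h0; linarith
      rw [ek_zero _ _ _ h0.symm.le, ← h0, Real.zero_rpow (sub_ne_zero.2 (h m hm0))]
      ring
    · exact absurd (by push_cast; linarith) ((mem_offGrid_iff hτ).1 h m)
  · rw [ek, if_pos h0, mul_assoc]

lemma mlSum_ae_eq (P : Coeffs) {α τ s : ℝ} (hτ : 0 < τ) (k : Fin 2) :
    ∀ᵐ t, 0 < t → mlSum P α τ s k t = delayKernel α (P.γ k k.succ) (P.γhat k k) τ s t :=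
  (ae_mem_offGrid hτ).mono fun _ h ht => mlSum_eq_delayKernel P hτ k ht (Or.inr h)

/-! ### Primitives of causal functions -/

section
variable {G w : ℝ → ℝ}

lemma continuous_cv_pk_one (hG : Causal G) : Continuous (cv (pk 1) G) := by
  rw [show cv (pk 1) G = _ from funext fun t => cv_pk_one hG t]
  exact intervalIntegral.continuous_primitive (fun a b => hG.intervalIntegrable a b) 0

/-- The primitive of `G` is differentiable where `G` has a continuous representative `g`. -/
lemma hasDerivAt_cv_pk_one {g : ℝ → ℝ} (hG : Causal G) (hg : ∀ᵐ s, 0 < s → G s = g s) {t : ℝ}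
    (ht : 0 < t) (hc : ContinuousAt g t) : HasDerivAt (cv (pk 1) G) (g t) t := by
  rw [show cv (pk 1) G = _ from funext fun t => cv_pk_one hG t]
  refine intervalIntegral.integral_hasDerivAt_of_tendsto_ae_right (hG.intervalIntegrable 0 t)
    (hG.aesm.stronglyMeasurableAtFilter) ?_
  refine Tendsto.congr' ?_ (hc.tendsto.mono_left inf_le_left)
  rw [EventuallyEq]
  filter_upwards [mem_inf_of_left (Ioi_mem_nhds ht), mem_inf_of_right hg] with s hs h
  exact (h hs).symm

lemma ae_hasDerivAt_cv_pk_one (hG : Causal G) : ∀ᵐ t, HasDerivAt (cv (pk 1) G) (G t) t := by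
  rw [show cv (pk 1) G = _ from funext fun t => cv_pk_one hG t]
  exact (_root_.LocallyIntegrable.ae_hasDerivAt_integral hG.locInt).mono fun t h => h 0

lemma cv_pk_two (hG : Causal G) : cv (pk 2) G = cv (pk 1) (cv (pk 1) G) := by
  ext t
  rw [(cv_pk_cv_pk one_pos one_pos (by norm_num) hG t).2]
  norm_num

lemma hasDerivAt_cv_pk_two (hG : Causal G) (t : ℝ) :
    HasDerivAt (cv (pk 2) G) (cv (pk 1) G t) t := by
  have hc := continuous_cv_pk_one hG
  have hP := (pk_causal one_pos).cv hG
  rw [cv_pk_two hG, show cv (pk 1) (cv (pk 1) G) = _ from funext fun t => cv_pk_one hP t]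
  exact intervalIntegral.integral_hasDerivAt_right (hP.intervalIntegrable 0 t)
    (hP.aesm.stronglyMeasurableAtFilter) hc.continuousAt

lemma absolutelyContinuousOnInterval_congr {f g : ℝ → ℝ} {a b : ℝ}
    (hf : AbsolutelyContinuousOnInterval f a b) (h : EqOn f g (uIcc a b)) :
    AbsolutelyContinuousOnInterval g a b := by
  rw [absolutelyContinuousOnInterval_iff] at hf ⊢
  intro ε hε
  obtain ⟨δ, hδ, H⟩ := hf ε hε
  refine ⟨δ, hδ, fun E hE hlt => ?_⟩
  refine lt_of_eq_of_lt (Finset.sum_congr rfl fun i hi => ?_) (H E hE hlt)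
  rw [h (hE.1 i hi).1, h (hE.1 i hi).2]

lemma absolutelyContinuousOnInterval_const_add_cv {f : ℝ → ℝ} (hw : Causal w) {b T : ℝ}
    (hT : 0 ≤ T) (hf : ∀ t, 0 ≤ t → f t = b + cv (pk 1) w t) :
    AbsolutelyContinuousOnInterval f 0 T := by
  have h1 := (hw.intervalIntegrable 0 T).absolutelyContinuousOnInterval_intervalIntegral
    (c := 0) (by simp)
  have h2 : AbsolutelyContinuousOnInterval (fun _ : ℝ => b) 0 T :=
    (LipschitzWith.const b).lipschitzOnWith.absolutelyContinuousOnInterval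
  refine absolutelyContinuousOnInterval_congr (h2.fun_add h1) fun t ht => ?_
  rw [uIcc_of_le hT] at ht
  rw [hf t ht.1, cv_pk_one hw]

/-! ### Sufficient conditions for the fractional differential equations -/

lemma ceil_eq_one {α : ℝ} (h0 : 0 < α) (h1 : α ≤ 1) : ⌈α⌉₊ = 1 := by
  rw [Nat.ceil_eq_iff (by norm_num)]; simpa using ⟨h0, h1⟩

lemma ceil_eq_two {α : ℝ} (h0 : 1 < α) (h1 : α ≤ 2) : ⌈α⌉₊ = 2 := by
  rw [Nat.ceil_eq_iff (by norm_num)]; norm_num; exact ⟨h0, h1⟩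

lemma ae_hasDerivAt_of_eq {f : ℝ → ℝ} (hw : Causal w) {b : ℝ}
    (hf : ∀ t, 0 < t → f t = b + cv (pk 1) w t) : ∀ᵐ t, 0 < t → HasDerivAt f (w t) t := by
  filter_upwards [ae_hasDerivAt_cv_pk_one hw] with t h ht
  refine (h.const_add b).congr_of_eventuallyEq ?_
  filter_upwards [Ioi_mem_nhds ht] with s hs
  exact hf s hs

/-- The weight `w = g₀ h_β + h_β * g'` of the fractional integral equation, for `β = α - n + 1`,
has the `(1 - β)`-th fractional integral `g₀ + ∫ g'`. -/
lemma rlIntegral_of_weight {β g₀ : ℝ} {g' D : ℝ → ℝ} (hβ : 0 < β) (hβ1 : β ≤ 1) (hg : Causal g')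
    (hD : ∀ᵐ t, 0 < t → D t = g₀ * pk β t + cv (pk β) g' t)
    (hD1 : β = 1 → ∀ t, 0 < t → D t = g₀ * pk β t + cv (pk β) g' t) {t : ℝ} (ht : 0 < t) :
    RLIntegrableAt (1 - β) D t ∧ rlIntegral (1 - β) D t = g₀ + cv (pk 1) g' t := by
  have hw : Causal fun t => g₀ * pk β t + cv (pk β) g' t :=
    ((pk_causal hβ).const_mul g₀).add ((pk_causal hβ).cv hg)
  have hae : ∀ᵐ s, 0 < s → s < t → D s = g₀ * pk β s + cv (pk β) g' s :=
    hD.mono fun s h hs _ => h hs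
  rcases hβ1.eq_or_lt with rfl | hlt
  · refine ⟨fun h => absurd (sub_self _) h, ?_⟩
    rw [rlIntegral, if_pos (sub_self _), hD1 rfl t ht, pk_one ht, mul_one]
  · have hpos : 0 < 1 - β := by linarith
    have h1 := cv_pk_cv_pk hpos hβ (by linarith) hg t
    have h2 := (cvEx_pk hpos hβ t).const_mul g₀
    refine ⟨rlIntegrableAt_of_cvEx hpos.le hw ht hae fun _ => h2.add h1.1, ?_⟩
    rw [rlIntegral_eq_cv hpos hw ht hae, cv_add h2 h1.1, cv_const_mul, cv_pk_pk hpos hβ, h1.2,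
      sub_add_cancel, pk_one ht, mul_one]

/-- If `f = b₁ + b₂ t + I^α g` on `[0, ∞)` with `g = g₀ + ∫ g'` locally absolutely continuous, then
the Caputo derivative of order `α` of `f` exists and equals `g`. -/
theorem caputo_of_integral_eq {α b₁ b₂ g₀ : ℝ} {f g' : ℝ → ℝ} (hα : 0 < α) (hα2 : α ≤ 2)
    (hb : α ≤ 1 → b₂ = 0) (hg : Causal g')
    (hf : ∀ t, 0 ≤ t → f t = b₁ + b₂ * t + (g₀ * pk (α + 1) t + cv (pk (α + 1)) g' t)) :
    (∀ t, 0 < t → CaputoDifferentiableAt α f t ∧ caputoDeriv α f t = g₀ + cv (pk 1) g' t) ∧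
    (1 < α → HasDerivWithinAt f b₂ (Ici 0) 0) := by
  have raise : ∀ {β : ℝ}, 0 < β → ∀ t, cv (pk 1) (fun t => g₀ * pk β t + cv (pk β) g' t) t
      = g₀ * pk (β + 1) t + cv (pk (β + 1)) g' t := fun {β} hβ t => by
    have h1 := cv_pk_cv_pk one_pos hβ (by linarith) hg t
    rw [cv_add ((cvEx_pk one_pos hβ t).const_mul g₀) h1.1, cv_const_mul, cv_pk_pk one_pos hβ, h1.2,
      add_comm 1 β]
  have contW : ∀ t : ℝ, 0 < t → ContinuousAt (fun t => g₀ * pk 1 t + cv (pk 1) g' t) t :=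
    fun t ht => (continuousAt_const.mul ((continuousOn_pk 1).continuousAt
      (isOpen_compl_singleton.mem_nhds ht.ne'))).add (continuous_cv_pk_one hg).continuousAt
  rcases le_or_gt α 1 with h1 | h1
  · refine ⟨fun t ht => ?_, fun h => absurd h (not_lt.2 h1)⟩
    have hn := ceil_eq_one hα h1
    set w : ℝ → ℝ := fun t => g₀ * pk α t + cv (pk α) g' t with hwdef
    have hw : Causal w := ((pk_causal hα).const_mul g₀).add ((pk_causal hα).cv hg)
    have hf' : ∀ t, 0 ≤ t → f t = b₁ + cv (pk 1) w t := fun t ht => by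
      rw [hf t ht, raise hα, hb h1]; ring
    have hae := ae_hasDerivAt_of_eq hw fun t ht => hf' t ht.le
    have hder : ∀ t, 0 < t → HasDerivAt f (w t) t → derivWithin f (Ici 0) t = w t :=
      fun t ht h => h.hasDerivWithinAt.derivWithin (uniqueDiffOn_Ici 0 t ht.le)
    have hone : α = 1 → ∀ t, 0 < t → HasDerivAt f (w t) t := by
      intro e t ht
      subst e
      refine ((hasDerivAt_cv_pk_one hw (Eventually.of_forall fun _ _ => rfl) ht
        (contW t ht)).const_add b₁).congr_of_eventuallyEq ?_
      filter_upwards [Ioi_mem_nhds ht] with s hs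
      exact hf' s (le_of_lt hs)
    have key := rlIntegral_of_weight (D := derivWithin f (Ici 0)) hα h1 hg
      (hae.mono fun t h ht => hder t ht (h ht)) (fun e t ht => hder t ht (hone e t ht)) ht
    have hcont : ContinuousOn f (Ici 0) :=
      (continuous_const.add (continuous_cv_pk_one hw)).continuousOn.congr fun t ht => hf' t ht
    constructor
    · refine ⟨?_, ?_, ?_, ?_⟩
      · rw [hn]; simpa using (contDiffOn_zero (𝕜 := ℝ)).2 hcont
      · intro T hT
        rw [hn]
        simpa using absolutelyContinuousOnInterval_const_add_cv hw hT.le hf'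
      · rw [hn, iteratedDerivWithin_one]; simpa using key.1
      · intro e
        rw [hn] at e ⊢
        simpa using (hone (by simpa using e) t ht).differentiableAt
    · rw [caputoDeriv, hn, iteratedDerivWithin_one]; simpa using key.2
  · have hn := ceil_eq_two h1 hα2
    have hβ : 0 < α - 1 := by linarith
    set w : ℝ → ℝ := fun t => g₀ * pk (α - 1) t + cv (pk (α - 1)) g' t with hwdef
    have hw : Causal w := ((pk_causal hβ).const_mul g₀).add ((pk_causal hβ).cv hg)
    have hw1 : cv (pk 1) w = fun t => g₀ * pk α t + cv (pk α) g' t := by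
      ext t; rw [raise hβ, sub_add_cancel]
    have hw2 : ∀ t, cv (pk 2) w t = g₀ * pk (α + 1) t + cv (pk (α + 1)) g' t := fun t => by
      rw [cv_pk_two hw, hw1, raise hα]
    have hdf : ∀ t, 0 ≤ t → HasDerivWithinAt f (b₂ + cv (pk 1) w t) (Ici 0) t := fun t ht => by
      have h3 : HasDerivAt (fun t => b₁ + b₂ * t + cv (pk 2) w t) (b₂ + cv (pk 1) w t) t := by
        have h4 := ((hasDerivAt_id t).const_mul b₂).const_add b₁
        rw [mul_one] at h4
        exact h4.add (hasDerivAt_cv_pk_two hw t)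
      exact h3.hasDerivWithinAt.congr (fun s hs => by rw [hf s hs, hw2]) (by rw [hf t ht, hw2])
    refine ⟨fun t ht => ?_, fun _ => ?_⟩
    swap
    · have := hdf 0 le_rfl
      rwa [cv_of_nonpos (pk_zero 1) hw.zero le_rfl, add_zero] at this
    set v := derivWithin f (Ici 0)
    have hv : ∀ t, 0 ≤ t → v t = b₂ + cv (pk 1) w t := fun t ht =>
      (hdf t ht).derivWithin (uniqueDiffOn_Ici 0 t ht)
    have hae := ae_hasDerivAt_of_eq hw fun t ht => hv t ht.le
    have hder : ∀ t, 0 < t → HasDerivAt v (w t) t → derivWithin v (Ici 0) t = w t :=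
      fun t ht h => h.hasDerivWithinAt.derivWithin (uniqueDiffOn_Ici 0 t ht.le)
    have hone : α - 1 = 1 → ∀ t, 0 < t → HasDerivAt v (w t) t := by
      intro e t ht
      have hc : ContinuousAt w t := by rw [hwdef, e]; exact contW t ht
      refine ((hasDerivAt_cv_pk_one hw (Eventually.of_forall fun _ _ => rfl) ht
        hc).const_add b₂).congr_of_eventuallyEq ?_
      filter_upwards [Ioi_mem_nhds ht] with s hs
      exact hv s (le_of_lt hs)
    have key := rlIntegral_of_weight (D := derivWithin v (Ici 0)) hβ (by linarith) hg
      (hae.mono fun t h ht => hder t ht (h ht)) (fun e t ht => hder t ht (hone e t ht)) ht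
    have e1 : iteratedDerivWithin 1 f (Ici 0) = v := iteratedDerivWithin_one
    have e2 : iteratedDerivWithin 2 f (Ici 0) = derivWithin v (Ici 0) := by
      rw [iteratedDerivWithin_succ, e1]
    have e3 : (2 : ℝ) - α = 1 - (α - 1) := by ring
    constructor
    · refine ⟨?_, ?_, ?_, ?_⟩
      · rw [hn]
        change ContDiffOn ℝ ((1 : ℕ) : WithTop ℕ∞) f (Ici 0)
        rw [Nat.cast_one, contDiffOn_one_iff_derivWithin (uniqueDiffOn_Ici 0)]
        exact ⟨fun t ht => (hdf t ht).differentiableWithinAt,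
          (continuous_const.add (continuous_cv_pk_one hw)).continuousOn.congr fun t ht => hv t ht⟩
      · intro T hT
        rw [hn]
        change AbsolutelyContinuousOnInterval (iteratedDerivWithin 1 f (Ici 0)) 0 T
        rw [e1]
        exact absolutelyContinuousOnInterval_const_add_cv hw hT.le hv
      · rw [hn, e2, Nat.cast_ofNat, e3]; exact key.1
      · intro e
        rw [hn] at e ⊢
        change DifferentiableAt ℝ (iteratedDerivWithin 1 f (Ici 0)) t
        rw [e1]
        refine (hone ?_ t ht).differentiableAt
        push_cast at e; linarith
    · rw [caputoDeriv, hn, e2, Nat.cast_ofNat, e3]; exact key.2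

/-- Fractional integrals of `f = β h_α + κ h_q + h_α * G`. -/
lemma rlIntegral_of_integral_eq {α β κ q σ : ℝ} {f : ℝ → ℝ} (hα : 0 < α) (hq : 0 < q)
    (hG : Causal G) (hσ : 0 ≤ σ) (hασ : 1 ≤ α + σ)
    (hf : ∀ᵐ t, 0 < t → f t = β * pk α t + κ * pk q t + cv (pk α) G t)
    (hf1 : 1 ≤ α → ∀ t, 0 < t → f t = β * pk α t + κ * pk q t + cv (pk α) G t)
    {t : ℝ} (ht : 0 < t) :
    RLIntegrableAt σ f t ∧
    rlIntegral σ f t = β * pk (α + σ) t + κ * pk (q + σ) t + cv (pk (α + σ)) G t := by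
  rcases hσ.eq_or_lt with rfl | hpos
  · refine ⟨fun h => absurd rfl h, ?_⟩
    rw [rlIntegral, if_pos rfl, hf1 (by linarith) t ht, add_zero, add_zero]
  · have hF : Causal fun t => β * pk α t + κ * pk q t + cv (pk α) G t :=
      (((pk_causal hα).const_mul β).add ((pk_causal hq).const_mul κ)).add ((pk_causal hα).cv hG)
    have hae : ∀ᵐ s, 0 < s → s < t → f s = β * pk α s + κ * pk q s + cv (pk α) G s :=
      hf.mono fun s h hs _ => h hs
    have h1 := (cvEx_pk hpos hα t).const_mul β
    have h2 := (cvEx_pk hpos hq t).const_mul κ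
    have h3 := cv_pk_cv_pk hpos hα (by linarith) hG t
    refine ⟨rlIntegrableAt_of_cvEx hpos.le hF ht hae fun _ => (h1.add h2).add h3.1, ?_⟩
    rw [rlIntegral_eq_cv hpos hF ht hae, cv_add (h1.add h2) h3.1, cv_add h1 h2, cv_const_mul,
      cv_const_mul, cv_pk_pk hpos hα, cv_pk_pk hpos hq, h3.2, add_comm σ α, add_comm σ q]

/-- If `f = β h_α + κ h_{α-1} + h_α * G` (without the second term if `α ≤ 1`), then the
Riemann-Liouville derivative of order `α` of `f` exists and equals `G` wherever `G` has a
continuous representative, and `β`, `κ` are the initial values of the derivatives of orders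
`α - 1`, `α - 2`. -/
theorem rl_of_integral_eq {α β κ q : ℝ} {f g : ℝ → ℝ} (hα : 0 < α) (hα2 : α ≤ 2) (hq : 0 < q)
    (hκ : (1 < α ∧ q = α - 1) ∨ (α ≤ 1 ∧ κ = 0)) (hG : Causal G)
    (hg : ∀ᵐ s, 0 < s → G s = g s)
    (hf : ∀ᵐ t, 0 < t → f t = β * pk α t + κ * pk q t + cv (pk α) G t)
    (hf1 : 1 ≤ α → ∀ t, 0 < t → f t = β * pk α t + κ * pk q t + cv (pk α) G t) :
    (∀ t, 0 < t → ContinuousAt g t → RLDifferentiableAt α f t ∧ rlDeriv α f t = g t) ∧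
    ((∀ᶠ t in 𝓝[>] 0, RLDifferentiableAt (α - 1) f t) ∧
      Tendsto (rlDeriv (α - 1) f) (𝓝[>] 0) (𝓝 β)) ∧
    ((∀ᶠ t in 𝓝[>] 0, RLDifferentiableAt (α - 2) f t) ∧
      Tendsto (rlDeriv (α - 2) f) (𝓝[>] 0) (𝓝 (if 1 < α then κ else 0))) := by
  have I := fun (σ : ℝ) (h0 : 0 ≤ σ) (h1 : 1 ≤ α + σ) (t : ℝ) (ht : 0 < t) =>
    rlIntegral_of_integral_eq hα hq hG h0 h1 hf hf1 ht
  have ev : ∀ {t : ℝ}, 0 < t → ∀ᶠ s in 𝓝 t, 0 < s := fun ht => Ioi_mem_nhds ht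
  have c1 := continuous_cv_pk_one hG
  have c2 : Continuous (cv (pk 2) G) := continuous_iff_continuousAt.2 fun t =>
    (hasDerivAt_cv_pk_two hG t).continuousAt
  have lim0 : ∀ {F H : ℝ → ℝ} {l : ℝ}, Continuous H → H 0 = l → (∀ t, 0 < t → F t = H t) →
      Tendsto F (𝓝[>] 0) (𝓝 l) := fun {F H l} hH h0 h => by
    refine Tendsto.congr' ?_ ((h0 ▸ hH.tendsto 0 : Tendsto H (𝓝 0) (𝓝 l)).mono_left
      nhdsWithin_le_nhds)
    filter_upwards [self_mem_nhdsWithin] with s hs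
    exact (h s hs).symm
  have z1 : cv (pk 1) G 0 = 0 := cv_of_nonpos (pk_zero 1) hG.zero le_rfl
  have z2 : cv (pk 2) G 0 = 0 := cv_of_nonpos (pk_zero 2) hG.zero le_rfl
  have hn2 : ⌈α - 2⌉₊ = 0 := Nat.ceil_eq_zero.2 (by linarith)
  have e2 : ((0 : ℕ) : ℝ) - (α - 2) = 2 - α := by push_cast; ring
  have rl2 : ∀ t, 0 < t → RLDifferentiableAt (α - 2) f t := fun t ht => by
    refine ⟨?_, fun j hj => ?_, fun j hj => ?_⟩
    · rw [hn2, e2]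
      exact (ev ht).mono fun s hs => (I (2 - α) (by linarith) (by linarith) s hs).1
    · rw [hn2] at hj; omega
    · rw [hn2] at hj; omega
  have d2 : ∀ t, 0 < t → rlDeriv (α - 2) f t
      = β * pk 2 t + κ * pk (q + (2 - α)) t + cv (pk 2) G t := fun t ht => by
    rw [rlDeriv, hn2, iteratedDeriv_zero, e2, (I (2 - α) (by linarith) (by linarith) t ht).2,
      show α + (2 - α) = 2 by ring]
  have evp : ∀ {p : ℝ → Prop}, (∀ t, 0 < t → p t) → ∀ᶠ t in 𝓝[>] (0 : ℝ), p t := fun h => by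
    filter_upwards [self_mem_nhdsWithin] with s hs
    exact h s hs
  rcases hκ with ⟨h1, rfl⟩ | ⟨h1, rfl⟩
  · have hn := ceil_eq_two h1 hα2
    have hn1 : ⌈α - 1⌉₊ = 1 := ceil_eq_one (by linarith) (by linarith)
    have e1 : ((1 : ℕ) : ℝ) - (α - 1) = 2 - α := by push_cast; ring
    have e0 : ((2 : ℕ) : ℝ) - α = 2 - α := by push_cast; ring
    set F := rlIntegral (2 - α) f with hF
    have hFint : ∀ t, 0 < t → RLIntegrableAt (2 - α) f t := fun t ht =>
      (I (2 - α) (by linarith) (by linarith) t ht).1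
    have hFeq : ∀ t, 0 < t → F t = β * t + κ + cv (pk 2) G t := fun t ht => by
      rw [hF, (I (2 - α) (by linarith) (by linarith) t ht).2, show α + (2 - α) = 2 by ring,
        show α - 1 + (2 - α) = 1 by ring, pk_one ht, pk_two ht, mul_one]
    have hF' : ∀ t, 0 < t → HasDerivAt F (β + cv (pk 1) G t) t := fun t ht => by
      have h4 := ((hasDerivAt_id t).const_mul β).add_const κ
      rw [mul_one] at h4
      refine (h4.add (hasDerivAt_cv_pk_two hG t)).congr_of_eventuallyEq ?_
      filter_upwards [ev ht] with s hs
      exact hFeq s hs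
    have hdF : ∀ t, 0 < t → iteratedDeriv 1 F t = β + cv (pk 1) G t := fun t ht => by
      rw [iteratedDeriv_one]; exact (hF' t ht).deriv
    have hF'' : ∀ t, 0 < t → ContinuousAt g t → HasDerivAt (iteratedDeriv 1 F) (g t) t :=
      fun t ht hc => by
        refine ((hasDerivAt_cv_pk_one hG hg ht hc).const_add β).congr_of_eventuallyEq ?_
        filter_upwards [ev ht] with s hs
        exact hdF s hs
    refine ⟨fun t ht hc => ⟨⟨?_, fun j hj => ?_, fun j hj => ?_⟩, ?_⟩,
      ⟨evp fun t ht => ⟨?_, fun j hj => ?_, fun j hj => ?_⟩, ?_⟩, evp rl2, ?_⟩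
    · rw [hn, e0]; exact (ev ht).mono hFint
    · rw [hn] at hj
      obtain rfl : j = 0 := by omega
      rw [hn, e0, iteratedDeriv_zero]
      exact (ev ht).mono fun s hs => (hF' s hs).differentiableAt
    · rw [hn] at hj
      rw [hn, e0]
      interval_cases j
      · rw [iteratedDeriv_zero]; exact (hF' t ht).differentiableAt
      · exact (hF'' t ht hc).differentiableAt
    · rw [rlDeriv, hn, e0, iteratedDeriv_succ]; exact (hF'' t ht hc).deriv
    · rw [hn1, e1]; exact (ev ht).mono hFint
    · rw [hn1] at hj; omega
    · rw [hn1] at hj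
      obtain rfl : j = 0 := by omega
      rw [hn1, e1, iteratedDeriv_zero]; exact (hF' t ht).differentiableAt
    · refine lim0 (continuous_const.add c1) (by rw [Pi.add_apply, z1, add_zero]) fun t ht => ?_
      rw [rlDeriv, hn1, e1]; exact hdF t ht
    · rw [if_pos h1]
      refine lim0 (H := fun t => β * t + κ + cv (pk 2) G t) (by fun_prop) (by simp [z2])
        fun t ht => ?_
      rw [d2 t ht, show α - 1 + (2 - α) = 1 by ring, pk_one ht, pk_two ht, mul_one]
  · have hn := ceil_eq_one hα h1
    have hn1 : ⌈α - 1⌉₊ = 0 := Nat.ceil_eq_zero.2 (by linarith)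
    have e1 : ((0 : ℕ) : ℝ) - (α - 1) = 1 - α := by push_cast; ring
    have e0 : ((1 : ℕ) : ℝ) - α = 1 - α := by push_cast; ring
    set F := rlIntegral (1 - α) f with hF
    have hFint : ∀ t, 0 < t → RLIntegrableAt (1 - α) f t := fun t ht =>
      (I (1 - α) (by linarith) (by linarith) t ht).1
    have hFeq : ∀ t, 0 < t → F t = β + cv (pk 1) G t := fun t ht => by
      rw [hF, (I (1 - α) (by linarith) (by linarith) t ht).2, show α + (1 - α) = 1 by ring,
        pk_one ht]
      ring
    have hF' : ∀ t, 0 < t → ContinuousAt g t → HasDerivAt F (g t) t := fun t ht hc => by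
      refine ((hasDerivAt_cv_pk_one hG hg ht hc).const_add β).congr_of_eventuallyEq ?_
      filter_upwards [ev ht] with s hs
      exact hFeq s hs
    refine ⟨fun t ht hc => ⟨⟨?_, fun j hj => ?_, fun j hj => ?_⟩, ?_⟩,
      ⟨evp fun t ht => ⟨?_, fun j hj => ?_, fun j hj => ?_⟩, ?_⟩, evp rl2, ?_⟩
    · rw [hn, e0]; exact (ev ht).mono hFint
    · rw [hn] at hj; omega
    · rw [hn] at hj
      obtain rfl : j = 0 := by omega
      rw [hn, e0, iteratedDeriv_zero]; exact (hF' t ht hc).differentiableAt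
    · rw [rlDeriv, hn, e0, iteratedDeriv_one]; exact (hF' t ht hc).deriv
    · rw [hn1, e1]; exact (ev ht).mono hFint
    · rw [hn1] at hj; omega
    · rw [hn1] at hj; omega
    · refine lim0 (continuous_const.add c1) (by rw [Pi.add_apply, z1, add_zero]) fun t ht => ?_
      rw [rlDeriv, hn1, e1, iteratedDeriv_zero]; exact hFeq t ht
    · rw [if_neg (not_lt.2 h1)]
      refine lim0 (H := fun t => β * t + cv (pk 2) G t) (by fun_prop) (by simp [z2]) fun t ht => ?_
      rw [d2 t ht, pk_two ht]; ring

end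

/-! ### Functions with an integrable derivative and two jumps -/

/-- Associativity at every point if the first function is locally bounded. -/
lemma LocBdd.cv_assoc_left {f g k : ℝ → ℝ} (hb : LocBdd f) (hf : Causal f) (hg : Causal g)
    (hk : Causal k) (t : ℝ) : DelayDR.cv (DelayDR.cv f g) k t = DelayDR.cv f (DelayDR.cv g k) t := by
  refine DelayDR.cv_assoc hf hg hk (fun t => (hb.abs.cvEx hg.abs hf.abs t).symm) ?_ t
  rw [cv_comm]; exact hb.abs.cv hg.abs hf.abs

/-- Two functions that are continuous on `(0, ∞)` and agree almost everywhere there are equal. -/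
lemma eqOn_Ioi_of_ae {f g : ℝ → ℝ} (h : ∀ᵐ t, 0 < t → f t = g t)
    (hf : ContinuousOn f (Ioi 0)) (hg : ContinuousOn g (Ioi 0)) {t : ℝ} (ht : 0 < t) :
    f t = g t :=
  Measure.eqOn_open_of_ae_eq (μ := volume)
    ((ae_restrict_iff' measurableSet_Ioi).2 h) isOpen_Ioi hf hg ht

/-- Up to a null set, `f` is a primitive of a causal function plus jumps of heights `c₀` at `0`
and `c₁` at `τ`. -/
def JumpPrimitive (τ c₀ c₁ : ℝ) (f : ℝ → ℝ) : Prop :=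
  ∃ f' : ℝ → ℝ, Causal f' ∧
    ∀ᵐ t, f t = c₀ * pk 1 t + c₁ * shift τ (pk 1) t + cv (pk 1) f' t

namespace JumpPrimitive

variable {τ c₀ c₁ d₀ d₁ : ℝ} {f g K : ℝ → ℝ}

lemma add (hf : JumpPrimitive τ c₀ c₁ f) (hg : JumpPrimitive τ d₀ d₁ g) :
    JumpPrimitive τ (c₀ + d₀) (c₁ + d₁) (fun t => f t + g t) := by
  obtain ⟨f', hf', ef⟩ := hf
  obtain ⟨g', hg', eg⟩ := hg
  refine ⟨_, hf'.add hg', ?_⟩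
  have hb := pk_locBdd le_rfl
  have hp := pk_causal one_pos
  filter_upwards [ef, eg] with t a b
  rw [a, b, cv_add (hb.cvEx hf' hp t).symm (hb.cvEx hg' hp t).symm]
  ring

lemma const_mul (hf : JumpPrimitive τ c₀ c₁ f) (c : ℝ) :
    JumpPrimitive τ (c * c₀) (c * c₁) (fun t => c * f t) := by
  obtain ⟨f', hf', ef⟩ := hf
  refine ⟨_, hf'.const_mul c, ?_⟩
  filter_upwards [ef] with t a
  rw [a, cv_const_mul]
  ring

lemma of_eq {b : ℝ} {w : ℝ → ℝ} (hw : Causal w) (h : ∀ t, f t = b * pk 1 t + cv (pk 1) w t) :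
    JumpPrimitive τ b 0 f :=
  ⟨w, hw, Eventually.of_forall fun t => by rw [h]; ring⟩

lemma shift_of_eq (hτ : 0 ≤ τ) {b : ℝ} {w : ℝ → ℝ} (hw : Causal w)
    (h : ∀ t, f t = b * pk 1 t + cv (pk 1) w t) : JumpPrimitive τ 0 b (shift τ f) :=
  ⟨_, hw.shift hτ, Eventually.of_forall fun t => by
    rw [cv_shift]; simp only [shift, h]; ring⟩

lemma congr {c₀' c₁' : ℝ} (hf : JumpPrimitive τ c₀ c₁ f) (h0 : c₀ = c₀') (h1 : c₁ = c₁')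
    (h : ∀ t, f t = g t) : JumpPrimitive τ c₀' c₁' g := by
  subst h0 h1
  rwa [← funext h]

/-- Convolution with a causal function turns jumps into continuous primitives. -/
lemma cv_eq (hτ : 0 ≤ τ) (hf : JumpPrimitive τ c₀ c₁ f) (hfc : Causal f) (hK : Causal K) :
    ∃ w, Causal w ∧ ∀ t, cv K f t = cv (pk 1) w t := by
  obtain ⟨f', hf', ef⟩ := hf
  have hb := pk_locBdd (b := 1) le_rfl
  have hp := pk_causal one_pos
  have hcv : LocBdd (cv (pk 1) f') := by rw [cv_comm]; exact hb.cv hf' hp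
  have x0 := fun t => (hb.cvEx hK hp t).const_mul c₀
  have x1 := fun t => (hb.cvEx hK hp (t - τ)).shift.const_mul c₁
  have x2 := fun t => hcv.cvEx hK (hp.cv hf') t
  have y0 := fun t => ((hb.cvEx hK hp t).symm).const_mul c₀
  have y1 := fun t => ((hb.cvEx hK hp (t - τ)).symm).shift.const_mul c₁
  have y2 := fun t => (hb.cvEx (hK.cv hf') hp t).symm
  refine ⟨fun t => c₀ * K t + c₁ * shift τ K t + cv K f' t,
    ((hK.const_mul c₀).add ((hK.shift hτ).const_mul c₁)).add (hK.cv hf'), fun t => ?_⟩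
  rw [cv_congr_ae hK.zero hfc.zero
    (((hp.const_mul c₀).add ((hp.shift hτ).const_mul c₁)).add (hp.cv hf')).zero ef,
    cv_add ((x0 t).add (x1 t)) (x2 t), cv_add (x0 t) (x1 t), cv_add ((y0 t).add (y1 t)) (y2 t),
    cv_add (y0 t) (y1 t), cv_const_mul, cv_const_mul, cv_const_mul, cv_const_mul, cv_shift,
    cv_shift, cv_comm K (pk 1), ← hb.cv_assoc hK hp hf', cv_comm K (pk 1),
    hb.cv_assoc_left hp hK hf']

end JumpPrimitive

/-! ### The history -/

/-- The delayed history: `t ↦ φ (t - τ)` on `(0, τ)`, and `0` elsewhere. -/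
noncomputable def hist (τ : ℝ) (φ : ℝ → ℝ) : ℝ → ℝ := (Ioo 0 τ).indicator fun t => φ (t - τ)

lemma hist_of_mem {τ : ℝ} {φ : ℝ → ℝ} {t : ℝ} (h : t ∈ Ioo 0 τ) : hist τ φ t = φ (t - τ) :=
  indicator_of_mem h _

lemma hist_of_ge {τ : ℝ} {φ : ℝ → ℝ} {t : ℝ} (h : τ ≤ t) : hist τ φ t = 0 :=
  indicator_of_notMem (fun h' => absurd h'.2 (not_lt.2 h)) _

lemma causal_delayed_restrict {τ : ℝ} {φ : ℝ → ℝ} (h : IntegrableOn φ (Icc (-τ) 0)) :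
    Causal (hist τ φ) := by
  refine Causal.of_integrableOn (fun t ht =>
    indicator_of_notMem (fun h' => absurd h'.1 (not_lt.2 ht)) _) fun T => Integrable.integrableOn ?_
  have h1 : IntegrableOn φ (Ioo (-τ) 0) := h.mono_set Ioo_subset_Icc_self
  rw [← integrable_indicator_iff measurableSet_Ioo] at h1
  refine (h1.comp_sub_right τ).congr (Eventually.of_forall fun t => ?_)
  have : t - τ ∈ Ioo (-τ) 0 ↔ t ∈ Ioo 0 τ := by
    simp only [mem_Ioo]; constructor <;> rintro ⟨a, b⟩ <;> constructor <;> linarith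
  simp only [hist, indicator, this]

lemma hist_causal {τ : ℝ} {φ : ℝ → ℝ} (hφ : ContinuousOn φ (Icc (-τ) 0)) : Causal (hist τ φ) :=
  causal_delayed_restrict (hφ.integrableOn_compact isCompact_Icc)

lemma continuousOn_hist {τ : ℝ} (hτ : 0 < τ) {φ : ℝ → ℝ} (hφ : ContinuousOn φ (Icc (-τ) 0)) :
    ContinuousOn (hist τ φ) (offGrid τ) := by
  intro t ht
  refine ContinuousAt.continuousWithinAt ?_
  have h0 : t ≠ 0 := by simpa using (mem_offGrid_iff hτ).1 ht 0
  have h1 : t ≠ τ := by simpa using (mem_offGrid_iff hτ).1 ht 1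
  by_cases h : t ∈ Ioo 0 τ
  · have hm : Icc (-τ) 0 ∈ 𝓝 (t - τ) := Icc_mem_nhds (by linarith [h.1]) (by linarith [h.2])
    have : ContinuousAt (fun t => φ (t - τ)) t :=
      ContinuousAt.comp (f := fun t => t - τ) (hφ.continuousAt hm) (by fun_prop)
    refine this.congr ?_
    filter_upwards [isOpen_Ioo.mem_nhds h] with s hs
    exact (hist_of_mem hs).symm
  · have hm : (Icc 0 τ)ᶜ ∈ 𝓝 t := isClosed_Icc.isOpen_compl.mem_nhds fun h' =>
      h ⟨lt_of_le_of_ne h'.1 (Ne.symm h0), lt_of_le_of_ne h'.2 h1⟩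
    refine (continuousAt_const (y := (0 : ℝ))).congr ?_
    filter_upwards [hm] with s hs
    exact (indicator_of_notMem (fun h' => hs (Ioo_subset_Icc_self h')) _).symm

/-- The delayed history jumps from `0` to `φ (-τ)` at `0`, and from `φ 0` to `0` at `τ`. -/
lemma jumpPrimitive_hist {τ : ℝ} (hτ : 0 < τ) {φ : ℝ → ℝ}
    (hφ : AbsolutelyContinuousOnInterval φ (-τ) 0) :
    JumpPrimitive τ (φ (-τ)) (-φ 0) (hist τ φ) := by
  have hint := hφ.intervalIntegrable_deriv
  rw [intervalIntegrable_iff, uIoc_of_le (by linarith), ← integrableOn_Icc_iff_integrableOn_Ioc]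
    at hint
  have hw := causal_delayed_restrict hint
  have hne0 : ∀ᵐ t : ℝ, t ≠ 0 := by simp [ae_iff]
  have hneτ : ∀ᵐ t : ℝ, t ≠ τ := by simp [ae_iff]
  refine ⟨_, hw, ?_⟩
  -- the primitive of the restricted derivative is `φ (t - τ) - φ (-τ)`, stopped at `t = τ`
  have key : ∀ t, 0 < t → t ≤ τ → ∫ s in (0 : ℝ)..t, hist τ (deriv φ) s = φ (t - τ) - φ (-τ) := by
    intro t h0 h1
    have hsub : uIcc (-τ) (t - τ) ⊆ uIcc (-τ) 0 := by
      rw [uIcc_of_le (by linarith), uIcc_of_le (by linarith)]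
      exact Icc_subset_Icc_right (by linarith)
    rw [← (hφ.mono hsub).integral_deriv_eq_sub, show -τ = 0 - τ by ring,
      ← intervalIntegral.integral_comp_sub_right]
    refine intervalIntegral.integral_congr_ae ?_
    filter_upwards [hneτ] with s hs hmem
    rw [uIoc_of_le h0.le] at hmem
    exact hist_of_mem ⟨hmem.1, lt_of_le_of_ne (hmem.2.trans h1) hs⟩
  filter_upwards [hne0, hneτ] with t h0 h1
  rw [cv_pk_one hw]
  rcases lt_or_gt_of_ne h0 with h | h
  · rw [← cv_pk_one hw, cv_of_nonpos (pk_zero 1) hw.zero h.le, pk_zero _ t h.le, shift,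
      pk_zero _ (t - τ) (by linarith), (hist_causal (by
        rw [← uIcc_of_le (by linarith : -τ ≤ 0)]; exact hφ.continuousOn)).zero t h.le]
    ring
  rcases lt_or_gt_of_ne h1 with h' | h'
  · rw [key t h h'.le, hist_of_mem ⟨h, h'⟩, pk_one h, shift, pk_zero _ (t - τ) (by linarith)]
    ring
  · rw [← intervalIntegral.integral_add_adjacent_intervals (hw.intervalIntegrable 0 τ)
      (hw.intervalIntegrable τ t), key τ hτ le_rfl, intervalIntegral.integral_congr (g := fun _ => 0)
      (fun s hs => ?_), intervalIntegral.integral_zero, pk_one h, shift, pk_one (by linarith),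
      hist_of_ge h'.le, sub_self]
    · ring
    · rw [uIcc_of_le h'.le] at hs
      exact hist_of_ge hs.1

/-! ### Solutions with absolutely continuous history -/

section
variable {α γ γ' τ c b₁ b₂ c₀ c₁ : ℝ} {f : ℝ → ℝ}

lemma solFun_eq_primitive (hα : 0 < α) (hτ : 0 < τ) (hf : Causal f)
    (hJ : JumpPrimitive τ c₀ c₁ f) :
    ∃ w, Causal w ∧ ∀ t, solFun α γ γ' τ c b₁ (1 - α) b₂ (2 - α) f t
      = b₁ * pk 1 t + cv (pk 1) w t := by
  have hα0 : 0 < α + 0 := by simpa using hα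
  have h1 : 0 < α + (1 - α) := by linarith
  have hK := delayKernel_causal (γ := γ) (γ' := γ') hα hτ hα0
  have hL := delayKernel_causal (γ := γ) (γ' := γ') hα hτ h1
  have hR := resKernel_causal (γ := γ) (γ' := γ') hα hτ
  obtain ⟨w, hw, ew⟩ := hJ.cv_eq hτ.le hf hK
  have hb := pk_locBdd (b := 1) le_rfl
  have hp := pk_causal one_pos
  have ex : ∀ {u : ℝ → ℝ}, Causal u → ∀ t, CvEx (pk 1) u t := fun hu t => (hb.cvEx hu hp t).symm
  refine ⟨fun t => (c * delayKernel α γ γ' τ 0 t + b₁ * resKernel α γ γ' τ t)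
    + (b₂ * delayKernel α γ γ' τ (1 - α) t + w t), ((hK.const_mul c).add (hR.const_mul b₁)).add
    ((hL.const_mul b₂).add hw), fun t => ?_⟩
  rw [cv_add (ex ((hK.const_mul c).add (hR.const_mul b₁)) t) (ex ((hL.const_mul b₂).add hw) t),
    cv_add (ex (hK.const_mul c) t) (ex (hR.const_mul b₁) t),
    cv_add (ex (hL.const_mul b₂) t) (ex hw t), cv_const_mul, cv_const_mul, cv_const_mul,
    (cv_pk_delayKernel hα hτ hα0 one_pos t).2, (cv_pk_delayKernel hα hτ h1 one_pos t).2, ← ew,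
    solFun, delayKernel_resolvent' hα hτ h1, show α + (1 - α) = 1 by ring, zero_add,
    show 1 - α + 1 = 2 - α by ring]
  change _ + b₁ * (_ + cv (pk 1) (resKernel α γ γ' τ) t) + _ + _ = _
  ring

lemma solFun_eq_of_jumpPrimitive (hα : 0 < α) (hτ : 0 < τ) (hf : Causal f)
    (hJ : JumpPrimitive τ c₀ c₁ f) (hc : c₁ + γ' * b₁ = 0) :
    ∃ g₀ g', Causal g' ∧
      (∀ᵐ t, srcFun γ γ' τ c f (solFun α γ γ' τ c b₁ (1 - α) b₂ (2 - α) f) t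
        = g₀ * pk 1 t + cv (pk 1) g' t) ∧
      ∀ t, 0 < t → solFun α γ γ' τ c b₁ (1 - α) b₂ (2 - α) f t
        = b₁ + b₂ * t + (g₀ * pk (α + 1) t + cv (pk (α + 1)) g' t) := by
  obtain ⟨w, hw, ew⟩ := solFun_eq_primitive (γ := γ) (γ' := γ') (c := c) (b₁ := b₁) (b₂ := b₂)
    hα hτ hf hJ
  set y := solFun α γ γ' τ c b₁ (1 - α) b₂ (2 - α) f with hy
  have hp := pk_causal one_pos
  have hone : JumpPrimitive τ 1 0 (pk 1) := by
    refine JumpPrimitive.of_eq (w := fun _ => 0) ⟨fun _ _ => rfl, locallyIntegrable_zero⟩ fun t => ?_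
    simp [cv]
  have hsrc : JumpPrimitive τ (c * 1 + c₀ + (γ * b₁ + γ' * 0)) (c * 0 + c₁ + (γ * 0 + γ' * b₁))
      (srcFun γ γ' τ c f y) :=
    ((hone.const_mul c).add hJ).add (((JumpPrimitive.of_eq hw ew).const_mul γ).add
      ((JumpPrimitive.shift_of_eq hτ.le hw ew).const_mul γ'))
  obtain ⟨g', hg', eg⟩ := hsrc
  set g₀ := c * 1 + c₀ + (γ * b₁ + γ' * 0)
  have eg' : ∀ᵐ t, srcFun γ γ' τ c f y t = g₀ * pk 1 t + cv (pk 1) g' t := by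
    filter_upwards [eg] with t h
    rw [h, show c * 0 + c₁ + (γ * 0 + γ' * b₁) = 0 by linarith]; ring
  refine ⟨g₀, g', hg', eg', fun t ht => ?_⟩
  have hs₁ : 0 < α + (1 - α) := by linarith
  have hs₂ : 0 < α + (2 - α) := by linarith
  have hyc : Causal y := solFun_causal hα hτ hs₁ hs₂ hf
  have hcv : ∀ t, cv (pk α) (srcFun γ γ' τ c f y) t
      = g₀ * pk (α + 1) t + cv (pk (α + 1)) g' t := fun t => by
    have h1 := cv_pk_cv_pk hα one_pos (by linarith) hg' t
    rw [cv_congr_ae (pk_zero α) (srcFun_causal hτ hf hyc).zero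
      ((hp.const_mul g₀).add (hp.cv hg')).zero eg',
      cv_add ((cvEx_pk hα one_pos t).const_mul g₀) h1.1, cv_const_mul, cv_pk_pk hα one_pos, h1.2]
  have hae : ∀ᵐ t, 0 < t → y t = b₁ + b₂ * t + (g₀ * pk (α + 1) t + cv (pk (α + 1)) g' t) := by
    filter_upwards [solFun_ae (γ := γ) (γ' := γ') (c := c) (b₁ := b₁) (b₂ := b₂) hα hτ hs₁ hs₂ hf]
      with t h ht
    rw [← hcv, hy, h, show α + (1 - α) = 1 by ring, show α + (2 - α) = 2 by ring, pk_one ht,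
      pk_two ht, mul_one]
  have hpc : ∀ b, ContinuousOn (pk b) (Ioi 0) := fun b =>
    (continuousOn_pk b).mono fun t ht => ne_of_gt ht
  refine eqOn_Ioi_of_ae hae ?_ ?_ ht
  · rw [show y = _ from funext ew]
    exact (continuousOn_const.mul (hpc 1)).add (continuous_cv_pk_one hw).continuousOn
  · have e : cv (pk (α + 1)) g' = cv (pk 1) (cv (pk α) g') := by
      ext t
      rw [(cv_pk_cv_pk one_pos hα (by linarith) hg' t).2, add_comm]
    rw [e]
    have h3 := continuous_cv_pk_one ((pk_causal hα).cv hg')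
    exact ((by fun_prop : Continuous fun t : ℝ => b₁ + b₂ * t).continuousOn).add
      ((continuousOn_const.mul (hpc _)).add h3.continuousOn)

end

/-! ### The system in separated form -/

/-- `conv` as a convolution of causal functions; only values on `(0, ∞)` up to null sets matter. -/
lemma conv_eq_cv {A F K f : ℝ → ℝ} (hK : ∀ t ≤ 0, K t = 0) (hf : ∀ t ≤ 0, f t = 0)
    (hA : ∀ᵐ s, 0 < s → A s = K s) (hF : ∀ᵐ s, 0 < s → F s = f s) {t : ℝ} (ht : 0 < t) :
    conv A F t = cv K f t := by
  rw [cv_comm, cv_eq_intervalIntegral hf hK ht.le, conv]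
  refine intervalIntegral.integral_congr_ae ?_
  have h1 : ∀ᵐ s, 0 < t - s → A (t - s) = K (t - s) :=
    (Measure.measurePreserving_sub_left volume t).quasiMeasurePreserving.ae hA
  have h2 : ∀ᵐ s : ℝ, s ≠ t := by simp [ae_iff]
  filter_upwards [h1, hF, h2] with s a b hne hs
  rw [uIoc_of_le ht.le] at hs
  rw [a (sub_pos.2 (lt_of_le_of_ne hs.2 hne)), b hs.1, mul_comm]

/-- The data of an initial value problem: coefficients satisfying the constraints on the reaction
terms, continuous history, and two initial values per component entering with weights `b₁ S^{(s₁)}`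
and `b₂ S^{(s₂)}`. -/
structure Problem where
  P : Coeffs
  α : ℝ
  τ : ℝ
  φ : Fin 2 → Fin 2 → ℝ → ℝ
  b₁ : Fin 2 → Fin 2 → ℝ
  b₂ : Fin 2 → Fin 2 → ℝ
  s₁ : ℝ
  s₂ : ℝ
  hα : 0 < α
  hα2 : α ≤ 2
  hτ : 0 < τ
  hs₁ : 0 < α + s₁
  hs₂ : 0 < α + s₂
  hφ : ∀ k i, ContinuousOn (φ k i) (Icc (-τ) 0)
  hγ : P.γ 1 1 = 0
  hγhat : P.γhat 1 0 = 0

namespace Problem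

variable (D : Problem)

/-- The contribution of the initial values to `δ_{k,i}`. -/
noncomputable def H (k i : Fin 2) (t : ℝ) : ℝ :=
  D.b₁ k i * mlSum D.P D.α D.τ D.s₁ k t + D.b₂ k i * mlSum D.P D.α D.τ D.s₂ k t

/-- The functions `δ_{k,i}`. -/
noncomputable def delta : Fin 2 → Fin 2 → ℝ → ℝ :=
  ![deltaOne D.P D.α D.τ D.φ D.H, deltaTwo D.P D.α D.τ D.φ D.H]

/-- The constant source, which only enters the coefficient of `1`. -/
def const (k i : Fin 2) : ℝ := if i = 0 then D.P.γ k 0 else 0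

/-- The forcing of the second component: the delayed history. -/
noncomputable def forceTwo (i : Fin 2) (t : ℝ) : ℝ := D.P.γhat 1 1 * hist D.τ (D.φ 1 i) t

/-- The causal part of `δ_{2,i}`. -/
noncomputable def solTwo (i : Fin 2) : ℝ → ℝ :=
  solFun D.α (D.P.γ 1 2) (D.P.γhat 1 1) D.τ (D.const 1 i) (D.b₁ 1 i) D.s₁ (D.b₂ 1 i) D.s₂
    (D.forceTwo i)

/-- The forcing of the first component: the delayed history and the second component. -/
noncomputable def forceOne (i : Fin 2) (t : ℝ) : ℝ :=
  D.P.γhat 0 0 * hist D.τ (D.φ 0 i) t + (D.P.γhat 0 1 * hist D.τ (D.φ 1 i) t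
    + (D.P.γhat 0 1 * shift D.τ (D.solTwo i) t + D.P.γ 0 2 * D.solTwo i t))

/-- The causal part of `δ_{1,i}`. -/
noncomputable def solOne (i : Fin 2) : ℝ → ℝ :=
  solFun D.α (D.P.γ 0 1) (D.P.γhat 0 0) D.τ (D.const 0 i) (D.b₁ 0 i) D.s₁ (D.b₂ 0 i) D.s₂
    (D.forceOne i)

/-- The forcing of the `k`-th component. -/
noncomputable def force : Fin 2 → Fin 2 → ℝ → ℝ := ![D.forceOne, D.forceTwo]

/-- The causal parts of the functions `δ_{k,i}`. -/
noncomputable def sol : Fin 2 → Fin 2 → ℝ → ℝ := ![D.solOne, D.solTwo]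

lemma sol_eq (k i : Fin 2) : D.sol k i =
    solFun D.α (D.P.γ k k.succ) (D.P.γhat k k) D.τ (D.const k i) (D.b₁ k i) D.s₁ (D.b₂ k i) D.s₂
      (D.force k i) := by
  fin_cases k <;> rfl

/-- The right-hand side of the scalar delay equation solved by `sol k i`. -/
noncomputable def src (k i : Fin 2) : ℝ → ℝ :=
  srcFun (D.P.γ k k.succ) (D.P.γhat k k) D.τ (D.const k i) (D.force k i) (D.sol k i)

/-- The coefficient of `1` (`i = 0`) or `x` (`i = 1`) of the right-hand side of the system. -/
noncomputable def rhs (k i : Fin 2) (t : ℝ) : ℝ :=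
  D.const k i + D.P.γ k 2 * D.delta 1 i t + D.P.γ k 1 * D.delta 0 i t
    + D.P.γhat k 0 * D.delta 0 i (t - D.τ) + D.P.γhat k 1 * D.delta 1 i (t - D.τ)

lemma forceTwo_causal (i : Fin 2) : Causal (D.forceTwo i) := (hist_causal (D.hφ 1 i)).const_mul _

lemma solTwo_causal (i : Fin 2) : Causal (D.solTwo i) :=
  solFun_causal D.hα D.hτ D.hs₁ D.hs₂ (D.forceTwo_causal i)

lemma force_causal (k i : Fin 2) : Causal (D.force k i) := by
  fin_cases k
  · exact ((hist_causal (D.hφ 0 i)).const_mul _).add (((hist_causal (D.hφ 1 i)).const_mul _).add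
      ((((D.solTwo_causal i).shift D.hτ.le).const_mul _).add ((D.solTwo_causal i).const_mul _)))
  · exact D.forceTwo_causal i

lemma sol_causal (k i : Fin 2) : Causal (D.sol k i) := by
  rw [sol_eq]; exact solFun_causal D.hα D.hτ D.hs₁ D.hs₂ (D.force_causal k i)

lemma src_causal (k i : Fin 2) : Causal (D.src k i) :=
  srcFun_causal D.hτ (D.force_causal k i) (D.sol_causal k i)

lemma continuousOn_force (k i : Fin 2) : ContinuousOn (D.force k i) (offGrid D.τ) := by
  have h := fun k => continuousOn_hist D.hτ (D.hφ k i)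
  have h2 : ContinuousOn (D.forceTwo i) (offGrid D.τ) := continuousOn_const.mul (h 1)
  fin_cases k
  · have hs : ContinuousOn (D.solTwo i) (offGrid D.τ) :=
      continuousOn_solFun D.hα D.hτ D.hs₁ D.hs₂ (D.forceTwo_causal i) h2
    have hs' : ContinuousOn (shift D.τ (D.solTwo i)) (offGrid D.τ) :=
      hs.comp (by fun_prop : Continuous fun t : ℝ => t - D.τ).continuousOn fun t ht => by
        simpa using sub_mul_mem_offGrid D.hτ ht 1
    exact (continuousOn_const.mul (h 0)).add ((continuousOn_const.mul (h 1)).add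
      ((continuousOn_const.mul hs').add (continuousOn_const.mul hs)))
  · exact h2

lemma continuousOn_sol (k i : Fin 2) : ContinuousOn (D.sol k i) (offGrid D.τ) := by
  rw [sol_eq]
  exact continuousOn_solFun D.hα D.hτ D.hs₁ D.hs₂ (D.force_causal k i) (D.continuousOn_force k i)

/-- No delayed summand of the functions `H` is a power `0 ^ 0` at a multiple of `τ`. -/
def Regular : Prop :=
  ∀ m : ℕ, m ≠ 0 → D.α * (m + 1) + D.s₁ ≠ 1 ∧ D.α * (m + 1) + D.s₂ ≠ 1

lemma delta_of_nonpos (k i : Fin 2) {t : ℝ} (ht : t ≤ 0) : D.delta k i t = D.φ k i t := by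
  fin_cases k
  · exact if_pos ht
  · exact if_pos ht

variable {D}

lemma H_eq (k i : Fin 2) {t : ℝ} (ht : 0 < t) (h : D.Regular ∨ t ∈ offGrid D.τ) :
    D.H k i t = D.b₁ k i * delayKernel D.α (D.P.γ k k.succ) (D.P.γhat k k) D.τ D.s₁ t
      + D.b₂ k i * delayKernel D.α (D.P.γ k k.succ) (D.P.γhat k k) D.τ D.s₂ t := by
  rw [H, mlSum_eq_delayKernel D.P D.hτ k ht (h.imp_left fun h m hm => (h m hm).1),
    mlSum_eq_delayKernel D.P D.hτ k ht (h.imp_left fun h m hm => (h m hm).2)]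

lemma const_mul_mlF1 (k i : Fin 2) {t : ℝ} (ht : 0 < t) :
    (if i = 0 then D.P.γ k 0 * mlF1 D.P D.α D.τ k t else 0)
      = D.const k i * delayKernel D.α (D.P.γ k k.succ) (D.P.γhat k k) D.τ 1 t := by
  have hα := D.hα
  have : mlF1 D.P D.α D.τ k t = delayKernel D.α (D.P.γ k k.succ) (D.P.γhat k k) D.τ 1 t :=
    mlSum_eq_delayKernel D.P D.hτ k ht (Or.inl fun m _ => by
      have : 0 < D.α * (m + 1) := by positivity
      linarith)
  rw [this, const]
  split_ifs <;> simp

lemma hist_eq_mul_rho (φ : ℝ → ℝ) {s : ℝ} (hs : 0 < s) :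
    hist D.τ φ s = φ (s - D.τ) * rho (s - D.τ) := by
  rcases lt_or_ge s D.τ with h | h
  · rw [hist_of_mem ⟨hs, h⟩, rho, if_neg (by linarith), mul_one]
  · rw [hist_of_ge h, rho, if_pos (by linarith), mul_zero]

lemma deltaTwo_eq_sol (i : Fin 2) {t : ℝ} (ht : 0 < t) (h : D.Regular ∨ t ∈ offGrid D.τ) :
    deltaTwo D.P D.α D.τ D.φ D.H i t = D.solTwo i t := by
  have hh := hist_causal (D.hφ 1 i)
  have hK := delayKernel_causal (γ := D.P.γ 1 2) (γ' := D.P.γhat 1 1) (s := 0) D.hα D.hτ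
    (by simpa using D.hα)
  have hc : conv (mlF3 D.P D.α D.τ 1) (fun s => D.φ 1 i (s - D.τ) * rho (s - D.τ)) t
      = cv (delayKernel D.α (D.P.γ 1 2) (D.P.γhat 1 1) D.τ 0) (hist D.τ (D.φ 1 i)) t :=
    conv_eq_cv hK.zero hh.zero (mlSum_ae_eq D.P D.hτ 1)
      (Eventually.of_forall fun s hs => (hist_eq_mul_rho _ hs).symm) ht
  rw [deltaTwo, if_neg (not_le.2 ht), hc, H_eq 1 i ht h, const_mul_mlF1 1 i ht, solTwo, solFun,
    show D.forceTwo i = fun s => D.P.γhat 1 1 * hist D.τ (D.φ 1 i) s from rfl, cv_const_mul]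
  simp only [show Fin.succ (1 : Fin 2) = 2 from rfl]
  ring

lemma deltaOne_eq_sol (i : Fin 2) {t : ℝ} (ht : 0 < t) (h : D.Regular ∨ t ∈ offGrid D.τ) :
    deltaOne D.P D.α D.τ D.φ D.H i t = D.solOne i t := by
  have hf : Causal (D.forceOne i) := D.force_causal 0 i
  have hK := delayKernel_causal (γ := D.P.γ 0 1) (γ' := D.P.γhat 0 0) (s := 0) D.hα D.hτ
    (by simpa using D.hα)
  have hc : conv (mlF3 D.P D.α D.τ 0) (fun s =>
        (D.P.γhat 0 0 * D.φ 0 i (s - D.τ) + D.P.γhat 0 1 * D.φ 1 i (s - D.τ)) * rho (s - D.τ)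
        + D.P.γhat 0 1 * (if D.τ ≤ s then deltaTwo D.P D.α D.τ D.φ D.H i (s - D.τ) else 0)
        + D.P.γ 0 2 * deltaTwo D.P D.α D.τ D.φ D.H i s) t
      = cv (delayKernel D.α (D.P.γ 0 1) (D.P.γhat 0 0) D.τ 0) (D.forceOne i) t := by
    refine conv_eq_cv hK.zero hf.zero (mlSum_ae_eq D.P D.hτ 0) ?_ ht
    filter_upwards [ae_mem_offGrid D.hτ] with s hs h0
    have hs' : s - D.τ ∈ offGrid D.τ := by simpa using sub_mul_mem_offGrid D.hτ hs 1
    have hne : s - D.τ ≠ 0 := by simpa using (mem_offGrid_iff D.hτ).1 hs' 0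
    have hd : (if D.τ ≤ s then deltaTwo D.P D.α D.τ D.φ D.H i (s - D.τ) else 0)
        = shift D.τ (D.solTwo i) s := by
      rw [shift]
      split_ifs with hle
      · exact deltaTwo_eq_sol i (lt_of_le_of_ne (by linarith) (Ne.symm hne)) (Or.inr hs')
      · rw [(D.solTwo_causal i).zero _ (by linarith)]
    rw [hd, deltaTwo_eq_sol i h0 (Or.inr hs), forceOne, hist_eq_mul_rho _ h0, hist_eq_mul_rho _ h0]
    ring
  rw [deltaOne, if_neg (not_le.2 ht), hc, H_eq 0 i ht h, const_mul_mlF1 0 i ht, solOne, solFun]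
  simp only [show Fin.succ (0 : Fin 2) = 1 from rfl]
  ring

lemma delta_eq_sol (k i : Fin 2) {t : ℝ} (ht : 0 < t) (h : D.Regular ∨ t ∈ offGrid D.τ) :
    D.delta k i t = D.sol k i t := by
  fin_cases k
  · exact deltaOne_eq_sol i ht h
  · exact deltaTwo_eq_sol i ht h

/-- Off the grid, the delayed value splits into the history and the delayed causal part. -/
lemma delta_sub (k i : Fin 2) {t : ℝ} (ht : 0 < t) (h : t ∈ offGrid D.τ) :
    D.delta k i (t - D.τ) = hist D.τ (D.φ k i) t + shift D.τ (D.sol k i) t := by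
  have h' : t - D.τ ∈ offGrid D.τ := by simpa using sub_mul_mem_offGrid D.hτ h 1
  have hne : t - D.τ ≠ 0 := by simpa using (mem_offGrid_iff D.hτ).1 h' 0
  rcases lt_or_gt_of_ne hne with hlt | hgt
  · rw [D.delta_of_nonpos k i hlt.le, hist_of_mem ⟨ht, by linarith⟩, shift,
      (D.sol_causal k i).zero _ hlt.le, add_zero]
  · rw [delta_eq_sol k i hgt (Or.inr h'), hist_of_ge (by linarith), shift, zero_add]

/-- The causal right-hand side is the actual one: the delayed history and the delayed causal part
add up to the delayed solution. -/
lemma src_eq_rhs (k i : Fin 2) : ∀ᵐ t, 0 < t → D.src k i t = D.rhs k i t := by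
  filter_upwards [ae_mem_offGrid D.hτ] with t ho ht
  have e1 := fun k => delta_eq_sol k i ht (Or.inr ho)
  have e2 := fun k => delta_sub k i ht ho
  rw [rhs, e1, e1, e2, e2, src, srcFun, pk_one ht]
  fin_cases k
  · simp only [force, forceOne, sol, shift, Fin.zero_eta, Matrix.cons_val_zero,
      Matrix.cons_val_one, show Fin.succ (0 : Fin 2) = 1 from rfl]
    ring
  · simp only [force, forceTwo, sol, shift, Fin.mk_one, Matrix.cons_val_zero,
      Matrix.cons_val_one, show Fin.succ (1 : Fin 2) = 2 from rfl, D.hγ, D.hγhat]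
    ring

lemma continuousAt_delta (k i : Fin 2) {t : ℝ} (ht : -D.τ < t) (h : t ∈ offGrid D.τ) :
    ContinuousAt (D.delta k i) t := by
  have h0 : t ≠ 0 := by simpa using (mem_offGrid_iff D.hτ).1 h 0
  rcases lt_or_gt_of_ne h0 with hlt | hgt
  · refine ((D.hφ k i).continuousAt (Icc_mem_nhds ht hlt)).congr ?_
    filter_upwards [Iio_mem_nhds hlt] with s hs
    exact (D.delta_of_nonpos k i (le_of_lt hs)).symm
  · refine ((D.continuousOn_sol k i).continuousAt ((isOpen_offGrid _).mem_nhds h)).congr ?_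
    filter_upwards [Ioi_mem_nhds hgt, (isOpen_offGrid _).mem_nhds h] with s hs hs'
    exact (delta_eq_sol k i hs (Or.inr hs')).symm

lemma continuousAt_rhs (k i : Fin 2) {t : ℝ} (h : ∀ k, ContinuousAt (D.delta k i) t)
    (h' : ∀ k, ContinuousAt (D.delta k i) (t - D.τ)) : ContinuousAt (D.rhs k i) t := by
  have hs : ∀ k, ContinuousAt (fun t => D.delta k i (t - D.τ)) t := fun k =>
    ContinuousAt.comp (f := fun t => t - D.τ) (h' k) (by fun_prop)
  exact (((continuousAt_const.add (continuousAt_const.mul (h 1))).add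
    (continuousAt_const.mul (h 0))).add (continuousAt_const.mul (hs 0))).add
    (continuousAt_const.mul (hs 1))

/-- Under the constraints on the diffusion coefficients, the right-hand side of the system is
affine in `x`. -/
lemma delayRHS_sepForm (h1 : ∀ k, D.P.a k 2 = -D.P.b k 1) (h2 : ∀ k, D.P.a k 1 = 0)
    (h3 : ∀ k, D.P.b k 2 = 0) (k : Fin 2) (x t : ℝ) :
    delayRHS D.P D.τ (sepForm D.delta) k x t = D.rhs k 0 t + D.rhs k 1 t * x := by
  have hd : ∀ (p q x : ℝ), deriv (fun y => p + q * y) x = q := fun p q x => by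
    simp
  have hA : (fun y => (D.P.a k 2 * sepForm D.delta 1 y t + D.P.a k 1 * sepForm D.delta 0 y t
        + D.P.a k 0) * deriv (fun y => sepForm D.delta 0 y t) y
      + (D.P.b k 2 * sepForm D.delta 1 y t + D.P.b k 1 * sepForm D.delta 0 y t + D.P.b k 0)
        * deriv (fun y => sepForm D.delta 1 y t) y)
      = fun _ => (-D.P.b k 1 * D.delta 1 0 t + D.P.a k 0) * D.delta 0 1 t
        + (D.P.b k 1 * D.delta 0 0 t + D.P.b k 0) * D.delta 1 1 t := by
    ext y
    simp only [sepForm, hd, h1, h2, h3]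
    ring
  rw [delayRHS, drOperator, hA, deriv_const]
  simp only [sepForm, rhs, const, if_true, show (1 : Fin 2) ≠ 0 by decide, if_false]
  ring

/-! ### The Riemann-Liouville problem -/

/-- The integral equation `δ = b₁ h_{α+s₁} + b₂ h_{α+s₂} + I^α (rhs)`, almost everywhere. -/
lemma delta_ae_eq_rl (k i : Fin 2) : ∀ᵐ t, 0 < t → D.delta k i t
    = D.b₁ k i * pk (D.α + D.s₁) t + D.b₂ k i * pk (D.α + D.s₂) t + cv (pk D.α) (D.src k i) t := by
  have h := solFun_ae (γ := D.P.γ k k.succ) (γ' := D.P.γhat k k) (c := D.const k i)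
    (b₁ := D.b₁ k i) (b₂ := D.b₂ k i) D.hα D.hτ D.hs₁ D.hs₂ (D.force_causal k i)
  rw [← sol_eq] at h
  filter_upwards [h, ae_mem_offGrid D.hτ] with t h ho ht
  rw [delta_eq_sol k i ht (Or.inr ho), h, src]

/-- For `α ≥ 1` the integral equation holds at every `t > 0`; this is needed if `α` is an integer,
when the Riemann-Liouville derivative of order `α` is an ordinary derivative of `δ` itself. -/
lemma delta_eq_rl (hreg : D.Regular) (hα1 : 1 ≤ D.α) (k i : Fin 2) {t : ℝ} (ht : 0 < t) :
    D.delta k i t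
    = D.b₁ k i * pk (D.α + D.s₁) t + D.b₂ k i * pk (D.α + D.s₂) t + cv (pk D.α) (D.src k i) t := by
  have h := solFun_of_one_le (γ := D.P.γ k k.succ) (γ' := D.P.γhat k k) (c := D.const k i)
    (b₁ := D.b₁ k i) (b₂ := D.b₂ k i) hα1 D.hτ D.hs₁ D.hs₂ (D.force_causal k i) t
  rw [← sol_eq] at h
  rw [delta_eq_sol k i ht (Or.inl hreg), h, src]

/-- The Riemann-Liouville equation and initial conditions for `c₀ δ_{k,1} + c₁ δ_{k,2}`, which
covers both the coefficients and `u_k(x, ·)`. -/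
lemma rl_combination (hs₁ : D.s₁ = 0)
    (hs₂ : (1 < D.α ∧ D.s₂ = -1) ∨ (D.α ≤ 1 ∧ ∀ k i, D.b₂ k i = 0))
    (hreg : 1 ≤ D.α → D.Regular) (k : Fin 2) (c₀ c₁ : ℝ) {f : ℝ → ℝ}
    (hf : ∀ t, f t = c₀ * D.delta k 0 t + c₁ * D.delta k 1 t) :
    (∀ t, 0 < t → (∀ i, ContinuousAt (D.rhs k i) t) → RLDifferentiableAt D.α f t ∧
      rlDeriv D.α f t = c₀ * D.rhs k 0 t + c₁ * D.rhs k 1 t) ∧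
    ((∀ᶠ t in 𝓝[>] 0, RLDifferentiableAt (D.α - 1) f t) ∧
      Tendsto (rlDeriv (D.α - 1) f) (𝓝[>] 0) (𝓝 (c₀ * D.b₁ k 0 + c₁ * D.b₁ k 1))) ∧
    ((∀ᶠ t in 𝓝[>] 0, RLDifferentiableAt (D.α - 2) f t) ∧
      Tendsto (rlDeriv (D.α - 2) f) (𝓝[>] 0)
        (𝓝 (if 1 < D.α then c₀ * D.b₂ k 0 + c₁ * D.b₂ k 1 else 0))) := by
  have hs := fun i => D.src_causal k i
  have hG : Causal fun t => c₀ * D.src k 0 t + c₁ * D.src k 1 t :=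
    ((hs 0).const_mul c₀).add ((hs 1).const_mul c₁)
  have hp := pk_causal D.hα
  have hg : ∀ᵐ t, 0 < t → c₀ * D.src k 0 t + c₁ * D.src k 1 t
      = c₀ * D.rhs k 0 t + c₁ * D.rhs k 1 t := by
    filter_upwards [D.src_eq_rhs k 0, D.src_eq_rhs k 1] with t a b ht
    rw [a ht, b ht]
  have comb : ∀ {t : ℝ}, (∀ i, CvEx (pk D.α) (D.src k i) t) → (∀ i, D.delta k i t
      = D.b₁ k i * pk (D.α + D.s₁) t + D.b₂ k i * pk (D.α + D.s₂) t
        + cv (pk D.α) (D.src k i) t) →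
      f t = (c₀ * D.b₁ k 0 + c₁ * D.b₁ k 1) * pk D.α t
        + (c₀ * D.b₂ k 0 + c₁ * D.b₂ k 1) * pk (D.α + D.s₂) t
        + cv (pk D.α) (fun t => c₀ * D.src k 0 t + c₁ * D.src k 1 t) t := by
    intro t hex h
    rw [hf, h, h, cv_add ((hex 0).const_mul c₀) ((hex 1).const_mul c₁), cv_const_mul, cv_const_mul,
      hs₁, add_zero]
    ring
  have h1 := rl_of_integral_eq (β := c₀ * D.b₁ k 0 + c₁ * D.b₁ k 1)
    (κ := c₀ * D.b₂ k 0 + c₁ * D.b₂ k 1) (q := D.α + D.s₂) (f := f) D.hα D.hα2 D.hs₂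
    (hs₂.imp (fun h => ⟨h.1, by rw [h.2]; ring⟩) fun h => ⟨h.1, by rw [h.2, h.2]; ring⟩) hG hg
    (by
      filter_upwards [hp.ae_cvEx (hs 0), hp.ae_cvEx (hs 1), delta_ae_eq_rl k 0, delta_ae_eq_rl k 1]
        with t a b c d ht
      refine comb (fun i => ?_) (fun i => ?_) <;> fin_cases i
      exacts [a, b, c ht, d ht])
    (fun hα1 t ht => comb (fun i => ((pk_locBdd hα1).cvEx (hs i) hp t).symm)
      fun i => delta_eq_rl (hreg hα1) hα1 k i ht)
  exact ⟨fun t ht hc => h1.1 t ht ((continuousAt_const.mul (hc 0)).add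
    (continuousAt_const.mul (hc 1))), h1.2⟩

/-! ### The Caputo problem -/

/-- For absolutely continuous history, the right-hand side is `g₀ + ∫ g'` up to a null set, and the
solution is `b₁ + b₂ t + I^α (g₀ + ∫ g')` at every `t > 0`. -/
lemma exists_caputo_rep (hs₁ : D.s₁ = 1 - D.α) (hs₂ : D.s₂ = 2 - D.α)
    (hb : ∀ k i, D.b₁ k i = D.φ k i 0)
    (hac : ∀ k i, AbsolutelyContinuousOnInterval (D.φ k i) (-D.τ) 0) (k i : Fin 2) :
    ∃ g₀ g', Causal g' ∧ (∀ᵐ t, D.src k i t = g₀ * pk 1 t + cv (pk 1) g' t) ∧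
      ∀ t, 0 < t → D.sol k i t
        = D.b₁ k i + D.b₂ k i * t + (g₀ * pk (D.α + 1) t + cv (pk (D.α + 1)) g' t) := by
  have hJ : ∀ k, JumpPrimitive D.τ (D.φ k i (-D.τ)) (-D.φ k i 0) (hist D.τ (D.φ k i)) :=
    fun k => jumpPrimitive_hist D.hτ (hac k i)
  have hF2 : JumpPrimitive D.τ _ (D.P.γhat 1 1 * -D.φ 1 i 0) (D.forceTwo i) := (hJ 1).const_mul _
  -- the jump at `τ` of the delayed history is compensated by the jump of the solution at `0`
  have key : ∃ c₀ c₁, JumpPrimitive D.τ c₀ c₁ (D.force k i) ∧ c₁ + D.P.γhat k k * D.b₁ k i = 0 := by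
    fin_cases k
    · obtain ⟨w, hw, ew⟩ := solFun_eq_primitive (γ := D.P.γ 1 2) (γ' := D.P.γhat 1 1)
        (c := D.const 1 i) (b₁ := D.b₁ 1 i) (b₂ := D.b₂ 1 i) D.hα D.hτ (D.forceTwo_causal i) hF2
      have hsol : ∀ t, D.solTwo i t = D.b₁ 1 i * pk 1 t + cv (pk 1) w t := by
        rw [solTwo, hs₁, hs₂]; exact ew
      refine ⟨_, _, ((hJ 0).const_mul (D.P.γhat 0 0)).add (((hJ 1).const_mul (D.P.γhat 0 1)).add
        (((JumpPrimitive.shift_of_eq D.hτ.le hw hsol).const_mul (D.P.γhat 0 1)).add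
        ((JumpPrimitive.of_eq hw hsol).const_mul (D.P.γ 0 2)))), ?_⟩
      simp only [Fin.zero_eta, hb]
      ring
    · refine ⟨_, _, hF2, ?_⟩
      simp only [Fin.mk_one, hb]
      ring
  obtain ⟨c₀, c₁, hJk, hc⟩ := key
  have h := solFun_eq_of_jumpPrimitive (γ := D.P.γ k k.succ) (c := D.const k i)
    (b₂ := D.b₂ k i) D.hα D.hτ (D.force_causal k i) hJk hc
  rw [← hs₁, ← hs₂, ← sol_eq] at h
  exact h

lemma regular_caputo (hs₁ : D.s₁ = 1 - D.α) (hs₂ : D.s₂ = 2 - D.α) : D.Regular := by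
  intro m hm
  have hm' : 0 < (m : ℝ) := by positivity
  have := mul_pos D.hα hm'
  rw [hs₁, hs₂]
  constructor <;> intro h <;> linarith

/-- The Caputo equation and initial conditions for `c₀ δ_{k,1} + c₁ δ_{k,2}`. -/
lemma caputo_combination (hs₁ : D.s₁ = 1 - D.α) (hs₂ : D.s₂ = 2 - D.α)
    (hb : ∀ k i, D.b₁ k i = D.φ k i 0) (hb₂ : D.α ≤ 1 → ∀ k i, D.b₂ k i = 0)
    (hac : ∀ k i, AbsolutelyContinuousOnInterval (D.φ k i) (-D.τ) 0) (k : Fin 2) (c₀ c₁ : ℝ)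
    {f : ℝ → ℝ} (hf : ∀ t, f t = c₀ * D.delta k 0 t + c₁ * D.delta k 1 t) :
    (∀ t, 0 < t → CaputoDifferentiableAt D.α f t ∧
      caputoDeriv D.α f t = c₀ * D.rhs k 0 t + c₁ * D.rhs k 1 t) ∧
    (1 < D.α → HasDerivWithinAt f (c₀ * D.b₂ k 0 + c₁ * D.b₂ k 1) (Ici 0) 0) := by
  have hreg := regular_caputo hs₁ hs₂
  choose g₀ g' hg' hsrc hsol using exists_caputo_rep hs₁ hs₂ hb hac
  have hα1 : 1 ≤ D.α + 1 := by linarith [D.hα]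
  have hp := pk_causal (show 0 < D.α + 1 by linarith)
  have hp1 := pk_causal one_pos
  have rep : ∀ k i t, 0 ≤ t → D.delta k i t
      = D.b₁ k i + D.b₂ k i * t
        + (g₀ k i * pk (D.α + 1) t + cv (pk (D.α + 1)) (g' k i) t) := by
    intro k i t ht
    rcases ht.eq_or_lt with rfl | ht
    · rw [D.delta_of_nonpos k i le_rfl, pk_zero _ 0 le_rfl,
        cv_of_nonpos hp.zero (hg' k i).zero le_rfl, hb]
      ring
    · rw [delta_eq_sol k i ht (Or.inl hreg), hsol k i t ht]
  have hex : ∀ {b : ℝ}, 1 ≤ b → ∀ k i t, CvEx (pk b) (g' k i) t := fun hb k i t =>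
    ((pk_locBdd hb).cvEx (hg' k i) (pk_causal (by linarith)) t).symm
  have hcomb : ∀ {b : ℝ}, 1 ≤ b → ∀ t, cv (pk b) (fun t => c₀ * g' k 0 t + c₁ * g' k 1 t) t
      = c₀ * cv (pk b) (g' k 0) t + c₁ * cv (pk b) (g' k 1) t := fun hb t => by
    rw [cv_add ((hex hb k 0 t).const_mul c₀) ((hex hb k 1 t).const_mul c₁), cv_const_mul,
      cv_const_mul]
  -- the solution and hence the right-hand side are continuous, also at multiples of `τ`
  have hcI : ∀ k i, ContinuousOn (D.delta k i) (Ici 0) := by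
    intro k i
    have h := caputo_of_integral_eq (f := D.delta k i) D.hα D.hα2 (fun h => hb₂ h k i) (hg' k i)
      (rep k i)
    exact (h.1 1 one_pos).1.contDiffOn.continuousOn
  have hcont : ∀ k i, ContinuousOn (D.delta k i) (Ici (-D.τ)) := by
    intro k i
    have h1 : ContinuousOn (D.delta k i) (Icc (-D.τ) 0) :=
      (D.hφ k i).congr fun t ht => D.delta_of_nonpos k i ht.2
    refine (h1.union_of_isClosed (hcI k i) isClosed_Icc isClosed_Ici).mono fun t ht => ?_
    rcases le_total t 0 with h | h
    exacts [Or.inl ⟨ht, h⟩, Or.inr h]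
  have hrhs : ∀ i t, 0 < t → D.rhs k i t = g₀ k i + cv (pk 1) (g' k i) t := by
    intro i t ht
    refine eqOn_Ioi_of_ae ?_ (fun s hs => ?_)
      (continuous_const.add (continuous_cv_pk_one (hg' k i))).continuousOn ht
    · filter_upwards [src_eq_rhs k i, hsrc k i] with s a b hs
      rw [← a hs, b, pk_one hs, mul_one]; rfl
    · have hs : 0 < s := hs
      have hτ := D.hτ
      exact (continuousAt_rhs k i
        (fun k => (hcont k i).continuousAt (Ici_mem_nhds (by linarith)))
        (fun k => (hcont k i).continuousAt (Ici_mem_nhds (by linarith)))).continuousWithinAt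
  have main := caputo_of_integral_eq (f := f) (b₁ := c₀ * D.b₁ k 0 + c₁ * D.b₁ k 1)
    (b₂ := c₀ * D.b₂ k 0 + c₁ * D.b₂ k 1) (g₀ := c₀ * g₀ k 0 + c₁ * g₀ k 1) D.hα D.hα2
    (fun h => by rw [hb₂ h, hb₂ h]; ring)
    (((hg' k 0).const_mul c₀).add ((hg' k 1).const_mul c₁)) (fun t ht => by
      rw [hf, rep k 0 t ht, rep k 1 t ht, hcomb hα1]; ring)
  refine ⟨fun t ht => ⟨(main.1 t ht).1, ?_⟩, main.2⟩
  rw [(main.1 t ht).2, hcomb le_rfl, hrhs 0 t ht, hrhs 1 t ht]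
  ring

end Problem

/-! ### The invariant space -/

lemma mem_polySpace_iff (U : Fin 2 → ℝ → ℝ) :
    U ∈ polySpace ↔ ∀ k, ∃ p q : ℝ, ∀ x, U k x = p + q * x := by
  simp only [polySpace, Submodule.mem_pi, mem_univ, true_imp_iff, Submodule.mem_span_pair]
  refine forall_congr' fun k => exists_congr fun p => exists_congr fun q => ?_
  constructor
  · rintro h x
    rw [← h]; simp
  · intro h
    ext x
    rw [h]; simp

lemma sepForm_mem_polySpace (δ : Fin 2 → Fin 2 → ℝ → ℝ) (t : ℝ) :
    (fun k x => sepForm δ k x t) ∈ polySpace :=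
  (mem_polySpace_iff _).2 fun k => ⟨δ k 0 t, δ k 1 t, fun _ => rfl⟩

lemma drOperator_mem_polySpace (P : Coeffs) {U V : Fin 2 → ℝ → ℝ} (hU : U ∈ polySpace)
    (hV : V ∈ polySpace) : drOperator P U V ∈ polySpace := by
  rw [mem_polySpace_iff] at hU hV ⊢
  choose p q hU using hU
  choose p' q' hV using hV
  intro k
  have hd : ∀ (p q x : ℝ), HasDerivAt (fun y => p + q * y) q x := fun p q x => by
    simpa using ((hasDerivAt_id x).const_mul q).const_add p
  have hU' : ∀ j, U j = fun y => p j + q j * y := fun j => funext (hU j)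
  set m := (P.a k 2 * q 1 + P.a k 1 * q 0) * q 0 + (P.b k 2 * q 1 + P.b k 1 * q 0) * q 1 with hm
  have hF : ∀ x, deriv (fun y => (P.a k 2 * U 1 y + P.a k 1 * U 0 y + P.a k 0) * deriv (U 0) y
      + (P.b k 2 * U 1 y + P.b k 1 * U 0 y + P.b k 0) * deriv (U 1) y) x = m := by
    intro x
    have : (fun y => (P.a k 2 * U 1 y + P.a k 1 * U 0 y + P.a k 0) * deriv (U 0) y
        + (P.b k 2 * U 1 y + P.b k 1 * U 0 y + P.b k 0) * deriv (U 1) y)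
        = fun y => ((P.a k 2 * p 1 + P.a k 1 * p 0 + P.a k 0) * q 0
          + (P.b k 2 * p 1 + P.b k 1 * p 0 + P.b k 0) * q 1) + m * y := by
      ext y
      rw [hU' 0, hU' 1, (hd _ _ _).deriv, (hd _ _ _).deriv]
      ring
    rw [this]
    exact (hd _ _ _).deriv
  refine ⟨m + P.γ k 2 * p 1 + P.γ k 1 * p 0 + P.γ k 0 + P.γhat k 0 * p' 0 + P.γhat k 1 * p' 1,
    P.γ k 2 * q 1 + P.γ k 1 * q 0 + P.γhat k 0 * q' 0 + P.γhat k 1 * q' 1, fun x => ?_⟩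
  rw [drOperator, hF, hU, hU, hV, hV]
  ring

end DelayDR

theorem mainTheorem7 (P : DelayDR.Coeffs) (α τ : ℝ) (hα : 0 < α) (hα2 : α ≤ 2) (hτ : 0 < τ) :
    -- invariance of `L{1, x} × L{1, x}`, for all coefficients
    (∀ U V : Fin 2 → ℝ → ℝ, U ∈ DelayDR.polySpace → V ∈ DelayDR.polySpace →
      DelayDR.drOperator P U V ∈ DelayDR.polySpace) ∧
    -- explicit solutions under the parameter constraints
    ((∀ k, P.a k 2 = -P.b k 1) → (∀ k, P.a k 1 = 0) → (∀ k, P.b k 2 = 0) →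
      P.γ 1 1 = 0 → P.γhat 1 0 = 0 →
      -- Caputo derivative
      (∀ (φ : Fin 2 → Fin 2 → ℝ → ℝ) (κ : Fin 2 → Fin 2 → ℝ),
        (∀ k i, AbsolutelyContinuousOnInterval (φ k i) (-τ) 0) →
        ∀ (δ : Fin 2 → Fin 2 → ℝ → ℝ) (u : Fin 2 → ℝ → ℝ → ℝ),
          δ = DelayDR.caputoDelta P α τ φ κ → u = DelayDR.sepForm δ →
          (∀ t, 0 < t → DelayDR.CaputoSolvesAt P α τ u t) ∧
          (∀ k x, ∀ t ∈ Set.Icc (-τ) 0, u k x t = φ k 0 t + φ k 1 t * x) ∧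
          (∀ t, (fun k x => u k x t) ∈ DelayDR.polySpace) ∧
          (∀ k x, u k x 0 = φ k 0 0 + φ k 1 0 * x) ∧
          (1 < α → (∀ k i, HasDerivWithinAt (δ k i) (κ k i) (Set.Ici 0) 0) ∧
            ∀ k x, HasDerivWithinAt (u k x) (κ k 0 + κ k 1 * x) (Set.Ici 0) 0) ∧
          (∀ κ' : Fin 2 → Fin 2 → ℝ,
            (∀ k i, HasDerivWithinAt (δ k i) (κ' k i) (Set.Ici 0) 0) →
            ∀ k x, HasDerivWithinAt (u k x) (κ' k 0 + κ' k 1 * x) (Set.Ici 0) 0) ∧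
          (∀ k t, u k 0 t = δ k 0 t) ∧
          (∀ k l t, u k l t = δ k 0 t + l * δ k 1 t)) ∧
      -- Riemann-Liouville derivative
      (∀ (φ : Fin 2 → Fin 2 → ℝ → ℝ) (β κ : Fin 2 → Fin 2 → ℝ),
        (∀ k i, ContinuousOn (φ k i) (Set.Icc (-τ) 0)) →
        ∀ (δ : Fin 2 → Fin 2 → ℝ → ℝ) (u : Fin 2 → ℝ → ℝ → ℝ),
          δ = DelayDR.rlDelta P α τ φ β κ → u = DelayDR.sepForm δ →
          (∀ t, 0 < t →
            ((∀ m : ℕ, t ≠ m * τ) ∨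
              ∀ k i, ContinuousAt (δ k i) t ∧ ContinuousAt (δ k i) (t - τ)) →
            DelayDR.RLSolvesAt P α τ u t) ∧
          (∀ k x, ∀ t ∈ Set.Icc (-τ) 0, u k x t = φ k 0 t + φ k 1 t * x) ∧
          (∀ t, (fun k x => u k x t) ∈ DelayDR.polySpace) ∧
          (∀ k i, (∀ᶠ t in 𝓝[>] 0, DelayDR.RLDifferentiableAt (α - 1) (δ k i) t) ∧
            Tendsto (DelayDR.rlDeriv (α - 1) (δ k i)) (𝓝[>] 0) (𝓝 (β k i))) ∧
          (∀ k x, (∀ᶠ t in 𝓝[>] 0, DelayDR.RLDifferentiableAt (α - 1) (u k x) t) ∧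
            Tendsto (DelayDR.rlDeriv (α - 1) (u k x)) (𝓝[>] 0) (𝓝 (β k 0 + β k 1 * x))) ∧
          (∀ k i, (∀ᶠ t in 𝓝[>] 0, DelayDR.RLDifferentiableAt (α - 2) (δ k i) t) ∧
            Tendsto (DelayDR.rlDeriv (α - 2) (δ k i)) (𝓝[>] 0)
              (𝓝 (if 1 < α then κ k i else 0))) ∧
          (∀ k x, (∀ᶠ t in 𝓝[>] 0, DelayDR.RLDifferentiableAt (α - 2) (u k x) t) ∧
            Tendsto (DelayDR.rlDeriv (α - 2) (u k x)) (𝓝[>] 0)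
              (𝓝 (if 1 < α then κ k 0 + κ k 1 * x else 0))) ∧
          (∀ k t, u k 0 t = δ k 0 t) ∧
          (∀ k l t, u k l t = δ k 0 t + l * δ k 1 t))) := by
  open DelayDR in
  refine ⟨fun U V hU hV => drOperator_mem_polySpace P hU hV, fun h1 h2 h3 hγ hγhat => ⟨?_, ?_⟩⟩
  · rintro φ κ hac δ u rfl rfl
    let D : Problem :=
      { P, α, τ, φ, hα, hα2, hτ, hγ, hγhat
        b₁ := fun k i => φ k i 0
        b₂ := fun k i => if 1 < α then κ k i else 0
        s₁ := 1 - α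
        s₂ := 2 - α
        hs₁ := by linarith
        hs₂ := by linarith
        hφ := fun k i => by
          rw [← Set.uIcc_of_le (by linarith : -τ ≤ 0)]; exact (hac k i).continuousOn }
    have hδ : caputoDelta P α τ φ κ = D.delta := by
      have hH : (fun k i t => φ k i 0 * mlF2 P α τ k t
          + (if 1 < α then κ k i * mlF4 P α τ k t else 0)) = D.H := by
        ext k i t
        simp only [Problem.H, D, mlF2, mlF4, ite_mul, zero_mul]
      simp only [caputoDelta, hH, Problem.delta, D]
    rw [hδ]
    have comb := fun (k : Fin 2) (c₀ c₁ : ℝ) (f : ℝ → ℝ)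
      (hf : ∀ t, f t = c₀ * D.delta k 0 t + c₁ * D.delta k 1 t) =>
      Problem.caputo_combination (D := D) rfl rfl (fun _ _ => rfl)
        (fun h _ _ => if_neg (not_lt.2 h)) hac k c₀ c₁ hf
    have combU := fun (k : Fin 2) (x : ℝ) => comb k 1 x (sepForm D.delta k x) fun t => by
      rw [sepForm]; ring
    have hist0 : ∀ k x, ∀ t ∈ Set.Icc (-τ) 0, sepForm D.delta k x t = φ k 0 t + φ k 1 t * x :=
      fun k x t ht => by
        rw [sepForm, D.delta_of_nonpos k 0 ht.2, D.delta_of_nonpos k 1 ht.2]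
    have dU : ∀ κ' : Fin 2 → Fin 2 → ℝ,
        (∀ k i, HasDerivWithinAt (D.delta k i) (κ' k i) (Set.Ici 0) 0) →
        ∀ k x, HasDerivWithinAt (sepForm D.delta k x) (κ' k 0 + κ' k 1 * x) (Set.Ici 0) 0 :=
      fun κ' h k x => (h k 0).add ((h k 1).mul_const x)
    have dδ : 1 < α → ∀ k i, HasDerivWithinAt (D.delta k i) (κ k i) (Set.Ici 0) 0 := by
      intro h k i
      have hb : ∀ i, D.b₂ k i = κ k i := fun i => if_pos h
      fin_cases i
      · simpa [hb] using (comb k 1 0 (D.delta k 0) fun t => by ring).2 h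
      · simpa [hb] using (comb k 0 1 (D.delta k 1) fun t => by ring).2 h
    refine ⟨fun t ht k => ⟨?_, fun x => ⟨((combU k x).1 t ht).1, ?_⟩⟩, hist0,
      sepForm_mem_polySpace D.delta, fun k x => hist0 k x 0 ⟨by linarith, le_rfl⟩,
      fun h => ⟨dδ h, dU κ (dδ h)⟩, dU, fun k t => ?_, fun k l t => ?_⟩
    · unfold sepForm; fun_prop
    · refine ((combU k x).1 t ht).2.trans ?_
      rw [show delayRHS P τ (sepForm D.delta) k x t = _ from
        Problem.delayRHS_sepForm (D := D) h1 h2 h3 k x t]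
      ring
    · simp [sepForm]
    · simp [sepForm, mul_comm]
  · rintro φ β κ hφ δ u rfl rfl
    let D : Problem :=
      { P, α, τ, φ, hα, hα2, hτ, hγ, hγhat, hφ
        b₁ := β
        b₂ := fun k i => if 1 < α then κ k i else 0
        s₁ := 0
        s₂ := if 1 < α then -1 else 0
        hs₁ := by linarith
        hs₂ := by split_ifs <;> linarith }
    have hδ : rlDelta P α τ φ β κ = D.delta := by
      have hH : (fun k i t => β k i * mlG1 P α τ k t
          + (if 1 < α then κ k i * mlG2 P α τ k t else 0)) = D.H := by
        ext k i t
        by_cases h : 1 < α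
        · simp only [Problem.H, D, mlG1, mlG2, if_pos h]
        · simp only [Problem.H, D, mlG1, if_neg h, zero_mul]
      simp only [rlDelta, hH, Problem.delta, D]
    rw [hδ]
    have hreg : 1 ≤ α → D.Regular := by
      intro h m hm
      have hm' : (1 : ℝ) ≤ m := by exact_mod_cast Nat.one_le_iff_ne_zero.2 hm
      have h2 : α * 2 ≤ α * (m + 1) := by gcongr; linarith
      refine ⟨fun e => ?_, fun e => ?_⟩
      · change α * (m + 1) + 0 = 1 at e
        linarith
      · change α * (m + 1) + (if 1 < α then -1 else 0) = 1 at e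
        split_ifs at e <;> linarith
    have hs₂ : (1 < D.α ∧ D.s₂ = -1) ∨ (D.α ≤ 1 ∧ ∀ k i, D.b₂ k i = 0) := by
      rcases lt_or_ge 1 α with h | h
      · exact Or.inl ⟨h, if_pos h⟩
      · exact Or.inr ⟨h, fun _ _ => if_neg (not_lt.2 h)⟩
    have comb := fun (k : Fin 2) (c₀ c₁ : ℝ) (f : ℝ → ℝ)
      (hf : ∀ t, f t = c₀ * D.delta k 0 t + c₁ * D.delta k 1 t) =>
      Problem.rl_combination (D := D) rfl hs₂ hreg k c₀ c₁ hf
    have combU := fun (k : Fin 2) (x : ℝ) => comb k 1 x (sepForm D.delta k x) fun t => by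
      rw [sepForm]; ring
    have combδ : ∀ k i, _ ∧ _ := fun k i => (comb k (if i = 0 then 1 else 0)
      (if i = 0 then 0 else 1) (D.delta k i) fun t => by fin_cases i <;> simp).2
    have eb : ∀ (v : Fin 2 → ℝ) (i : Fin 2),
        (if i = 0 then 1 else 0) * v 0 + (if i = 0 then 0 else 1) * v 1 = v i := fun v i => by
      fin_cases i <;> simp
    have eκ : ∀ k i, (if 1 < D.α then D.b₂ k i else 0) = if 1 < α then κ k i else 0 := fun k i => by
      change (if 1 < α then (if 1 < α then κ k i else 0) else 0) = _
      split_ifs <;> rfl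
    refine ⟨fun t ht hc k => ⟨?_, fun x => ?_⟩, fun k x t ht => ?_,
      sepForm_mem_polySpace D.delta, fun k i => ?_, fun k x => ?_, fun k i => ?_, fun k x => ?_,
      fun k t => ?_, fun k l t => ?_⟩
    · unfold sepForm; fun_prop
    · have hcr : ∀ i, ContinuousAt (D.rhs k i) t := by
        intro i
        rcases hc with hc | hc
        · have ho : t ∈ offGrid τ := (mem_offGrid_iff hτ).2 fun n hn => by
            have hn0 : 0 < n := by
              by_contra hle
              have : (n : ℝ) ≤ 0 := by exact_mod_cast not_lt.1 hle
              nlinarith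
            lift n to ℕ using hn0.le
            exact hc n (by exact_mod_cast hn)
          have ho' : t - τ ∈ offGrid τ := by simpa using sub_mul_mem_offGrid hτ ho 1
          exact Problem.continuousAt_rhs k i
            (fun k => Problem.continuousAt_delta k i (by change -τ < t; linarith) ho)
            (fun k => Problem.continuousAt_delta k i (by change -τ < t - τ; linarith) ho')
        · exact Problem.continuousAt_rhs k i (fun k => (hc k i).1) (fun k => (hc k i).2)
      refine ⟨((combU k x).1 t ht hcr).1, ((combU k x).1 t ht hcr).2.trans ?_⟩
      rw [show delayRHS P τ (sepForm D.delta) k x t = _ from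
        Problem.delayRHS_sepForm (D := D) h1 h2 h3 k x t]
      ring
    · rw [sepForm, D.delta_of_nonpos k 0 ht.2, D.delta_of_nonpos k 1 ht.2]
    · simpa only [eb] using (combδ k i).1
    · have h := (combU k x).2.1
      rwa [show 1 * D.b₁ k 0 + x * D.b₁ k 1 = β k 0 + β k 1 * x by
        change 1 * β k 0 + x * β k 1 = _; ring] at h
    · have h := (combδ k i).2
      rw [eb, eκ] at h
      exact h
    · have h := (combU k x).2.2
      have e : (if 1 < D.α then 1 * D.b₂ k 0 + x * D.b₂ k 1 else 0)
          = if 1 < α then κ k 0 + κ k 1 * x else 0 := by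
        by_cases hlt : 1 < α
        · have hb : ∀ i, D.b₂ k i = κ k i := fun i => if_pos hlt
          rw [if_pos hlt, hb, hb, if_pos (show 1 < D.α from hlt)]; ring
        · rw [if_neg hlt, if_neg (show ¬ 1 < D.α from hlt)]
      rw [e] at h
      exact h
    · simp [sepForm]
    · simp [sepForm, mul_comm]
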